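/- Let $(M,S,D)$ be a constraint manifold: $M$ is a smooth manifold, $j:S\hookrightarrow M$ is a closed embedded submanifold, and $D\subset TS$ is a regular foliation (a smooth involutive distribution of constant rank) whose leaf space $M_{\mathrm{red}}=S/D$ is a smooth manifold, i.e. there is a surjective submersion $\pi:S\to M_{\mathrm{red}}$ whose fibres are the leaves of $D$ (so $\ker d\pi=D$). Manifolds are finite-dimensional, Hausdorff, second countable and without boundary; $\Gamma(D)$ denotes the smooth vector fields on $S$ with values in $D$. Put $A=C^\infty(M)$, $A_0=I_S=\{f\in A: f\circ j=0\}$, and let $\mathfrak X(A)$ be the derivations of $A$, with $\mathfrak X(A)_W=\{X: X(A_0)\subset A_0\}$ and $\mathfrak X(A)_0=\{X: X(A)\subset A_0\}$. Let $\mathcal F=\{X\in\mathfrak X(A): X|_S\in\Gamma(D)\}$. Define * $A'_W=\{f\in A: X(f)\in A_0 \text{ for all }X\in\mathcal F\}$, $A'_0=A_0$, $A'_{\mathrm{red}}=A'_W/A'_0$; * $\mathfrak Y_W=\{X\in\mathfrak X(A)_W: [\mathcal F,X]\subset\mathcal F\}$, $\mathfrak Y_0=\mathcal F$, $\mathfrak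 Y_{\mathrm{red}}=\mathfrak Y_W/\mathfrak Y_0$, a Lie–Rinehart algebra over $A'_{\mathrm{red}}$; * $B=\mathrm{CE}(\mathfrak X(A))$, where $B^k$ is the module of alternating $A$-multilinear maps $\mathfrak X(A)^k\to A$, with the usual operators $d$, $\iota_X$, $L_X$; $B_0^k$ consists of the $\alpha$ with $\alpha(Y_1,\dots,Y_k)\in A_0$ for all $Y_i\in\mathfrak X(A)_W$, and $B_W^k$ of the $\alpha$ with $\alpha(Y_1,\dots,Y_k)\in A_0$ whenever all $Y_i\in\mathfrak X(A)_W$ and at least one $Y_i\in\mathfrak X(A)_0$; * $B'_W=\{\alpha\in B_W: \iota_X\alpha,\ L_X\alpha\in B_0\text{ for all }X\in\mathfrak Y_0\}$, $B'_0=B_0$, $B'_{\mathrm{red}}=B'_W/B'_0$. Then the following hold. 1. Vector fields on $M$ are the derivations of $A$, via $Y\mapsto(f\mapsto Yf)$, and, for every $k$, differential $k$-forms $\sigma$ on $M$ are the elements $\alpha$ of $B^k$, via $\alpha(Y_1,\dots,Y_k)=\sigma(Y_1,\dots,Y_k)$. Under these identifications * $A'_W$ is the set of functions $f\in A$ for which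 $f\circ j$ is constant on the leaves of $D$; * $\mathfrak Y_0\subset\mathfrak Y_W$, $B'_0\subset B'_W$; * $\mathfrak Y_W=\{Y\in\mathfrak X(M): Y|_S\in\mathfrak X(S),\ [Y|_S,\Gamma(D)]\subset\Gamma(D)\}$ and $\mathfrak Y_0=\{Y\in\mathfrak X(M): Y|_S\in\Gamma(D)\}$; * $B'_W=\{\sigma\in\Omega(M): \iota_W j^*\sigma=0,\ L_W j^*\sigma=0\text{ for all }W\in\Gamma(D)\}$ and $B'_0=\{\sigma\in\Omega(M): j^*\sigma=0\}$. 2. There is an algebra isomorphism $\varphi:A'_{\mathrm{red}}\to C^\infty(M_{\mathrm{red}})$ with $\varphi([f])\circ\pi=f\circ j$, and, over $\varphi$, an isomorphism of Lie–Rinehart algebras $\Phi:\mathfrak Y_{\mathrm{red}}\to\mathfrak X(M_{\mathrm{red}})$ which sends $[Y]$ to the $\pi$-projection of $Y|_S$: $\Phi([Y])_{\pi(s)}=d\pi_s\big((Y|_S)_s\big)$ for all $s\in S$. 3. For every $k$ there is a linear isomorphism $\Psi:B'^{\,k}_{\mathrm{red}}\to\Omega^k(M_{\mathrm{red}})$ with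 $\pi^*\Psi([\sigma])=j^*\sigma$. These isomorphisms are linear over $\varphi$, they commute with the differentials (in particular $dB'_W\subset B'_W$), and $\Psi([\iota_X\alpha])=\iota_{\Phi([X])}\Psi([\alpha])$ for all $X\in\mathfrak Y_W$ and $\alpha\in B'_W$ (in particular $\iota_X\alpha\in B'_W$). -/

import Mathlib

open scoped Manifold ContDiff

/-! ### Constraint reduction of a commutative algebra -/

namespace ConstraintReduction

section Reduction

variable {S M : Type*} [CommRing S] [AddCommGroup M] [Module S M]

/-- The reduction `V_W / V_0` of a constraint module `V_0 ⊆ V_W ⊆ V_T`. -/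
def Red (W N : Submodule S M) : Type _ := W ⧸ N.comap W.subtype

instance Red.addCommGroup (W N : Submodule S M) : AddCommGroup (Red W N) :=
  inferInstanceAs (AddCommGroup (W ⧸ N.comap W.subtype))

instance Red.module (W N : Submodule S M) : Module S (Red W N) :=
  inferInstanceAs (Module S (W ⧸ N.comap W.subtype))

/-- The class in `V_W / V_0` of an element of `V_W`. -/
def Red.mk {W N : Submodule S M} (x : M) (hx : x ∈ W) : Red W N :=
  (N.comap W.subtype).mkQ ⟨x, hx⟩

lemma Red.exists_mk {W N : Submodule S M} (y : Red W N) : ∃ x, ∃ hx : x ∈ W, Red.mk x hx = y := by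
  obtain ⟨x, rfl⟩ := Submodule.mkQ_surjective (N.comap W.subtype) y
  exact ⟨x.1, x.2, rfl⟩

lemma Red.mk_eq_zero {W N : Submodule S M} {x : M} (hx : x ∈ W) :
    (Red.mk x hx : Red W N) = 0 ↔ x ∈ N :=
  Submodule.Quotient.mk_eq_zero (N.comap W.subtype)

end Reduction

section Algebraic

variable {R A : Type*} [CommRing R] [CommRing A] [Algebra R A]

/-- `𝔛(A)_W` for the constraint algebra `(A, A, I)`: the derivations preserving `I`. -/
def derWobs (I : Ideal A) : LieSubalgebra R (Derivation R A A) where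
  carrier := {X | ∀ a ∈ I, X a ∈ I}
  add_mem' hX hY a ha := I.add_mem (hX a ha) (hY a ha)
  zero_mem' _ _ := I.zero_mem
  smul_mem' c X hX a ha := by
    rw [Derivation.smul_apply, algebra_compatible_smul A c (X a)]
    exact I.mul_mem_left _ (hX a ha)
  lie_mem' {X Y} hX hY a ha := by
    rw [Derivation.commutator_apply]
    exact I.sub_mem (hX _ (hY a ha)) (hY _ (hX a ha))

/-- `𝔛(A)_0` for the constraint algebra `(A, A, I)`: the derivations mapping `A` into `I`. -/
def derNull (I : Ideal A) : Submodule A (Derivation R A A) where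
  carrier := {X | ∀ a, X a ∈ I}
  add_mem' hX hY a := I.add_mem (hX a) (hY a)
  zero_mem' _ := I.zero_mem
  smul_mem' c _ hX a := I.mul_mem_left c (hX a)

variable (R A) in
/-- An ideal `I` of `A` with an `A`-module `𝓕` of symmetries,
`𝔛(A)_0 ⊆ 𝓕 ⊆ 𝔛(A)_W`. -/
structure SymmetryData where
  /-- the ideal `A_0` -/
  I : Ideal A
  /-- the symmetries -/
  F : Submodule A (Derivation R A A)
  null_le : derNull I ≤ F
  le_wobs : ∀ X ∈ F, X ∈ derWobs (R := R) I

namespace SymmetryData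

variable (P : SymmetryData R A)

/-- `A'_W = {f | 𝓕 f ⊆ A_0}`. -/
def algWobs : Subalgebra R A where
  carrier := {f | ∀ X ∈ P.F, X f ∈ P.I}
  add_mem' {f g} hf hg X hX := by
    rw [map_add]; exact P.I.add_mem (hf X hX) (hg X hX)
  mul_mem' {f g} hf hg X hX := by
    rw [Derivation.leibniz]
    exact P.I.add_mem (P.I.mul_mem_left _ (hg X hX)) (P.I.mul_mem_left _ (hf X hX))
  algebraMap_mem' r X _ := by
    rw [Derivation.map_algebraMap]; exact P.I.zero_mem

/-- `A'_0 = A_0`, as an ideal of `A'_W`. -/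
def algNull : Ideal P.algWobs := P.I.comap P.algWobs.val.toRingHom

/-- The reduced algebra `A'_red = A'_W / A'_0`. -/
abbrev AlgRed : Type _ := P.algWobs ⧸ P.algNull

/-- `𝔜_W`: the normalizer of `𝓕` in `𝔛(A)_W`. -/
def lieWobs : LieSubalgebra R (Derivation R A A) where
  carrier := {X | X ∈ derWobs (R := R) P.I ∧ ∀ Y ∈ P.F, ⁅Y, X⁆ ∈ P.F}
  add_mem' {X X'} hX hX' := ⟨add_mem hX.1 hX'.1, fun Y hY => by
    rw [lie_add]; exact P.F.add_mem (hX.2 Y hY) (hX'.2 Y hY)⟩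
  zero_mem' := ⟨zero_mem _, fun Y _ => by rw [lie_zero]; exact P.F.zero_mem⟩
  smul_mem' c X hX := ⟨(derWobs (R := R) P.I).smul_mem c hX.1, fun Y hY => by
    rw [lie_smul, algebra_compatible_smul A c]; exact P.F.smul_mem _ (hX.2 Y hY)⟩
  lie_mem' {X X'} hX hX' := ⟨LieSubalgebra.lie_mem _ hX.1 hX'.1, fun Y hY => by
    rw [leibniz_lie, ← lie_skew X ⁅Y, X'⁆, ← sub_eq_add_neg]
    exact P.F.sub_mem (hX'.2 _ (hX.2 Y hY)) (hX.2 _ (hX'.2 Y hY))⟩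

/-- `𝔜_0 = 𝓕`, as an ideal of the Lie algebra `𝔜_W`. -/
def lieNull : LieIdeal R P.lieWobs where
  carrier := {X | (X : Derivation R A A) ∈ P.F}
  add_mem' hX hY := P.F.add_mem hX hY
  zero_mem' := P.F.zero_mem
  smul_mem' c X hX := by
    change c • (X : Derivation R A A) ∈ P.F
    rw [algebra_compatible_smul A c]; exact P.F.smul_mem _ hX
  lie_mem {X Y} hY := by
    change ⁅(X : Derivation R A A), (Y : Derivation R A A)⁆ ∈ P.F
    rw [← lie_skew]; exact P.F.neg_mem (X.2.2 _ hY)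

/-- The reduced Lie algebra `𝔜_red = 𝔜_W / 𝔜_0`. -/
abbrev LieRed : Type _ := P.lieWobs ⧸ P.lieNull

lemma smul_mem_lieWobs {f : A} (hf : f ∈ P.algWobs) {X : Derivation R A A}
    (hX : X ∈ P.lieWobs) : f • X ∈ P.lieWobs := by
  refine ⟨fun a ha => P.I.mul_mem_left f (hX.1 a ha), fun Y hY => ?_⟩
  rw [LieRinehartRing.leibniz_smul_right]
  exact P.F.add_mem (P.F.smul_mem f (hX.2 Y hY))
    (P.null_le fun a => P.I.mul_mem_right _ (hf Y hY))

lemma apply_mem_algWobs {X : Derivation R A A} (hX : X ∈ P.lieWobs) {f : A}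
    (hf : f ∈ P.algWobs) : X f ∈ P.algWobs := fun Y hY => by
  have h : Y (X f) = ⁅Y, X⁆ f + X (Y f) := by rw [Derivation.commutator_apply]; ring
  rw [h]
  exact P.I.add_mem (hf _ (hX.2 Y hY)) (hX.1 _ (hf Y hY))

/-- Multiplication of `𝔜_red` by an element of `A'_W`. -/
def smulRed (f : P.algWobs) : P.LieRed →ₗ[R] P.LieRed :=
  Submodule.mapQ P.lieNull.toSubmodule P.lieNull.toSubmodule
    { toFun := fun X => ⟨(f : A) • (X : Derivation R A A), P.smul_mem_lieWobs f.2 X.2⟩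
      map_add' := fun _ _ => Subtype.ext (smul_add _ _ _)
      map_smul' := fun _ _ => Subtype.ext (smul_comm _ _ _) }
    (fun _ hX => P.F.smul_mem _ hX)

/-- The ring map through which `A'_red` acts on `𝔜_red`. -/
def smulRedHom : P.AlgRed →+* Module.End R P.LieRed :=
  Ideal.Quotient.lift P.algNull
    { toFun := P.smulRed
      map_one' := Submodule.linearMap_qext _ (LinearMap.ext fun X =>
        congrArg (Submodule.Quotient.mk (p := P.lieNull.toSubmodule))
          (Subtype.ext (one_smul A (X : Derivation R A A))))
      map_mul' := fun f g => Submodule.linearMap_qext _ (LinearMap.ext fun X =>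
        congrArg (Submodule.Quotient.mk (p := P.lieNull.toSubmodule))
          (Subtype.ext (mul_smul (f : A) (g : A) (X : Derivation R A A))))
      map_zero' := Submodule.linearMap_qext _ (LinearMap.ext fun X =>
        congrArg (Submodule.Quotient.mk (p := P.lieNull.toSubmodule))
          (Subtype.ext (zero_smul A (X : Derivation R A A))))
      map_add' := fun f g => Submodule.linearMap_qext _ (LinearMap.ext fun X =>
        congrArg (Submodule.Quotient.mk (p := P.lieNull.toSubmodule))
          (Subtype.ext (add_smul (f : A) (g : A) (X : Derivation R A A)))) }
    (fun _ hf => Submodule.linearMap_qext _ (LinearMap.ext fun _ =>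
      (Submodule.Quotient.mk_eq_zero P.lieNull.toSubmodule).2
        (P.null_le fun _ => P.I.mul_mem_right _ hf)))

/-- `𝔜_red` as an `A'_red`-module: `[f] • [X] = [f X]`. -/
instance : Module P.AlgRed P.LieRed := Module.compHom P.LieRed P.smulRedHom

/-- Action of an element of `𝔜_W` on `A'_red`. -/
def actRed (X : P.lieWobs) : Module.End R P.AlgRed :=
  Submodule.mapQ (P.algNull.restrictScalars R) (P.algNull.restrictScalars R)
    { toFun := fun f => ⟨(X : Derivation R A A) f, P.apply_mem_algWobs X.2 f.2⟩
      map_add' := fun _ _ => Subtype.ext (map_add _ _ _)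
      map_smul' := fun _ _ => Subtype.ext (Derivation.map_smul _ _ _) }
    (fun f hf => X.2.1 f hf)

lemma actRed_mk (X : P.lieWobs) (f : P.algWobs) :
    P.actRed X (Ideal.Quotient.mk P.algNull f) = Ideal.Quotient.mk P.algNull
      ⟨(X : Derivation R A A) f, P.apply_mem_algWobs X.2 f.2⟩ := rfl

lemma actRed_eq_zero (X : P.lieWobs) (hX : (X : Derivation R A A) ∈ P.F) : P.actRed X = 0 := by
  refine LinearMap.ext fun a => ?_
  obtain ⟨f, rfl⟩ := Ideal.Quotient.mk_surjective a
  rw [actRed_mk]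
  exact Ideal.Quotient.eq_zero_iff_mem.2 (f.2 _ hX)

/-- The linear map through which `𝔜_red` acts on `A'_red`. -/
def actRedHom : P.LieRed →ₗ[R] Module.End R P.AlgRed :=
  Submodule.liftQ P.lieNull.toSubmodule
    { toFun := P.actRed
      map_add' := fun X Y => LinearMap.ext fun a => by
        obtain ⟨f, rfl⟩ := Ideal.Quotient.mk_surjective a
        rw [LinearMap.add_apply, actRed_mk, actRed_mk, actRed_mk, ← map_add]
        rfl
      map_smul' := fun c X => LinearMap.ext fun a => by
        obtain ⟨f, rfl⟩ := Ideal.Quotient.mk_surjective a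
        rfl }
    (fun X hX => LinearMap.mem_ker.2 (P.actRed_eq_zero X hX))

/-- The action of `𝔜_red` on `A'_red`: `[X] [f] = [X f]`. -/
instance : LieRingModule P.LieRed P.AlgRed where
  bracket x a := P.actRedHom x a
  add_lie x y a := by rw [map_add]; rfl
  lie_add x a b := map_add _ _ _
  leibniz_lie x y a := by
    obtain ⟨X, rfl⟩ := Submodule.Quotient.mk_surjective _ x
    obtain ⟨Y, rfl⟩ := Submodule.Quotient.mk_surjective _ y
    obtain ⟨f, rfl⟩ := Ideal.Quotient.mk_surjective a
    change Ideal.Quotient.mk P.algNull _ =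
      Ideal.Quotient.mk P.algNull _ + Ideal.Quotient.mk P.algNull _
    rw [← map_add]
    refine congrArg _ (Subtype.ext ?_)
    change (X : Derivation R A A) ((Y : Derivation R A A) f) =
      ⁅(X : Derivation R A A), (Y : Derivation R A A)⁆ f +
        (Y : Derivation R A A) ((X : Derivation R A A) f)
    rw [Derivation.commutator_apply]; ring

instance : LieRinehartRing P.AlgRed P.LieRed where
  lie_smul_eq_mul' a b x := by
    obtain ⟨X, rfl⟩ := Submodule.Quotient.mk_surjective _ x
    obtain ⟨f, rfl⟩ := Ideal.Quotient.mk_surjective a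
    obtain ⟨g, rfl⟩ := Ideal.Quotient.mk_surjective b
    rfl
  leibniz_mul_right' x a b := by
    obtain ⟨X, rfl⟩ := Submodule.Quotient.mk_surjective _ x
    obtain ⟨f, rfl⟩ := Ideal.Quotient.mk_surjective a
    obtain ⟨g, rfl⟩ := Ideal.Quotient.mk_surjective b
    refine congrArg (Ideal.Quotient.mk P.algNull) (Subtype.ext ?_)
    change (X : Derivation R A A) ((f : A) * (g : A)) =
      (f : A) * (X : Derivation R A A) g + (X : Derivation R A A) f * (g : A)
    rw [Derivation.leibniz, smul_eq_mul, smul_eq_mul]; ring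
  leibniz_smul_right' x y a := by
    obtain ⟨X, rfl⟩ := Submodule.Quotient.mk_surjective _ x
    obtain ⟨Y, rfl⟩ := Submodule.Quotient.mk_surjective _ y
    obtain ⟨f, rfl⟩ := Ideal.Quotient.mk_surjective a
    refine congrArg (Submodule.Quotient.mk (p := P.lieNull.toSubmodule)) (Subtype.ext ?_)
    exact LieRinehartRing.leibniz_smul_right (X : Derivation R A A) (Y : Derivation R A A) (f : A)

instance : LieRinehartAlgebra R P.AlgRed P.LieRed where
  smul_assoc c a x := by
    obtain ⟨X, rfl⟩ := Submodule.Quotient.mk_surjective _ x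
    obtain ⟨f, rfl⟩ := Ideal.Quotient.mk_surjective a
    exact congrArg (Submodule.Quotient.mk (p := P.lieNull.toSubmodule))
      (Subtype.ext (smul_assoc c (f : A) (X : Derivation R A A)))
  smul_lie c x a := by
    obtain ⟨X, rfl⟩ := Submodule.Quotient.mk_surjective _ x
    obtain ⟨f, rfl⟩ := Ideal.Quotient.mk_surjective a
    rfl
  lie_smul c x a := map_smul (P.actRedHom x) c a

end SymmetryData

variable (R A) in
/-- `CE^k(𝔛(A))_T = (Λ^k_A 𝔛(A))^*`: alternating `A`-multilinear forms on the derivations of `A`. -/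
abbrev CE (k : ℕ) : Type _ := Derivation R A A [⋀^Fin k]→ₗ[A] A

/-- The Lie derivative
`(L_X α)(Y_1, …, Y_k) = X (α (Y_1, …, Y_k)) - ∑ i, α (Y_1, …, [X, Y_i], …, Y_k)`. -/
def lieDer {k : ℕ} (X : Derivation R A A) (α : CE R A k) : CE R A k where
  toFun Y := X (α Y) - ∑ i, α (Function.update Y i ⁅X, Y i⁆)
  map_update_add' := by
    intro _ Y i x y
    have hdec : ‹DecidableEq (Fin k)› = instDecidableEqFin k := Subsingleton.elim _ _
    subst hdec
    have key : ∀ j, α (Function.update (Function.update Y i (x + y)) j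
          ⁅X, Function.update Y i (x + y) j⁆) =
        α (Function.update (Function.update Y i x) j ⁅X, Function.update Y i x j⁆) +
        α (Function.update (Function.update Y i y) j ⁅X, Function.update Y i y j⁆) := by
      intro j
      by_cases h : j = i
      · subst h
        simp only [Function.update_idem, Function.update_self, lie_add,
          AlternatingMap.map_update_add]
      · simp only [Function.update_of_ne h, Function.update_comm (Ne.symm h),
          AlternatingMap.map_update_add]
    simp only [key, AlternatingMap.map_update_add, map_add, Finset.sum_add_distrib]
    abel
  map_update_smul' := by
    intro _ Y i c x
    have hdec : ‹DecidableEq (Fin k)› = instDecidableEqFin k := Subsingleton.elim _ _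
    subst hdec
    have key : ∀ j, α (Function.update (Function.update Y i (c • x)) j
          ⁅X, Function.update Y i (c • x) j⁆) =
        c • α (Function.update (Function.update Y i x) j ⁅X, Function.update Y i x j⁆) +
        if j = i then X c • α (Function.update Y i x) else 0 := by
      intro j
      by_cases h : j = i
      · subst h
        simp only [Function.update_idem, Function.update_self,
          LieRinehartRing.leibniz_smul_right, Derivation.bracket_eq_fun,
          AlternatingMap.map_update_add, AlternatingMap.map_update_smul, if_true]
      · simp only [Function.update_of_ne h, Function.update_comm (Ne.symm h),
          AlternatingMap.map_update_smul, if_neg h, add_zero]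
    simp only [key, AlternatingMap.map_update_smul, Finset.sum_add_distrib, smul_eq_mul,
      Derivation.leibniz, Finset.sum_ite_eq', Finset.mem_univ, if_true, ← Finset.mul_sum]
    ring
  map_eq_zero_of_eq' := by
    intro Y i j hij hne
    have hz : α Y = 0 := α.map_eq_zero_of_eq Y hij hne
    have hs : ∑ l, α (Function.update Y l ⁅X, Y l⁆) =
        α (Function.update Y i ⁅X, Y i⁆) + α (Function.update Y j ⁅X, Y j⁆) := by
      refine Finset.sum_eq_add i j hne (fun l _ hl => ?_) (by simp) (by simp)
      exact α.map_eq_zero_of_eq _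
        (by rw [Function.update_of_ne hl.1.symm, Function.update_of_ne hl.2.symm, hij]) hne
    have hsw : Function.update Y j ⁅X, Y j⁆ =
        Function.update Y i ⁅X, Y i⁆ ∘ Equiv.swap i j := by
      funext l
      by_cases h1 : l = i
      · subst h1; simp [Function.update_of_ne hne, Function.update_of_ne hne.symm, hij]
      · by_cases h2 : l = j
        · subst h2; simp [hij]
        · simp [Equiv.swap_apply_of_ne_of_ne h1 h2, Function.update_of_ne h1,
            Function.update_of_ne h2]
    rw [hz, map_zero, hs, hsw, α.map_swap _ hne, add_neg_cancel, sub_zero]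

/-- The contraction `ι_X`, which is zero in degree zero. -/
def contract (X : Derivation R A A) : ∀ {k : ℕ}, CE R A k → CE R A (k - 1)
  | 0, _ => 0
  | _ + 1, α => α.curryLeft X

/-- The Chevalley–Eilenberg differential of a cochain of a Lie ring `L` with values in an
`L`-module `V`:
`(d α)(X_0, …, X_k) = ∑ i, (-1)^i X_i (α (…, X̂_i, …)) +
  ∑ i < j, (-1)^(i+j) α ([X_i, X_j], …, X̂_i, …, X̂_j, …)`;
in the second sum `[X_i, X_j]` has been moved to the place of `X_j`. -/
def ceDiff {L V : Type*} [LieRing L] [AddCommGroup V] [LieRingModule L V] {k : ℕ}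
    (α : (Fin k → L) → V) (X : Fin (k + 1) → L) : V :=
  ∑ i : Fin (k + 1), (-1 : ℤ) ^ (i : ℕ) •
    (⁅X i, α (i.removeNth X)⁆ -
      ∑ j ∈ Finset.univ.filter (fun j => i < j),
        α (i.removeNth (Function.update X j ⁅X i, X j⁆)))

namespace SymmetryData

variable (P : SymmetryData R A)

/-- `B_W` for `B = CE(𝔛(A))`: forms taking `𝔛(A)_W` to `A_W = A` (no condition),
and to `A_0` as soon as one argument is in `𝔛(A)_0`. -/
def formTan (k : ℕ) : Submodule P.algWobs (CE R A k) where
  carrier := {α | ∀ Y : Fin k → Derivation R A A, (∀ i, Y i ∈ derWobs (R := R) P.I) →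
    (∃ i, Y i ∈ derNull P.I) → α Y ∈ P.I}
  add_mem' hα hβ Y hY h := P.I.add_mem (hα Y hY h) (hβ Y hY h)
  zero_mem' _ _ _ := P.I.zero_mem
  smul_mem' c _ hα Y hY h := P.I.mul_mem_left (c : A) (hα Y hY h)

/-- `B'_0 = B_0` for `B = CE(𝔛(A))`: forms taking `𝔛(A)_W` to `A_0`. -/
def formNull (k : ℕ) : Submodule P.algWobs (CE R A k) where
  carrier := {α | ∀ Y : Fin k → Derivation R A A, (∀ i, Y i ∈ derWobs (R := R) P.I) → α Y ∈ P.I}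
  add_mem' hα hβ Y hY := P.I.add_mem (hα Y hY) (hβ Y hY)
  zero_mem' _ _ := P.I.zero_mem
  smul_mem' c _ hα Y hY := P.I.mul_mem_left (c : A) (hα Y hY)

lemma contract_smul_mem {k : ℕ} {f : A} {X : Derivation R A A} {α : CE R A k}
    (h : contract X α ∈ P.formNull (k - 1)) : contract X (f • α) ∈ P.formNull (k - 1) := by
  cases k with
  | zero => exact h
  | succ k => exact fun Y hY => P.I.mul_mem_left f (h Y hY)

lemma contract_add_mem {k : ℕ} {X : Derivation R A A} {α β : CE R A k}
    (h : contract X α ∈ P.formNull (k - 1)) (h' : contract X β ∈ P.formNull (k - 1)) :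
    contract X (α + β) ∈ P.formNull (k - 1) := by
  cases k with
  | zero => exact h
  | succ k => exact fun Y hY => P.I.add_mem (h Y hY) (h' Y hY)

lemma contract_zero_mem {k : ℕ} {X : Derivation R A A} :
    contract X (0 : CE R A k) ∈ P.formNull (k - 1) := by
  cases k with
  | zero => exact zero_mem _
  | succ k => exact fun Y _ => P.I.zero_mem

/-- `B'_W = {α ∈ B_W | ι_X α, L_X α ∈ B_0 for all X ∈ 𝔜_0}`, in degree `k`. -/
def formWobs (k : ℕ) : Submodule P.algWobs (CE R A k) where
  carrier := {α | α ∈ P.formTan k ∧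
    ∀ X ∈ P.F, contract X α ∈ P.formNull (k - 1) ∧ lieDer X α ∈ P.formNull k}
  add_mem' {α β} hα hβ := ⟨add_mem hα.1 hβ.1, fun X hX =>
    ⟨P.contract_add_mem (hα.2 X hX).1 (hβ.2 X hX).1, fun Y hY => by
      have h := P.I.add_mem ((hα.2 X hX).2 Y hY) ((hβ.2 X hX).2 Y hY)
      convert h using 1
      simp only [lieDer, AlternatingMap.coe_mk, MultilinearMap.coe_mk, AlternatingMap.add_apply,
        map_add, Finset.sum_add_distrib]
      abel⟩⟩
  zero_mem' := ⟨zero_mem _, fun X _ => ⟨P.contract_zero_mem, fun Y _ => by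
    simp [lieDer]⟩⟩
  smul_mem' f α hα := ⟨(P.formTan k).smul_mem f hα.1, fun X hX =>
    ⟨P.contract_smul_mem (hα.2 X hX).1, fun Y hY => by
      have h := P.I.add_mem (P.I.mul_mem_left (f : A) ((hα.2 X hX).2 Y hY))
        (P.I.mul_mem_left (α Y) (f.2 X hX))
      convert h using 1
      change X ((f : A) * α Y) - ∑ i, (f : A) * α (Function.update Y i ⁅X, Y i⁆) =
        (f : A) * (X (α Y) - ∑ i, α (Function.update Y i ⁅X, Y i⁆)) + α Y * X f
      rw [Derivation.leibniz, ← Finset.mul_sum, smul_eq_mul, smul_eq_mul]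
      ring⟩⟩

/-- The reduced forms `B'_red = B'_W / B'_0`, in degree `k`. -/
def FormRed (k : ℕ) : Type _ := Red (P.formWobs k) (P.formNull k)

instance (k : ℕ) : AddCommGroup (P.FormRed k) := Red.addCommGroup _ _

instance FormRed.moduleWobs (k : ℕ) : Module P.algWobs (P.FormRed k) := Red.module _ _

instance (k : ℕ) : Module R (P.FormRed k) :=
  Module.compHom (P.FormRed k) (algebraMap R P.algWobs)

/-- The class in `B'_red` of an element of `B'_W`. -/
def formMk {k : ℕ} (α : CE R A k) (hα : α ∈ P.formWobs k) : P.FormRed k := Red.mk α hα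

/-- `B'_red` as an `A'_red`-module: `[f] • [α] = [f α]`. -/
instance (k : ℕ) : Module P.AlgRed (P.FormRed k) :=
  Module.IsTorsionBySet.module (R := P.algWobs) (I := P.algNull) (by
    rintro x ⟨f, hf⟩
    obtain ⟨α, hα, rfl⟩ := Red.exists_mk x
    exact (Red.mk_eq_zero ((P.formWobs k).smul_mem f hα)).2
      fun Y _ => P.I.mul_mem_right (α Y) hf)

end SymmetryData

end Algebraic

noncomputable section Geometry

open VectorField

variable {E M : Type*} [NormedAddCommGroup E] [NormedSpace ℝ E]
  [TopologicalSpace M] [ChartedSpace E M]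

variable (E M) in
/-- `C^∞(M)`. -/
abbrev Fun : Type _ := C^∞⟮𝓘(ℝ, E), M; ℝ⟯

variable [IsManifold 𝓘(ℝ, E) ∞ M]

variable (E M) in
/-- `𝔛(M)`: the smooth vector fields on `M`. -/
abbrev VF : Type _ :=
  Cₛ^∞⟮𝓘(ℝ, E); E, fun x : M => TangentSpace 𝓘(ℝ, E) x⟯

lemma two_le_infty : (2 : ℕ∞ω) ≤ ∞ :=
  WithTop.coe_le_coe.2 (le_top : (2 : ℕ∞) ≤ ⊤)

lemma three_le_infty : (3 : ℕ∞ω) ≤ ∞ :=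
  WithTop.coe_le_coe.2 (le_top : (3 : ℕ∞) ≤ ⊤)

namespace VF

instance : SMul (Fun E M) (VF E M) where
  smul f X := ⟨fun x => f x • X x, f.contMDiff.smul_section X.contMDiff⟩

instance : Module (Fun E M) (VF E M) where
  one_smul X := ContMDiffSection.ext fun x => one_smul ℝ (X x)
  mul_smul f g X := ContMDiffSection.ext fun x => mul_smul (f x) (g x) (X x)
  smul_zero f := ContMDiffSection.ext fun x => smul_zero (f x)
  smul_add f X Y := ContMDiffSection.ext fun x => smul_add (f x) (X x) (Y x)
  add_smul f g X := ContMDiffSection.ext fun x => add_smul (f x) (g x) (X x)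
  zero_smul X := ContMDiffSection.ext fun x => zero_smul ℝ (X x)

lemma mdiffAt (X : VF E M) (x : M) :
    MDifferentiableAt 𝓘(ℝ, E) (𝓘(ℝ, E).prod 𝓘(ℝ, E))
      (fun y => (⟨y, X y⟩ : TangentBundle 𝓘(ℝ, E) M)) x :=
  (X.contMDiff x).mdifferentiableAt (by simp)

lemma fun_mdiffAt (f : Fun E M) (x : M) : MDifferentiableAt 𝓘(ℝ, E) 𝓘(ℝ, ℝ) f x :=
  (f.contMDiff x).mdifferentiableAt (by simp)

/-- The derivative `X f = df(X)` of a function along a vector field. -/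
instance : Bracket (VF E M) (Fun E M) where
  bracket X f := ⟨fun x => mvfderiv 𝓘(ℝ, E) f x (X x),
    (contMDiff_snd_tangentBundle_modelSpace ℝ 𝓘(ℝ, ℝ)).comp
      ((f.contMDiff.contMDiff_tangentMap (m := ∞) (by simp)).comp X.contMDiff)⟩

lemma lie_fun_apply (X : VF E M) (f : Fun E M) (x : M) :
    ⁅X, f⁆ x = mvfderiv 𝓘(ℝ, E) f x (X x) := rfl

variable [FiniteDimensional ℝ E]

/-- The Lie bracket of vector fields. -/
instance : Bracket (VF E M) (VF E M) where
  bracket X Y := ⟨mlieBracket 𝓘(ℝ, E) X Y, by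
    have := FiniteDimensional.complete ℝ E
    have : IsManifold 𝓘(ℝ, E) (minSmoothness ℝ 2) M :=
      IsManifold.of_le (n := ∞) (by simpa using two_le_infty)
    have : IsManifold 𝓘(ℝ, E) ((⊤ : ℕ∞) + 1) M := IsManifold.of_le (n := ∞) (by simp)
    intro x
    exact ContMDiffAt.mlieBracket_vectorField (n := ⊤) (m := ⊤) (X.contMDiff x) (Y.contMDiff x)
      (by simp)⟩

lemma lie_apply (X Y : VF E M) (x : M) : ⁅X, Y⁆ x = mlieBracket 𝓘(ℝ, E) X Y x := rfl

instance : LieRing (VF E M) where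
  add_lie X Y Z := ContMDiffSection.ext fun x =>
    have := FiniteDimensional.complete ℝ E
    mlieBracket_add_left (X.mdiffAt x) (Y.mdiffAt x)
  lie_add X Y Z := ContMDiffSection.ext fun x =>
    have := FiniteDimensional.complete ℝ E
    mlieBracket_add_right (Y.mdiffAt x) (Z.mdiffAt x)
  lie_self X := ContMDiffSection.ext fun x => by
    rw [lie_apply, mlieBracket_self]; rfl
  leibniz_lie X Y Z := ContMDiffSection.ext fun x => by
    have := FiniteDimensional.complete ℝ E
    have h3 : minSmoothness ℝ 3 ≤ ∞ := by simpa using three_le_infty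
    have h2 : minSmoothness ℝ 2 ≤ ∞ := by simpa using two_le_infty
    have : IsManifold 𝓘(ℝ, E) (minSmoothness ℝ 3) M := IsManifold.of_le h3
    exact leibniz_identity_mlieBracket_apply ((X.contMDiff x).of_le h2)
      ((Y.contMDiff x).of_le h2) ((Z.contMDiff x).of_le h2)

instance : LieAlgebra ℝ (VF E M) where
  lie_smul _ _ Y := ContMDiffSection.ext fun x =>
    have := FiniteDimensional.complete ℝ E
    mlieBracket_const_smul_right (Y.mdiffAt x)

section chart

/-- The derivative of a function along a vector field, in a chart. -/
lemma fderiv_chart (X : VF E M) (f : Fun E M) (x : M) {z : E}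
    (hz : z ∈ (extChartAt 𝓘(ℝ, E) x).target) :
    fderiv ℝ (f ∘ (extChartAt 𝓘(ℝ, E) x).symm) z
      (mpullbackWithin 𝓘(ℝ, E) 𝓘(ℝ, E) (extChartAt 𝓘(ℝ, E) x).symm X
        (Set.range 𝓘(ℝ, E)) z) = ⁅X, f⁆ ((extChartAt 𝓘(ℝ, E) x).symm z) := by
  have : IsManifold 𝓘(ℝ, E) 1 M := IsManifold.of_le (n := ∞) (by simp)
  have hinv := isInvertible_mfderivWithin_extChartAt_symm (I := 𝓘(ℝ, E)) hz
  have hd := mdifferentiableWithinAt_extChartAt_symm (I := 𝓘(ℝ, E)) hz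
  rw [lie_fun_apply]
  simp only [modelWithCornersSelf_coe, Set.range_id, mpullbackWithin_apply] at hinv hd ⊢
  rw [mfderivWithin_univ] at hinv ⊢
  rw [mdifferentiableWithinAt_univ] at hd
  have h1 := mvfderiv_comp_apply (I := 𝓘(ℝ, E)) (I' := 𝓘(ℝ, E)) z
    (fun_mdiffAt f ((extChartAt 𝓘(ℝ, E) x).symm z)) hd
    ((mfderiv 𝓘(ℝ, E) 𝓘(ℝ, E) (extChartAt 𝓘(ℝ, E) x).symm z).inverse
      (X ((extChartAt 𝓘(ℝ, E) x).symm z)))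
  have h2 : mfderiv 𝓘(ℝ, E) 𝓘(ℝ, E) (extChartAt 𝓘(ℝ, E) x).symm z
      ((mfderiv 𝓘(ℝ, E) 𝓘(ℝ, E) (extChartAt 𝓘(ℝ, E) x).symm z).inverse
      (X ((extChartAt 𝓘(ℝ, E) x).symm z))) = X ((extChartAt 𝓘(ℝ, E) x).symm z) := by
    obtain ⟨e, he⟩ := hinv
    rw [← he, ContinuousLinearMap.inverse_equiv]
    exact e.apply_symm_apply _
  rw [h2] at h1
  rw [← h1]
  change _ = (mfderiv 𝓘(ℝ, E) 𝓘(ℝ, ℝ) _ _) _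
  rw [mfderiv_eq_fderiv]
  rfl

/-- `[X, Y] f = X (Y f) - Y (X f)`. -/
lemma lie_lie_fun (X Y : VF E M) (f : Fun E M) : ⁅⁅X, Y⁆, f⁆ = ⁅X, ⁅Y, f⁆⁆ - ⁅Y, ⁅X, f⁆⁆ := by
  have := FiniteDimensional.complete ℝ E
  have : IsManifold 𝓘(ℝ, E) 1 M := IsManifold.of_le (n := ∞) (by simp)
  have : IsManifold 𝓘(ℝ, E) 2 M := IsManifold.of_le (n := ∞) two_le_infty
  ext x
  set φ := extChartAt 𝓘(ℝ, E) x with hφ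
  have htx : φ x ∈ φ.target := mem_extChartAt_target x
  have hopen : IsOpen φ.target := isOpen_extChartAt_target x
  have hback : φ.symm (φ x) = x := extChartAt_to_inv x
  set X' := mpullbackWithin 𝓘(ℝ, E) 𝓘(ℝ, E) φ.symm X (Set.range 𝓘(ℝ, E)) with hX'
  set Y' := mpullbackWithin 𝓘(ℝ, E) 𝓘(ℝ, E) φ.symm Y (Set.range 𝓘(ℝ, E)) with hY'
  have hdiff : ∀ Z : VF E M, DifferentiableAt ℝ
      (mpullbackWithin 𝓘(ℝ, E) 𝓘(ℝ, E) φ.symm Z (Set.range 𝓘(ℝ, E))) (φ x) := by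
    intro Z
    have h := contMDiffWithinAt_mpullbackWithin_extChartAt_symm (n := 2) (m := 1) (s := Set.univ)
      (x := x) (((Z.contMDiff x).of_le (by simp)).contMDiffWithinAt) uniqueMDiffOn_univ
      (Set.mem_univ x) (by norm_num)
    have h := contMDiffWithinAt_vectorSpace_iff_contDiffWithinAt.1 h
    exact (h.differentiableWithinAt (by simp)).differentiableAt (by
      rw [Set.preimage_univ, Set.inter_univ]; exact hopen.mem_nhds htx)
  have hf : ContDiffAt ℝ 2 (f ∘ φ.symm) (φ x) := by
    have h := (f.contMDiff (φ.symm (φ x))).comp (φ x)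
      ((contMDiffOn_extChartAt_symm (I := 𝓘(ℝ, E)) (n := ∞) x).contMDiffAt (hopen.mem_nhds htx))
    exact h.contDiffAt.of_le two_le_infty
  have hsec : ∀ Z : VF E M, (fun z => fderiv ℝ (f ∘ φ.symm) z
      (mpullbackWithin 𝓘(ℝ, E) 𝓘(ℝ, E) φ.symm Z (Set.range 𝓘(ℝ, E)) z)) =ᶠ[nhds (φ x)]
      ((⁅Z, f⁆ : Fun E M) ∘ φ.symm) := fun Z =>
    Filter.eventuallyEq_of_mem (hopen.mem_nhds htx) fun z hz => fderiv_chart Z f x hz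
  have key := fderiv_apply_lieBracket hf (by simp) (hdiff Y) (hdiff X)
  rw [(hsec Y).fderiv_eq, (hsec X).fderiv_eq, fderiv_chart X ⁅Y, f⁆ x htx,
    fderiv_chart Y ⁅X, f⁆ x htx, hback] at key
  change _ = ⁅X, ⁅Y, f⁆⁆ x - ⁅Y, ⁅X, f⁆⁆ x
  rw [← key, lie_fun_apply, lie_apply, ← mlieBracketWithin_univ, mlieBracketWithin_apply]
  simp only [modelWithCornersSelf_coe, Set.range_id, Set.preimage_univ, Set.inter_univ]
  have hinv := isInvertible_mfderiv_extChartAt (I := 𝓘(ℝ, E))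
    (mem_extChartAt_source (I := 𝓘(ℝ, E)) x)
  have hfx : ∀ v : TangentSpace 𝓘(ℝ, E) x, mvfderiv 𝓘(ℝ, E) f x v =
      fderiv ℝ (f ∘ φ.symm) (φ x) (mfderiv 𝓘(ℝ, E) 𝓘(ℝ, E) φ x v) := by
    intro v
    have h1 : (f : M → ℝ) =ᶠ[nhds x] (f ∘ φ.symm) ∘ φ :=
      Filter.eventuallyEq_of_mem (extChartAt_source_mem_nhds (I := 𝓘(ℝ, E)) x) fun y hy =>
        congrArg f (φ.left_inv hy).symm
    have h2 : MDifferentiableAt 𝓘(ℝ, E) 𝓘(ℝ, ℝ) (f ∘ φ.symm) (φ x) :=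
      (hf.differentiableAt (by norm_num)).mdifferentiableAt
    have h3 : mfderiv 𝓘(ℝ, E) 𝓘(ℝ, ℝ) f x = mfderiv 𝓘(ℝ, E) 𝓘(ℝ, ℝ) ((f ∘ φ.symm) ∘ φ) x :=
      h1.mfderiv_eq
    have h4 := mfderiv_comp_apply x h2
      (mdifferentiableAt_extChartAt (I := 𝓘(ℝ, E)) (mem_chart_source E x)) v
    rw [mfderiv_eq_fderiv] at h4
    change mfderiv 𝓘(ℝ, E) 𝓘(ℝ, ℝ) f x v = _
    rw [h3]
    exact h4
  rw [hfx]
  obtain ⟨e, he⟩ := hinv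
  rw [← he, ContinuousLinearMap.inverse_equiv]
  refine congrArg _ ((e.apply_symm_apply _).trans ?_)
  exact congrFun (lieBracketWithin_univ (𝕜 := ℝ) (E := E)) _

end chart

instance : LieRingModule (VF E M) (Fun E M) where
  add_lie X Y f := by
    ext x; exact map_add (mvfderiv 𝓘(ℝ, E) f x) (X x) (Y x)
  lie_add X f g := by
    ext x
    exact congrArg (fun L => L (X x)) (mvfderiv_add (fun_mdiffAt f x) (fun_mdiffAt g x))
  leibniz_lie X Y f := by rw [lie_lie_fun]; abel

instance : LieRinehartRing (Fun E M) (VF E M) where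
  lie_smul_eq_mul' f g X := by
    ext x; exact map_smul (mvfderiv 𝓘(ℝ, E) g x) (f x) (X x)
  leibniz_mul_right' X f g := by
    ext x
    refine (congrArg (fun L => L (X x)) (mvfderiv_mul (fun_mdiffAt f x) (fun_mdiffAt g x))).trans ?_
    change f x * mvfderiv 𝓘(ℝ, E) g x (X x) + g x * mvfderiv 𝓘(ℝ, E) f x (X x) =
      f x * mvfderiv 𝓘(ℝ, E) g x (X x) + mvfderiv 𝓘(ℝ, E) f x (X x) * g x
    ring
  leibniz_smul_right' X Y f := ContMDiffSection.ext fun x => by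
    have := FiniteDimensional.complete ℝ E
    refine (mlieBracket_smul_right (fun_mdiffAt f x) (Y.mdiffAt x)).trans ?_
    exact add_comm _ _

instance : LieRinehartAlgebra ℝ (Fun E M) (VF E M) where
  smul_assoc c f X := ContMDiffSection.ext fun x => smul_assoc c (f x) (X x)
  smul_lie c X f := by
    ext x; exact map_smul (mvfderiv 𝓘(ℝ, E) f x) c (X x)
  lie_smul c X f := by
    ext x
    have h := mvfderiv_smul (I := 𝓘(ℝ, E)) (a := fun _ : M => c) (x := x)
      mdifferentiableAt_const (fun_mdiffAt f x)
    refine (congrArg (fun L => L (X x)) h).trans ?_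
    rw [mvfderiv_const]
    simp only [ContinuousLinearMap.zero_smulRight, add_zero]
    rfl

end VF

variable (E M) in
/-- `Ω^k(M)`: families of alternating `k`-forms on the tangent spaces which are smooth, i.e. give a
smooth function whenever they are evaluated on smooth vector fields. -/
def DiffForm (k : ℕ) : Submodule ℝ (∀ x : M, TangentSpace 𝓘(ℝ, E) x [⋀^Fin k]→L[ℝ] ℝ) where
  carrier := {σ | ∀ V : Fin k → VF E M,
    ContMDiff 𝓘(ℝ, E) 𝓘(ℝ, ℝ) ∞ fun x => σ x fun i => V i x}
  add_mem' hσ hη V := (hσ V).add (hη V)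
  zero_mem' _ := contMDiff_const
  smul_mem' _ _ hσ V := contMDiff_const.mul (hσ V)

/-- The smooth function `σ(V_1, …, V_k)`. -/
def DiffForm.eval {k : ℕ} (σ : DiffForm E M k) (V : Fin k → VF E M) : Fun E M :=
  ⟨fun x => σ.1 x fun i => V i x, σ.2 V⟩

variable {E' M' : Type*} [NormedAddCommGroup E'] [NormedSpace ℝ E']
  [TopologicalSpace M'] [ChartedSpace E' M']

/-- The pullback `(h^* σ)_x (v_1, …, v_k) = σ_{h x} (dh v_1, …, dh v_k)`. -/
def pullback {k : ℕ} (h : M' → M) (σ : ∀ x : M, TangentSpace 𝓘(ℝ, E) x [⋀^Fin k]→L[ℝ] ℝ)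
    (x : M') : TangentSpace 𝓘(ℝ, E') x [⋀^Fin k]→L[ℝ] ℝ :=
  (σ (h x)).compContinuousLinearMap (mfderiv 𝓘(ℝ, E') 𝓘(ℝ, E) h x)

/-- The derivation `f ↦ Y f` of `C^∞(M)` given by a vector field `Y`. -/
def VF.toDer [FiniteDimensional ℝ E] (Y : VF E M) : Derivation ℝ (Fun E M) (Fun E M) :=
  LieRinehartAlgebra.anchor ℝ (Fun E M) (VF E M) Y

/-- The form `σ` represents the alternating map `α`:
`α(Y_1, …, Y_k) = σ(Y_1, …, Y_k)` for all vector fields `Y_i`. -/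
def Represents [FiniteDimensional ℝ E] {k : ℕ} (σ : DiffForm E M k) (α : CE ℝ (Fun E M) k) :
    Prop :=
  ∀ Y : Fin k → VF E M, α (fun i => (Y i).toDer) = DiffForm.eval σ Y

/-- `Γ(D)`: the smooth vector fields with values in `D`. -/
def secs (D : ∀ x : M, Submodule ℝ (TangentSpace 𝓘(ℝ, E) x)) : Set (VF E M) :=
  {W | ∀ x, W x ∈ D x}

variable (E M) in
/-- A regular foliation of `M`, given by its tangent distribution: a smooth involutive
distribution of constant rank. -/
structure RegularFoliation [FiniteDimensional ℝ E] where
  /-- the tangent distribution -/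
  D : ∀ x : M, Submodule ℝ (TangentSpace 𝓘(ℝ, E) x)
  const_rank : ∃ r : ℕ, ∀ x, Module.finrank ℝ (D x) = r
  smooth : ∀ x, ∀ v ∈ D x, ∃ W ∈ secs D, W x = v
  involutive : ∀ V ∈ secs D, ∀ W ∈ secs D, ⁅V, W⁆ ∈ secs D

namespace RegularFoliation

variable [FiniteDimensional ℝ E] (𝓓 : RegularFoliation E M)

/-- `x` and `y` lie on the same leaf: they are joined by a smooth curve tangent to the
foliation. -/
def SameLeaf (x y : M) : Prop :=
  ∃ γ : ℝ → M, ContMDiff 𝓘(ℝ, ℝ) 𝓘(ℝ, E) ∞ γ ∧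
    (∀ t, mfderiv 𝓘(ℝ, ℝ) 𝓘(ℝ, E) γ t (1 : ℝ) ∈ 𝓓.D (γ t)) ∧ γ 0 = x ∧ γ 1 = y

/-- The manifold `M'` with the map `p : M → M'` is the smooth leaf space of the foliation:
`p` is a surjective submersion whose fibres are the leaves; a leaf being an integral manifold of
the distribution, the tangent space of the fibre at `x` is `D x`. -/
structure IsLeafSpace (p : M → M') : Prop where
  submersion : Manifold.IsSubmersion 𝓘(ℝ, E) 𝓘(ℝ, E') ∞ p
  surjective : Function.Surjective p
  fibre : ∀ x y, p x = p y ↔ 𝓓.SameLeaf x y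
  tangent : ∀ x (v : TangentSpace 𝓘(ℝ, E) x),
    mfderiv 𝓘(ℝ, E) 𝓘(ℝ, E') p x v = 0 ↔ v ∈ 𝓓.D x

/-- A form `η` is basic: `ι_W η = 0` and `L_W η = 0` for all `W ∈ Γ(D)`. The first condition is
imposed in each slot, the second one is
`W (η(Z_1, …, Z_k)) = ∑ i, η(Z_1, …, [W, Z_i], …, Z_k)`. -/
def IsBasic {k : ℕ} (η : ∀ x : M, TangentSpace 𝓘(ℝ, E) x [⋀^Fin k]→L[ℝ] ℝ) : Prop :=
  ∀ W ∈ secs 𝓓.D, ∀ (Z : Fin k → VF E M) (x : M),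
    (∀ i, η x (Function.update (fun l => Z l x) i (W x)) = 0) ∧
    mvfderiv 𝓘(ℝ, E) (fun y => η y fun l => Z l y) x (W x) =
      ∑ i, η x (Function.update (fun l => Z l x) i (⁅W, Z i⁆ x))

end RegularFoliation

/-- The vector field `Y` on `M` restricts to the vector field `Z` on the submanifold
`j : M' → M`. -/
def Restricts [IsManifold 𝓘(ℝ, E') ∞ M'] (j : M' → M) (Y : VF E M) (Z : VF E' M') : Prop :=
  ∀ s, Y (j s) = mfderiv 𝓘(ℝ, E') 𝓘(ℝ, E) j s (Z s)

/-- The symmetry data of a constraint manifold: `I` is the ideal of functions vanishing on the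
submanifold `j : M' → M`, and `𝓕` consists of the derivations `X` of `C^∞(M)` with
`X|_{M'} ∈ Γ(D)`, that is, whose value at each point of the submanifold is the derivative along
some vector in `D`. -/
def symmetryData [IsManifold 𝓘(ℝ, E') ∞ M'] [FiniteDimensional ℝ E'] (j : M' → M)
    (𝓓 : RegularFoliation E' M') : SymmetryData ℝ (Fun E M) where
  I :=
    { carrier := {f | ∀ s, f (j s) = 0}
      add_mem' := fun {f g} hf hg s => by
        change f (j s) + g (j s) = 0
        rw [hf s, hg s, add_zero]
      zero_mem' := fun _ => rfl
      smul_mem' := fun g f hf s => by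
        change g (j s) * f (j s) = 0
        rw [hf s, mul_zero] }
  F :=
    { carrier := {X | ∀ s, ∃ v ∈ 𝓓.D s, ∀ f : Fun E M,
        X f (j s) = mvfderiv 𝓘(ℝ, E) f (j s) (mfderiv 𝓘(ℝ, E') 𝓘(ℝ, E) j s v)}
      add_mem' := fun {X Y} hX hY s => by
        obtain ⟨v, hv, h⟩ := hX s
        obtain ⟨w, hw, h'⟩ := hY s
        refine ⟨v + w, add_mem hv hw, fun f => ?_⟩
        rw [map_add, map_add, ← h, ← h']
        rfl
      zero_mem' := fun s => ⟨0, zero_mem _, fun f => by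
        rw [map_zero, map_zero]; rfl⟩
      smul_mem' := fun g X hX s => by
        obtain ⟨v, hv, h⟩ := hX s
        refine ⟨g (j s) • v, Submodule.smul_mem _ _ hv, fun f => ?_⟩
        rw [map_smul, map_smul, ← h]
        rfl }
  null_le X hX s := ⟨0, zero_mem _, fun f => by
    rw [map_zero, map_zero]; exact hX f s⟩
  le_wobs X hX f hf s := by
    obtain ⟨v, -, h⟩ := hX s
    rw [h]
    by_cases hj : MDifferentiableAt 𝓘(ℝ, E') 𝓘(ℝ, E) j s
    · rw [← mvfderiv_comp_apply s (VF.fun_mdiffAt f (j s)) hj]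
      have h0 : (f : M → ℝ) ∘ j = fun _ => 0 := funext hf
      rw [h0, mvfderiv_const]
      rfl
    · rw [mfderiv_zero_of_not_mdifferentiableAt hj]
      exact map_zero _

end Geometry

end ConstraintReduction

/-! All algebraic conditions are first transported to `S`, then to the leaf space. Two bridges from
algebra to geometry come at the start. By Hadamard's lemma a point derivation of `C^∞(M)` is a
tangent vector, so derivations are vector fields (`toDer_bijective`). By tensoriality the value of
an alternating `C^∞(M)`-multilinear map at a point depends only on the values of its arguments
there, so such maps are differential forms (`exists_unique_represents`).

From `M` to `S`: since `j` is a closed embedding, functions and vector fields on `S` extend to `M`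
(`exists_extension`, `exists_extension_vf`). Hence restriction identifies `A / I` with `C^∞(S)`, a
derivation preserving `I` is a field tangent to `S`, and a condition tested on `𝔛(A)_W` or on `𝓕` is
a condition on `S` tested on `𝔛(S)` or on `Γ(D)`. This turns the constraint objects into invariant
functions, normalizers of `Γ(D)` and basic forms.

From `S` to the leaf space: `ker dπ = D` says that `Γ(D)` consists of the fields `π`-related to
zero. Functions killed by `Γ(D)` are constant along leaves and descend through local sections. A
field normalizing `Γ(D)` acts on the functions pulled back from the quotient and so projects
(`exists_project`); conversely fields lift (`exists_lift`) and lifts normalize `Γ(D)`. A form on `S`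
is basic exactly when it is a pullback (`exists_form_of_isBasic`, `isBasic_of_pullback`).

Each reduction map sends a class to the unique object on the quotient whose pullback, or `π`-related
field, on `S` comes from the representative. Its kernel is the null part; surjectivity is lifting or
pulling back to `S` and extending to `M` (`exists_extension_form` for forms). Compatibility with
brackets, `d` and contractions is naturality under related fields together with uniqueness on the
quotient. That `d` stays within `A`-multilinear forms follows inductively from Cartan's formula
(`exists_ceDiff`). -/

namespace ConstraintReduction

noncomputable section

open VectorField Filter Topology

set_option linter.unusedSectionVars false

/-! ### Cutting off by bump functions, parametric integrals and Hadamard's lemma -/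

section LocalTools

variable {E M : Type*} [NormedAddCommGroup E] [NormedSpace ℝ E]
  [TopologicalSpace M] [ChartedSpace E M] [IsManifold 𝓘(ℝ, E) ∞ M]
  [FiniteDimensional ℝ E] [T2Space M]

/-- A real function which is smooth near `x` agrees near `x` with a smooth function. -/
lemma exists_fun_eventuallyEq {x : M} {f : M → ℝ} {s : Set M} (hs : IsOpen s) (hx : x ∈ s)
    (hf : ContMDiffOn 𝓘(ℝ, E) 𝓘(ℝ, ℝ) ∞ f s) : ∃ g : Fun E M, g =ᶠ[𝓝 x] f := by
  obtain ⟨χ, -, hχ⟩ := (SmoothBumpFunction.nhds_basis_tsupport (I := 𝓘(ℝ, E)) x).mem_iff.1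
    (hs.mem_nhds hx)
  refine ⟨⟨fun y => χ y • f y, contMDiff_of_tsupport fun y hy => ?_⟩, ?_⟩
  · have hy' := hs.mem_nhds (hχ (tsupport_smul_subset_left _ _ hy))
    exact χ.contMDiffAt.smul (hf.contMDiffAt hy')
  · filter_upwards [χ.eventuallyEq_one] with y hy
    change χ y • f y = f y
    rw [hy, Pi.one_apply, one_smul]

/-- A vector field which is smooth near `x` agrees near `x` with a smooth vector field. -/
lemma exists_vf_eventuallyEq {x : M} {V : ∀ y : M, TangentSpace 𝓘(ℝ, E) y} {s : Set M}
    (hs : IsOpen s) (hx : x ∈ s)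
    (hV : ContMDiffOn 𝓘(ℝ, E) (𝓘(ℝ, E).prod 𝓘(ℝ, E)) ∞
      (fun y => (⟨y, V y⟩ : TangentBundle 𝓘(ℝ, E) M)) s) :
    ∃ W : VF E M, ∀ᶠ y in 𝓝 x, W y = V y := by
  obtain ⟨χ, -, hχ⟩ := (SmoothBumpFunction.nhds_basis_tsupport (I := 𝓘(ℝ, E)) x).mem_iff.1
    (hs.mem_nhds hx)
  refine ⟨⟨fun y => χ y • V y, ?_⟩, ?_⟩
  · exact ContMDiffOn.smul_section_of_tsupport χ.contMDiff.contMDiffOn hs hχ hV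
  · filter_upwards [χ.eventuallyEq_one] with y hy
    change χ y • V y = V y
    rw [hy, Pi.one_apply, one_smul]

/-- A parametric integral over `[0, 1]` of a smooth function is smooth. -/
lemma contDiff_integral_param {G : E × ℝ → ℝ} (hG : ContDiff ℝ ∞ G) :
    ContDiff ℝ ∞ fun x => ∫ t in (0 : ℝ)..1, G (x, t) := by
  obtain ⟨χ, hχ⟩ : ∃ χ : ContDiffBump (0 : ℝ), χ.rIn = 2 := ⟨⟨2, 3, by norm_num, by norm_num⟩, rfl⟩
  -- The integral is the convolution at `0` of the indicator of `(0, 1]` with `s ↦ χ s * G (x, -s)`.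
  -- The cutoff supplies compact support and, having inner radius `2`, equals `1` wherever the
  -- indicator is nonzero.
  have key := MeasureTheory.contDiffOn_convolution_right_with_param_comp (𝕜 := ℝ) (G := ℝ)
    (μ := MeasureTheory.volume) (n := ⊤) (ContinuousLinearMap.mul ℝ ℝ) (s := (Set.univ : Set E))
    (v := fun _ => 0) contDiffOn_const (f := Set.indicator (Set.Ioc (0 : ℝ) 1) 1)
    (g := fun x s => χ s * G (x, -s)) (k := tsupport χ) isOpen_univ χ.hasCompactSupport
    (fun p x _ hx => by rw [image_eq_zero_of_notMem_tsupport hx, zero_mul])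
    ((MeasureTheory.integrable_indicator_iff measurableSet_Ioc).2
      (MeasureTheory.integrableOn_const (by simp)) |>.locallyIntegrable)
    (((χ.contDiff.comp contDiff_snd).mul
      (hG.comp (contDiff_fst.prodMk contDiff_snd.neg))).contDiffOn)
  rw [contDiffOn_univ] at key
  convert key using 2 with x
  rw [intervalIntegral.integral_of_le zero_le_one, ← MeasureTheory.integral_indicator
    measurableSet_Ioc]
  refine MeasureTheory.integral_congr_ae (Filter.Eventually.of_forall fun t => ?_)
  by_cases ht : t ∈ Set.Ioc (0 : ℝ) 1
  · have h1 : χ (0 - t) = 1 := χ.one_of_mem_closedBall (by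
      rw [hχ, zero_sub, mem_closedBall_zero_iff, norm_neg, Real.norm_of_nonneg ht.1.le]
      linarith [ht.2])
    simp only [Set.indicator_of_mem ht, ContinuousLinearMap.mul_apply', h1]
    simp
  · simp [Set.indicator_of_notMem ht]

/-- Hadamard's lemma. -/
lemma exists_hadamard {ι : Type*} [Fintype ι] (b : Module.Basis ι ℝ E) {F : E → ℝ}
    (hF : ContDiff ℝ ∞ F) (z₀ : E) : ∃ H : ι → E → ℝ, (∀ i, ContDiff ℝ ∞ (H i)) ∧
      ∀ z, F z = F z₀ + ∑ i, (b.repr z i - b.repr z₀ i) * H i z := by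
  have hdF : ContDiff ℝ ∞ (fderiv ℝ F) := hF.fderiv_right (by simp)
  have hc : ∀ i, ContDiff ℝ ∞ fun p : E × ℝ => fderiv ℝ F (z₀ + p.2 • (p.1 - z₀)) (b i) :=
    fun i => (hdF.comp (contDiff_const.add
      (contDiff_snd.smul (contDiff_fst.sub contDiff_const)))).clm_apply contDiff_const
  refine ⟨fun i z => ∫ t in (0 : ℝ)..1, fderiv ℝ F (z₀ + t • (z - z₀)) (b i),
    fun i => contDiff_integral_param (hc i), fun z => ?_⟩
  have hd : ∀ t ∈ Set.uIcc (0 : ℝ) 1, HasDerivAt (fun t : ℝ => F (z₀ + t • (z - z₀)))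
      (fderiv ℝ F (z₀ + t • (z - z₀)) (z - z₀)) t := fun t _ => by
    have h2 : HasDerivAt (fun t : ℝ => z₀ + t • (z - z₀)) (z - z₀) t := by
      simpa using ((hasDerivAt_id t).smul_const (z - z₀)).const_add z₀
    exact ((hF.differentiable (by simp)).differentiableAt.hasFDerivAt).comp_hasDerivAt t h2
  have hcont : ∀ v, Continuous fun t : ℝ => fderiv ℝ F (z₀ + t • (z - z₀)) v := fun v =>
    (hdF.continuous.comp (by fun_prop)).clm_apply continuous_const
  have hint := intervalIntegral.integral_eq_sub_of_hasDerivAt hd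
    ((hcont (z - z₀)).intervalIntegrable 0 1)
  have hsum : ∀ t : ℝ, fderiv ℝ F (z₀ + t • (z - z₀)) (z - z₀) =
      ∑ i, (b.repr z i - b.repr z₀ i) * fderiv ℝ F (z₀ + t • (z - z₀)) (b i) := fun t => by
    generalize fderiv ℝ F (z₀ + t • (z - z₀)) = L
    conv_lhs => rw [← b.sum_repr (z - z₀), map_sum]
    simp
  simp only [hsum, one_smul, zero_smul, add_zero, add_sub_cancel] at hint
  rw [intervalIntegral.integral_finsetSum fun i _ =>
    ((hcont (b i)).const_mul _).intervalIntegrable 0 1] at hint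
  simp only [intervalIntegral.integral_const_mul] at hint
  rw [hint]; ring

end LocalTools

/-! ### Local coordinates by global functions and fields -/

section LocalTools

variable {E M : Type*} [NormedAddCommGroup E] [NormedSpace ℝ E]
  [TopologicalSpace M] [ChartedSpace E M] [IsManifold 𝓘(ℝ, E) ∞ M]
  [FiniteDimensional ℝ E] [T2Space M]

/-- Local coordinates around `x₀` given by globally defined functions `g i` and vector fields
`e i`, with the Hadamard expansion of all smooth functions. -/
structure Coords (x₀ : M) where
  /-- the coordinate functions -/
  g : Fin (Module.finrank ℝ E) → Fun E M
  /-- the coordinate vector fields -/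
  e : Fin (Module.finrank ℝ E) → VF E M
  expand : ∀ᶠ x in 𝓝 x₀, ∀ v : TangentSpace 𝓘(ℝ, E) x,
    v = ∑ i, mvfderiv 𝓘(ℝ, E) (g i) x v • e i x
  dual : ∀ᶠ x in 𝓝 x₀, ∀ i l, mvfderiv 𝓘(ℝ, E) (g i) x (e l x) = if i = l then 1 else 0
  hadamard : ∀ f : Fun E M, ∃ h : Fin (Module.finrank ℝ E) → Fun E M, ∀ᶠ x in 𝓝 x₀,
    f x = f x₀ + ∑ i, (g i x - g i x₀) * h i x

/-- The chart components, the coordinate frame and the Hadamard coefficients are replaced by global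
objects with the same germ at `x₀`; all three properties are local, so they survive. -/
lemma exists_coords (x₀ : M) : Nonempty (Coords (E := E) x₀) := by
  have : IsManifold 𝓘(ℝ, E) 1 M := IsManifold.of_le (n := ∞) (by simp)
  set b := Module.finBasis ℝ E
  set φ := extChartAt 𝓘(ℝ, E) x₀ with hφ
  set T := trivializationAt E (TangentSpace 𝓘(ℝ, E) : M → Type _) x₀ with hT
  have hbase : T.baseSet = (chartAt E x₀).source := rfl
  have hsrc : φ.source = (chartAt E x₀).source := extChartAt_source _ _
  have hx₀ : x₀ ∈ (chartAt E x₀).source := mem_chart_source E x₀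
  have hopen := (chartAt E x₀).open_source
  have hφs : ContMDiffOn 𝓘(ℝ, E) 𝓘(ℝ, E) ∞ φ (chartAt E x₀).source := contMDiffOn_extChartAt
  have hcoord : ∀ i, ContDiff ℝ ∞ (fun z => b.repr z i) := fun i =>
    (LinearMap.toContinuousLinearMap (b.coord i)).contDiff
  choose g hg using fun i => exists_fun_eventuallyEq (E := E) hopen hx₀
    (f := fun x => b.repr (φ x) i) ((hcoord i).contMDiff.comp_contMDiffOn hφs)
  choose e he using fun i => exists_vf_eventuallyEq (E := E) hopen hx₀
    (V := T.localFrame b i) (T.contMDiffOn_localFrame_baseSet _ b i)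
  have hd : ∀ᶠ x in 𝓝 x₀, ∀ i (v : TangentSpace 𝓘(ℝ, E) x),
      mvfderiv 𝓘(ℝ, E) (g i) x v = b.repr (T.continuousLinearMapAt ℝ x v) i := by
    -- Agreement in a neighbourhood of each nearby point is needed, since derivatives at those
    -- points are compared.
    filter_upwards [eventually_all.2 fun i => (hg i).eventually_nhds, hopen.mem_nhds hx₀]
      with x hx hxs i v
    rw [TangentBundle.continuousLinearMapAt_trivializationAt hxs]
    change mfderiv 𝓘(ℝ, E) 𝓘(ℝ, ℝ) (g i) x v = _
    rw [Filter.EventuallyEq.mfderiv_eq (hx i)]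
    have h2 := mfderiv_comp_apply (I := 𝓘(ℝ, E)) (I' := 𝓘(ℝ, E)) (I'' := 𝓘(ℝ, ℝ)) (f := φ) x
      (g := fun z => b.repr z i)
      (((hcoord i).contMDiff _).mdifferentiableAt (by simp))
      (mdifferentiableAt_extChartAt hxs) v
    refine h2.trans ?_
    rw [mfderiv_eq_fderiv]
    exact congrFun (congrArg DFunLike.coe
      (ContinuousLinearMap.fderiv (LinearMap.toContinuousLinearMap (b.coord i)))) _
  refine ⟨⟨g, e, ?_, ?_, fun f => ?_⟩⟩
  · filter_upwards [hd, eventually_all.2 he, hopen.mem_nhds hx₀] with x hdx hex hxs v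
    simp only [hdx, hex]
    have hxb : x ∈ T.baseSet := hxs
    have h := (T.basisAt b hxb).sum_repr v
    simp only [T.localFrame_apply_of_mem_baseSet b hxb]
    conv_lhs => rw [← h]
    refine Finset.sum_congr rfl fun i _ => ?_
    congr 1
    simp [Bundle.Trivialization.basisAt, Bundle.Trivialization.coe_linearMapAt_of_mem _ hxb]
  · filter_upwards [hd, eventually_all.2 he, hopen.mem_nhds hx₀] with x hdx hex hxs i l
    have hxb : x ∈ T.baseSet := hxs
    rw [hdx, hex, T.localFrame_apply_of_mem_baseSet b hxb]
    have : T.continuousLinearMapAt ℝ x (T.basisAt b hxb l) = b l := by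
      simp [Bundle.Trivialization.basisAt, Bundle.Trivialization.coe_linearMapAt_of_mem _ hxb,
        T.apply_mk_symm hxb]
    rw [this, b.repr_self, Finsupp.single_apply]
    simp only [eq_comm]
  -- The chart target need not be star-shaped, so `f ∘ φ.symm` is replaced by a function on all of
  -- `E` with the same germ before expanding.
  · obtain ⟨F, hF⟩ := exists_fun_eventuallyEq (E := E) (M := E) (f := f ∘ φ.symm)
      (isOpen_extChartAt_target x₀) (mem_extChartAt_target x₀)
      (f.contMDiff.comp_contMDiffOn (contMDiffOn_extChartAt_symm x₀))
    obtain ⟨H, hH, hFH⟩ := exists_hadamard b (contMDiff_iff_contDiff.1 F.contMDiff) (φ x₀)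
    choose h hh using fun i => exists_fun_eventuallyEq (E := E) hopen hx₀
      (f := fun x => H i (φ x)) ((hH i).contMDiff.comp_contMDiffOn hφs)
    refine ⟨h, ?_⟩
    filter_upwards [eventually_all.2 hg, eventually_all.2 hh, hopen.mem_nhds hx₀,
      (continuousAt_extChartAt x₀).eventually hF] with x hgx hhx hxs hFx
    have hFφ : ∀ y ∈ (chartAt E x₀).source, (f ∘ φ.symm) (φ y) = f y := fun y hy => by
      rw [Function.comp_apply, φ.left_inv (hsrc ▸ hy)]
    rw [← hFφ x hxs, ← hFφ x₀ hx₀, ← hFx, ← hF.self_of_nhds, hFH]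
    simp only [hgx, hhx, fun i => (hg i).self_of_nhds]
    rfl

end LocalTools

/-! ### Point derivations, tangent vectors and vector fields -/

section Pointwise

variable {E M : Type*} [NormedAddCommGroup E] [NormedSpace ℝ E]
  [TopologicalSpace M] [ChartedSpace E M] [IsManifold 𝓘(ℝ, E) ∞ M]
  [FiniteDimensional ℝ E]

lemma VF.toDer_apply (Y : VF E M) (f : Fun E M) : Y.toDer f = ⁅Y, f⁆ := rfl

lemma VF.toDer_add (Y Z : VF E M) : (Y + Z).toDer = Y.toDer + Z.toDer :=
  map_add (LinearMapClass.linearMap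
    (LieRinehartAlgebra.anchor ℝ (Fun E M) (VF E M)).toLieHom) Y Z

lemma VF.toDer_smul (f : Fun E M) (Y : VF E M) : (f • Y).toDer = f • Y.toDer :=
  (LieRinehartAlgebra.anchor ℝ (Fun E M) (VF E M)).map_smul_apply f Y

lemma VF.toDer_lie (Y Z : VF E M) : ⁅Y, Z⁆.toDer = ⁅Y.toDer, Z.toDer⁆ :=
  (LieRinehartAlgebra.anchor ℝ (Fun E M) (VF E M)).toLieHom.map_lie Y Z

lemma VF.smul_apply (f : Fun E M) (Y : VF E M) (x : M) : (f • Y) x = f x • Y x := rfl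

variable (E M) in
/-- `C^∞(M)`-linear version of `VF.toDer`. -/
def VF.toDerLin : VF E M →ₗ[Fun E M] Derivation ℝ (Fun E M) (Fun E M) where
  toFun := VF.toDer
  map_add' := VF.toDer_add
  map_smul' := VF.toDer_smul

variable (E) in
/-- Evaluation at a point. -/
def evalAt (x : M) : Fun E M →ₐ[ℝ] ℝ where
  toFun f := f x
  map_one' := rfl
  map_mul' _ _ := rfl
  map_zero' := rfl
  map_add' _ _ := rfl
  commutes' _ := rfl

lemma fun_sum_apply {ι : Type*} (s : Finset ι) (f : ι → Fun E M) (x : M) :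
    (∑ i ∈ s, f i) x = ∑ i ∈ s, f i x := map_sum (evalAt E x) f s

lemma vf_sum_apply {ι : Type*} (s : Finset ι) (Y : ι → VF E M) (x : M) :
    (∑ i ∈ s, Y i) x = ∑ i ∈ s, Y i x :=
  (congrFun (map_sum (ContMDiffSection.coeAddHom 𝓘(ℝ, E) E ∞
    (fun x : M => TangentSpace 𝓘(ℝ, E) x)) Y s) x).trans (Finset.sum_apply _ _ _)

lemma mvfderiv_fun_mul (f g : Fun E M) (x : M) (v : TangentSpace 𝓘(ℝ, E) x) :
    mvfderiv 𝓘(ℝ, E) (f * g : Fun E M) x v =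
      f x * mvfderiv 𝓘(ℝ, E) g x v + g x * mvfderiv 𝓘(ℝ, E) f x v :=
  congrArg (fun L => L v) (mvfderiv_mul (VF.fun_mdiffAt f x) (VF.fun_mdiffAt g x))

lemma mvfderiv_fun_add (f g : Fun E M) (x : M) (v : TangentSpace 𝓘(ℝ, E) x) :
    mvfderiv 𝓘(ℝ, E) (f + g : Fun E M) x v =
      mvfderiv 𝓘(ℝ, E) f x v + mvfderiv 𝓘(ℝ, E) g x v :=
  congrArg (fun L => L v) (mvfderiv_add (VF.fun_mdiffAt f x) (VF.fun_mdiffAt g x))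

lemma mvfderiv_fun_smul (c : ℝ) (f : Fun E M) (x : M) (v : TangentSpace 𝓘(ℝ, E) x) :
    mvfderiv 𝓘(ℝ, E) (c • f : Fun E M) x v = c * mvfderiv 𝓘(ℝ, E) f x v := by
  have h := mvfderiv_smul (I := 𝓘(ℝ, E)) (a := fun _ : M => c) (x := x)
      mdifferentiableAt_const (VF.fun_mdiffAt f x)
  rw [mvfderiv_const, ContinuousLinearMap.zero_smulRight, add_zero] at h
  exact congrArg (fun L => L v) h

/-- The derivative at `x` in direction `v`, as a linear form on `C^∞(M)`. -/
def dirDeriv {x : M} (v : TangentSpace 𝓘(ℝ, E) x) : Fun E M →ₗ[ℝ] ℝ where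
  toFun f := mvfderiv 𝓘(ℝ, E) f x v
  map_add' f g := mvfderiv_fun_add f g x v
  map_smul' c f := mvfderiv_fun_smul c f x v

variable [T2Space M]

/-- Near any point there is a bump function. -/
lemma exists_bump {x : M} {s : Set M} (hs : s ∈ 𝓝 x) :
    ∃ χ : Fun E M, χ x = 1 ∧ ∀ y, χ y ≠ 0 → y ∈ s := by
  obtain ⟨χ, -, hχ⟩ := (SmoothBumpFunction.nhds_basis_tsupport (I := 𝓘(ℝ, E)) x).mem_iff.1 hs
  exact ⟨⟨χ, χ.contMDiff⟩, χ.eq_one, fun y hy => hχ (subset_tsupport _ hy)⟩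

/-- Point derivations are determined by the germs of functions. -/
lemma pointDerivation_congr {x : M} {D : Fun E M →ₗ[ℝ] ℝ}
    (hD : ∀ f g, D (f * g) = f x * D g + g x * D f) {f g : Fun E M} (h : f =ᶠ[𝓝 x] g) :
    D f = D g := by
  obtain ⟨χ, h1, hχ⟩ := exists_bump (E := E) h
  have h0 : χ * (f - g) = 0 := by
    ext y
    by_cases hy : χ y = 0
    · exact mul_eq_zero_of_left hy _
    · exact mul_eq_zero_of_right _ (sub_eq_zero.2 (hχ y hy))
  have h2 := hD χ (f - g)
  have h3 : (f - g) x = 0 := sub_eq_zero.2 h.self_of_nhds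
  rw [h0, map_zero, h1, h3, map_sub] at h2
  linarith

/-- In the Hadamard expansion of `f` the factors `g i - g i x` vanish at `x`, so the Leibniz rule
leaves only `D (c.g i) * h i x`. The same formula for differentiation along `c.e i` identifies `h i
x` with the partial derivative. -/
lemma pointDerivation_coords {x : M} {D : Fun E M →ₗ[ℝ] ℝ}
    (hD : ∀ f g, D (f * g) = f x * D g + g x * D f) (c : Coords (E := E) x) (f : Fun E M) :
    D f = ∑ i, D (c.g i) * mvfderiv 𝓘(ℝ, E) f x (c.e i x) := by
  obtain ⟨h, hh⟩ := c.hadamard f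
  -- Stated for every point derivation because it is applied both to the given one and to the
  -- coordinate directions.
  have key : ∀ D : Fun E M →ₗ[ℝ] ℝ, (∀ f g, D (f * g) = f x * D g + g x * D f) →
      D f = ∑ i, D (c.g i) * h i x := by
    intro D hD
    have h1 : D 1 = 0 := by
      have := hD 1 1
      rw [mul_one, show (1 : Fun E M) x = 1 from rfl] at this
      linarith
    have hf : f =ᶠ[𝓝 x] (f x • (1 : Fun E M) + ∑ i, (c.g i - c.g i x • (1 : Fun E M)) * h i :
        Fun E M) := by
      filter_upwards [hh] with y hy
      rw [hy]
      change _ = evalAt E y (f x • (1 : Fun E M) + ∑ i, (c.g i - c.g i x • (1 : Fun E M)) * h i)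
      rw [map_add, map_sum, map_smul, map_one, smul_eq_mul, mul_one]
      refine congrArg _ (Finset.sum_congr rfl fun i _ => ?_)
      rw [map_mul, map_sub, map_smul, map_one, smul_eq_mul, mul_one]
      rfl
    rw [pointDerivation_congr hD hf, map_add, map_smul, h1, smul_zero, zero_add, map_sum]
    refine Finset.sum_congr rfl fun i _ => ?_
    rw [hD, map_sub, map_smul, h1, smul_zero, sub_zero]
    have : (c.g i - c.g i x • (1 : Fun E M)) x = 0 := by
      change c.g i x - c.g i x * 1 = 0
      ring
    rw [this]; ring
  rw [key D hD]
  refine Finset.sum_congr rfl fun i _ => ?_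
  have h2 := key (dirDeriv (c.e i x)) fun f g => mvfderiv_fun_mul f g x _
  have h3 : ∀ l, dirDeriv (c.e i x) (c.g l) = if l = i then 1 else 0 := fun l =>
    c.dual.self_of_nhds l i
  simp only [h3, ite_mul, one_mul, zero_mul, Finset.sum_ite_eq', Finset.mem_univ, if_true] at h2
  rw [← h2]; rfl

/-- Point derivations of `C^∞(M)` are tangent vectors. -/
lemma exists_vec_of_pointDerivation {x : M} {D : Fun E M →ₗ[ℝ] ℝ}
    (hD : ∀ f g, D (f * g) = f x * D g + g x * D f) :
    ∃ v : TangentSpace 𝓘(ℝ, E) x, ∀ f, D f = mvfderiv 𝓘(ℝ, E) f x v := by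
  obtain ⟨c⟩ := exists_coords (E := E) x
  refine ⟨∑ i, D (c.g i) • c.e i x, fun f => ?_⟩
  rw [pointDerivation_coords hD c, map_sum]
  exact Finset.sum_congr rfl fun i _ =>
    (map_smul (mvfderiv 𝓘(ℝ, E) f x) _ _).symm

/-- Tangent vectors are determined by the derivatives of smooth functions. -/
lemma tangent_ext {x : M} {v w : TangentSpace 𝓘(ℝ, E) x}
    (h : ∀ f : Fun E M, mvfderiv 𝓘(ℝ, E) f x v = mvfderiv 𝓘(ℝ, E) f x w) : v = w := by
  obtain ⟨c⟩ := exists_coords (E := E) x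
  rw [c.expand.self_of_nhds v, c.expand.self_of_nhds w]
  simp only [h]

/-- A linear choice of vector fields through the tangent vectors at a point. -/
def extendVec (x : M) : TangentSpace 𝓘(ℝ, E) x →ₗ[ℝ] VF E M :=
  ∑ i, ((mvfderiv 𝓘(ℝ, E) ((Classical.choice (exists_coords x)).g i) x :
    TangentSpace 𝓘(ℝ, E) x →ₗ[ℝ] ℝ)).smulRight ((Classical.choice (exists_coords x)).e i)

lemma extendVec_apply (x : M) (v : TangentSpace 𝓘(ℝ, E) x) : extendVec x v x = v := by
  rw [(Classical.choice (exists_coords (E := E) x)).expand.self_of_nhds v]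
  conv_lhs => rw [extendVec, LinearMap.sum_apply, vf_sum_apply]
  refine Finset.sum_congr rfl fun i _ => ?_
  rw [← (Classical.choice (exists_coords (E := E) x)).expand.self_of_nhds v]
  rfl

/-- A family of tangent vectors is smooth if it differentiates smooth functions to smooth
functions. -/
lemma contMDiff_of_deriv {X : ∀ x : M, TangentSpace 𝓘(ℝ, E) x}
    (hX : ∀ f : Fun E M, ContMDiff 𝓘(ℝ, E) 𝓘(ℝ, ℝ) ∞ fun x => mvfderiv 𝓘(ℝ, E) f x (X x)) :
    ContMDiff 𝓘(ℝ, E) (𝓘(ℝ, E).prod 𝓘(ℝ, E)) ∞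
      (fun y => (⟨y, X y⟩ : TangentBundle 𝓘(ℝ, E) M)) := by
  intro x
  obtain ⟨c⟩ := exists_coords (E := E) x
  let V : VF E M := ∑ i, (show Fun E M from ⟨_, hX (c.g i)⟩) • c.e i
  refine (V.contMDiff x).congr_of_eventuallyEq ?_
  filter_upwards [c.expand] with y hy
  congr 1
  rw [vf_sum_apply]
  exact hy (X y)

/-- Derivations of `C^∞(M)` are vector fields. -/
lemma toDer_bijective : Function.Bijective (VF.toDer (E := E) (M := M)) := by
  refine ⟨fun Y Z h => ContMDiffSection.ext fun x => tangent_ext fun f => ?_, fun D => ?_⟩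
  · exact congrArg (fun D : Derivation ℝ (Fun E M) (Fun E M) => D f x) h
  · choose X hX using fun x : M => exists_vec_of_pointDerivation (x := x)
      (D := (evalAt E x).toLinearMap ∘ₗ (D : Fun E M →ₗ[ℝ] Fun E M)) fun f g =>
        congrArg (evalAt E x) (D.leibniz f g)
    refine ⟨⟨X, contMDiff_of_deriv fun f => ?_⟩, ?_⟩
    · simp only [← hX]
      exact (D f).contMDiff
    · ext f x
      exact (hX x f).symm

/-- Vector fields and derivations. -/
def derEquiv : VF E M ≃ₗ[Fun E M] Derivation ℝ (Fun E M) (Fun E M) :=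
  LinearEquiv.ofBijective (VF.toDerLin E M) toDer_bijective

lemma toDer_derEquiv_symm (D : Derivation ℝ (Fun E M) (Fun E M)) :
    (derEquiv.symm D).toDer = D := derEquiv.apply_symm_apply D

lemma derEquiv_symm_toDer (Y : VF E M) : derEquiv.symm Y.toDer = Y := derEquiv.symm_apply_apply Y

end Pointwise

/-! ### Alternating multilinear maps on derivations are differential forms -/

section Forms

variable {E : Type*} [NormedAddCommGroup E] [NormedSpace ℝ E] [FiniteDimensional ℝ E]

/-- In a finite basis the map is a polynomial in the coordinates. -/
lemma continuous_multilinear {k : ℕ} (f : MultilinearMap ℝ (fun _ : Fin k => E) ℝ) :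
    Continuous f := by
  classical
  set b := Module.finBasis ℝ E
  have hf : (f : (Fin k → E) → ℝ) = fun v =>
      ∑ r : Fin k → Fin (Module.finrank ℝ E), (∏ a, b.coord (r a) (v a)) * f fun a => b (r a) := by
    funext v
    conv_lhs => rw [show v = fun a => ∑ i, b.repr (v a) i • b i from
      funext fun a => (b.sum_repr (v a)).symm, f.map_sum]
    refine Finset.sum_congr rfl fun r _ => ?_
    rw [f.map_smul_univ]; rfl
  rw [hf]
  refine continuous_finsetSum _ fun r _ => (continuous_finsetProd _ fun a _ => ?_).mul
    continuous_const
  exact (LinearMap.continuous_of_finiteDimensional (b.coord (r a))).comp (continuous_apply a)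

variable {M : Type*} [TopologicalSpace M] [ChartedSpace E M]

/-- Alternating forms on tangent spaces are continuous. -/
def toContAlt {k : ℕ} {x : M} (f : TangentSpace 𝓘(ℝ, E) x [⋀^Fin k]→ₗ[ℝ] ℝ) :
    TangentSpace 𝓘(ℝ, E) x [⋀^Fin k]→L[ℝ] ℝ :=
  { f with cont := continuous_multilinear (E := E) f.toMultilinearMap }

lemma toContAlt_apply {k : ℕ} {x : M} (f : TangentSpace 𝓘(ℝ, E) x [⋀^Fin k]→ₗ[ℝ] ℝ)
    (v : Fin k → TangentSpace 𝓘(ℝ, E) x) : toContAlt f v = f v := rfl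

variable [IsManifold 𝓘(ℝ, E) ∞ M]

lemma DiffForm.eval_apply {k : ℕ} (σ : DiffForm E M k) (V : Fin k → VF E M) (x : M) :
    DiffForm.eval σ V x = σ.1 x fun i => V i x := rfl

/-- `σ` as an alternating form on the vector fields. -/
def DiffForm.toAlt {k : ℕ} (σ : DiffForm E M k) : VF E M [⋀^Fin k]→ₗ[Fun E M] Fun E M where
  toFun := DiffForm.eval σ
  map_update_add' V i X Y := by
    ext x
    have h : ∀ Z : VF E M, (fun l => Function.update V i Z l x) =
        Function.update (fun l => V l x) i (Z x) := fun Z => by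
      funext l; by_cases hl : l = i
      · subst hl; simp
      · simp [hl]
    change σ.1 x _ = σ.1 x _ + σ.1 x _
    rw [h, h, h]
    exact (σ.1 x).map_update_add _ i (X x) (Y x)
  map_update_smul' V i f X := by
    ext x
    have h : ∀ Z : VF E M, (fun l => Function.update V i Z l x) =
        Function.update (fun l => V l x) i (Z x) := fun Z => by
      funext l; by_cases hl : l = i
      · subst hl; simp
      · simp [hl]
    change σ.1 x _ = f x * σ.1 x _
    rw [h, h]
    exact (σ.1 x).map_update_smul _ i (f x) (X x)
  map_eq_zero_of_eq' V i l h hne := by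
    ext x
    exact (σ.1 x).map_eq_zero_of_eq (fun i => V i x) (congrArg (fun X : VF E M => X x) h) hne

variable [T2Space M]

lemma DiffForm.ext_eval {k : ℕ} {σ τ : DiffForm E M k}
    (h : ∀ V, DiffForm.eval σ V = DiffForm.eval τ V) : σ = τ := by
  refine Subtype.ext (funext fun x => ContinuousAlternatingMap.ext fun v => ?_)
  have h1 := congrArg (fun f : Fun E M => f x) (h fun i => extendVec x (v i))
  simpa only [DiffForm.eval_apply, extendVec_apply] using h1

lemma exists_unique_represented {k : ℕ} (σ : DiffForm E M k) :
    ∃! α : CE ℝ (Fun E M) k, Represents σ α := by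
  refine ⟨(DiffForm.toAlt σ).compLinearMap derEquiv.symm.toLinearMap, fun Y => ?_, fun β hβ => ?_⟩
  · change DiffForm.eval σ (fun i => derEquiv.symm (Y i).toDer) = _
    simp only [derEquiv_symm_toDer]
  · ext X : 1
    have h := hβ fun i => derEquiv.symm (X i)
    simp only [toDer_derEquiv_symm] at h
    exact h

/-- `C^∞(M)`-multilinear forms on vector fields are tensorial. -/
lemma alt_apply_eq_zero {k : ℕ} (α : VF E M [⋀^Fin k]→ₗ[Fun E M] Fun E M) {Y : Fin k → VF E M}
    {x : M} {i : Fin k} (h : Y i x = 0) : α Y x = 0 := by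
  obtain ⟨c⟩ := exists_coords (E := E) x
  obtain ⟨χ, h1, hχ⟩ := exists_bump (E := E) c.expand
  -- The frame expansion holds only near `x`; multiplying by the bump function makes it a global
  -- identity to which linearity over `C^∞(M)` applies, and `χ x = 1` loses nothing at `x`.
  have hY : χ • Y i = ∑ l, (χ * ⁅Y i, c.g l⁆) • c.e l := by
    refine ContMDiffSection.ext fun y => ?_
    rw [vf_sum_apply, VF.smul_apply]
    by_cases hy : χ y = 0
    · rw [hy, zero_smul]
      refine (Finset.sum_eq_zero fun l _ => ?_).symm
      change (χ y * mvfderiv 𝓘(ℝ, E) (c.g l) y (Y i y)) • c.e l y = 0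
      rw [hy, zero_mul, zero_smul]
    · conv_lhs => rw [hχ y hy (Y i y), Finset.smul_sum]
      exact Finset.sum_congr rfl fun l _ => smul_smul (χ y) (mvfderiv 𝓘(ℝ, E) (c.g l) y (Y i y)) _
  have h2 : (χ * α Y) x = 0 := by
    rw [← smul_eq_mul, ← Function.update_eq_self i Y, ← α.map_update_smul, hY,
      α.map_update_sum, fun_sum_apply]
    refine Finset.sum_eq_zero fun l _ => ?_
    rw [α.map_update_smul]
    change χ x * mvfderiv 𝓘(ℝ, E) (c.g l) x (Y i x) * _ = 0
    rw [h, map_zero, mul_zero, zero_mul]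
  change χ x * α Y x = 0 at h2
  rwa [h1, one_mul] at h2

/-- The arguments are exchanged one at a time; each exchange alters the value by a term having an
argument that vanishes at `x`. -/
lemma alt_apply_congr {k : ℕ} (α : VF E M [⋀^Fin k]→ₗ[Fun E M] Fun E M) {Y Z : Fin k → VF E M}
    {x : M} (h : ∀ i, Y i x = Z i x) : α Y x = α Z x := by
  classical
  have key : ∀ s : Finset (Fin k), α Y x = α (s.piecewise Z Y) x := by
    intro s
    induction s using Finset.induction_on with
    | empty => simp
    | insert i s hi ih =>
      rw [ih, Finset.piecewise_insert]
      have h1 : s.piecewise Z Y = Function.update (s.piecewise Z Y) i (Y i) := by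
        conv_lhs => rw [← Function.update_eq_self i (s.piecewise Z Y)]
        rw [Finset.piecewise_eq_of_notMem _ _ _ hi]
      rw [h1, Function.update_idem, ← sub_eq_zero]
      change (α (Function.update _ i (Y i)) - α (Function.update _ i (Z i))) x = 0
      rw [← α.map_update_sub]
      refine alt_apply_eq_zero α (i := i) ?_
      rw [Function.update_self]
      exact sub_eq_zero.2 (h i)
  have := key Finset.univ
  rwa [Finset.piecewise_univ] at this

/-- The form at `x` is `α` evaluated on extensions of the given vectors. Linearity of `extendVec x`
makes it multilinear; tensoriality shows that evaluating it on fields returns `α`, which also gives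
smoothness. -/
lemma exists_unique_represents {k : ℕ} (α : CE ℝ (Fun E M) k) :
    ∃! σ : DiffForm E M k, Represents σ α := by
  let α' := α.compLinearMap (VF.toDerLin E M)
  have key : ∀ (V : Fin k → VF E M) (x : M),
      α' (fun i => extendVec x (V i x)) x = α' V x := fun V x =>
    alt_apply_congr α' fun i => extendVec_apply x (V i x)
  let f : ∀ x : M, TangentSpace 𝓘(ℝ, E) x [⋀^Fin k]→ₗ[ℝ] ℝ := fun x =>
    { toFun := fun v => α' (fun i => extendVec x (v i)) x
      map_update_add' := fun v i u w => by
        have h : ∀ z, (fun l => extendVec x (Function.update v i z l)) =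
            Function.update (fun l => extendVec x (v l)) i (extendVec x z) := fun z =>
          funext fun l => Function.apply_update (fun _ => extendVec x) v i z l
        rw [h, h, h, map_add, α'.map_update_add]
        rfl
      map_update_smul' := fun v i c w => by
        have h : ∀ z, (fun l => extendVec x (Function.update v i z l)) =
            Function.update (fun l => extendVec x (v l)) i (extendVec x z) := fun z =>
          funext fun l => Function.apply_update (fun _ => extendVec x) v i z l
        rw [h, h, map_smul, algebra_compatible_smul (Fun E M) c, α'.map_update_smul]
        rfl
      map_eq_zero_of_eq' := fun v i l h hne => by
        rw [α'.map_eq_zero_of_eq _ (congrArg (extendVec x) h) hne]; rfl }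
  let σ : DiffForm E M k := ⟨fun x => toContAlt (f x), fun V =>
    (α' V).contMDiff.congr fun x => key V x⟩
  refine ⟨σ, fun Y => ?_, fun τ hτ => DiffForm.ext_eval fun V => ?_⟩
  · ext x
    exact (key Y x).symm
  · rw [← hτ V]
    ext x
    exact (key V x).symm

end Forms

/-! ### Related vector fields and pullbacks along a smooth map -/

section Maps

variable {E M E' M' : Type*} [NormedAddCommGroup E] [NormedSpace ℝ E] [FiniteDimensional ℝ E]
  [TopologicalSpace M] [ChartedSpace E M] [IsManifold 𝓘(ℝ, E) ∞ M]
  [NormedAddCommGroup E'] [NormedSpace ℝ E'] [FiniteDimensional ℝ E']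
  [TopologicalSpace M'] [ChartedSpace E' M'] [IsManifold 𝓘(ℝ, E') ∞ M']

/-- The pullback of functions. -/
def comapFun (h : M' → M) (hh : ContMDiff 𝓘(ℝ, E') 𝓘(ℝ, E) ∞ h) : Fun E M →ₐ[ℝ] Fun E' M' where
  toFun f := ⟨f ∘ h, f.contMDiff.comp hh⟩
  map_one' := rfl
  map_mul' _ _ := rfl
  map_zero' := rfl
  map_add' _ _ := rfl
  commutes' _ := rfl

variable {h : M' → M} (hh : ContMDiff 𝓘(ℝ, E') 𝓘(ℝ, E) ∞ h)

include hh in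
lemma mvfderiv_comp_map (f : Fun E M) (s : M') (v : TangentSpace 𝓘(ℝ, E') s) :
    mvfderiv 𝓘(ℝ, E') (f ∘ h) s v =
      mvfderiv 𝓘(ℝ, E) f (h s) (mfderiv 𝓘(ℝ, E') 𝓘(ℝ, E) h s v) :=
  mvfderiv_comp_apply s (VF.fun_mdiffAt f (h s)) ((hh s).mdifferentiableAt (by simp)) v

lemma Restricts.lie_comapFun {Y : VF E M} {Z : VF E' M'} (H : Restricts h Y Z) (f : Fun E M) :
    ⁅Z, comapFun h hh f⁆ = comapFun h hh ⁅Y, f⁆ := by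
  ext s
  change mvfderiv 𝓘(ℝ, E') (f ∘ h) s (Z s) = mvfderiv 𝓘(ℝ, E) f (h s) (Y (h s))
  rw [mvfderiv_comp_map hh, H s]

/-- Relatedness can be tested on functions because these separate tangent vectors. `Restricts` is
relatedness along any map: it serves for the embedding `j` and also for the projection `π`. -/
lemma restricts_iff [T2Space M] {Y : VF E M} {Z : VF E' M'} :
    Restricts h Y Z ↔ ∀ f : Fun E M, ⁅Z, comapFun h hh f⁆ = comapFun h hh ⁅Y, f⁆ := by
  refine ⟨fun H f => H.lie_comapFun hh f, fun H s => tangent_ext fun f => ?_⟩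
  have := congrArg (fun g : Fun E' M' => g s) (H f)
  refine Eq.trans this.symm ?_
  exact mvfderiv_comp_map hh f s (Z s)

include hh in
-- Tested on functions, a bracket is a commutator of derivatives, and each derivative commutes with
-- the pullback.
lemma Restricts.lie [T2Space M] {Y Y' : VF E M} {Z Z' : VF E' M'} (H : Restricts h Y Z)
    (H' : Restricts h Y' Z') : Restricts h ⁅Y, Y'⁆ ⁅Z, Z'⁆ := by
  rw [restricts_iff hh]
  intro f
  rw [VF.lie_lie_fun, VF.lie_lie_fun, map_sub, H'.lie_comapFun hh, H.lie_comapFun hh,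
    H.lie_comapFun hh, H'.lie_comapFun hh]

lemma Restricts.add {Y Y' : VF E M} {Z Z' : VF E' M'} (H : Restricts h Y Z)
    (H' : Restricts h Y' Z') : Restricts h (Y + Y') (Z + Z') := fun s => by
  change Y (h s) + Y' (h s) = mfderiv 𝓘(ℝ, E') 𝓘(ℝ, E) h s (Z s + Z' s)
  rw [H s, H' s, map_add]

lemma Restricts.const_smul {Y : VF E M} {Z : VF E' M'} (H : Restricts h Y Z) (c : ℝ) :
    Restricts h (c • Y) (c • Z) := fun s => by
  change c • Y (h s) = mfderiv 𝓘(ℝ, E') 𝓘(ℝ, E) h s (c • Z s)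
  rw [H s, map_smul]

lemma Restricts.fun_smul {Y : VF E M} {Z : VF E' M'} (H : Restricts h Y Z) (f : Fun E M)
    {g : Fun E' M'} (hg : ∀ s, g s = f (h s)) : Restricts h (f • Y) (g • Z) := fun s => by
  change f (h s) • Y (h s) = mfderiv 𝓘(ℝ, E') 𝓘(ℝ, E) h s (g s • Z s)
  rw [H s, map_smul, hg]

lemma pullback_apply {k : ℕ} (σ : ∀ x : M, TangentSpace 𝓘(ℝ, E) x [⋀^Fin k]→L[ℝ] ℝ) (s : M')
    (v : Fin k → TangentSpace 𝓘(ℝ, E') s) : pullback (E' := E') h σ s v =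
      σ (h s) fun i => mfderiv 𝓘(ℝ, E') 𝓘(ℝ, E) h s (v i) := rfl

lemma pullback_apply_restricts {k : ℕ} (σ : DiffForm E M k) {Y : Fin k → VF E M}
    {Z : Fin k → VF E' M'} (H : ∀ i, Restricts h (Y i) (Z i)) (s : M') :
    pullback (E' := E') h σ.1 s (fun i => Z i s) = DiffForm.eval σ Y (h s) := by
  rw [pullback_apply, DiffForm.eval_apply]
  exact congrArg _ (funext fun i => (H i s).symm)

end Maps

lemma sigmaCompactSpace_of_secondCountable (E M : Type*) [NormedAddCommGroup E] [NormedSpace ℝ E]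
    [FiniteDimensional ℝ E] [TopologicalSpace M] [ChartedSpace E M]
    [SecondCountableTopology M] : SigmaCompactSpace M := by
  have : LocallyCompactSpace M := ChartedSpace.locallyCompactSpace E M
  infer_instance

/-! ### Extension of functions and vector fields from a closed submanifold -/

section Embedding

variable {EM M ES S : Type*}
    [NormedAddCommGroup EM] [NormedSpace ℝ EM] [FiniteDimensional ℝ EM]
    [TopologicalSpace M] [ChartedSpace EM M] [IsManifold 𝓘(ℝ, EM) ∞ M]
    [T2Space M] [SecondCountableTopology M]
    [NormedAddCommGroup ES] [NormedSpace ℝ ES] [FiniteDimensional ℝ ES]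
    [TopologicalSpace S] [ChartedSpace ES S] [IsManifold 𝓘(ℝ, ES) ∞ S]
    {j : S → M} (hj : Manifold.IsSmoothEmbedding 𝓘(ℝ, ES) 𝓘(ℝ, EM) ∞ j)
    (hcl : IsClosed (Set.range j))

include hj in
/-- A function on an embedded submanifold extends locally. -/
lemma exists_local_extension (f : Fun ES S) (s₀ : S) : ∃ (U : Set M) (F : M → ℝ), IsOpen U ∧
    j s₀ ∈ U ∧ ContMDiffOn 𝓘(ℝ, EM) 𝓘(ℝ, ℝ) ∞ F U ∧ ∀ s, j s ∈ U → F (j s) = f s := by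
  have c := hj.isImmersion.isImmersionAt s₀
  -- Being an embedding, not only an immersion, enters here: over `V` the image contains no points
  -- of `S` outside the chart domain.
  obtain ⟨V, hV, hVs⟩ := hj.isEmbedding.isInducing.isOpen_iff.1 c.domChart.open_source
  -- In the normal form `u ↦ (u, 0)` of the immersion, the first projection is a left inverse; the
  -- extension is `f` composed with it.
  set T : EM → ES := fun z => (c.equiv.symm z).1 with hT
  have hTc : ContDiff ℝ ∞ T := contDiff_fst.comp c.equiv.symm.contDiff
  have hmem : ∀ s, j s ∈ V → s ∈ c.domChart.source := fun s hs => by rw [← hVs]; exact hs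
  have hw : ∀ s ∈ c.domChart.source, T (c.codChart (j s)) = c.domChart s := fun s hs => by
    have h := c.writtenInCharts (show c.domChart s ∈ (c.domChart.extend 𝓘(ℝ, ES)).target by
      simpa using c.domChart.map_source hs)
    simp only [Function.comp_apply, OpenPartialHomeomorph.extend_coe,
      OpenPartialHomeomorph.extend_coe_symm, modelWithCornersSelf_coe,
      modelWithCornersSelf_coe_symm, id_eq, c.domChart.left_inv hs] at h
    rw [hT]
    simp only
    rw [h, ContinuousLinearEquiv.symm_apply_apply]
  have hcod := contMDiffOn_of_mem_maximalAtlas c.codChart_mem_maximalAtlas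
  have hdom := contMDiffOn_symm_of_mem_maximalAtlas c.domChart_mem_maximalAtlas
  have hs₀ := c.mem_domChart_source
  have hopen : IsOpen (c.codChart.source ∩ (T ∘ c.codChart) ⁻¹' c.domChart.target) :=
    (hTc.continuous.comp_continuousOn c.codChart.continuousOn).isOpen_inter_preimage
      c.codChart.open_source c.domChart.open_target
  refine ⟨V ∩ (c.codChart.source ∩ (T ∘ c.codChart) ⁻¹' c.domChart.target),
    fun x => f (c.domChart.symm (T (c.codChart x))), hV.inter hopen,
    ⟨(hVs.symm ▸ hs₀ : s₀ ∈ j ⁻¹' V), c.mem_codChart_source, ?_⟩, ?_, fun s hs => ?_⟩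
  · rw [Set.mem_preimage, Function.comp_apply, hw _ hs₀]
    exact c.domChart.map_source hs₀
  · refine f.contMDiff.comp_contMDiffOn (hdom.comp ?_ fun x hx => hx.2.2)
    exact hTc.contMDiff.comp_contMDiffOn (hcod.mono fun x hx => hx.2.1)
  · beta_reduce
    rw [hw s (hmem s hs.1), c.domChart.left_inv (hmem s hs.1)]

include hj hcl in
/-- Functions on a closed submanifold extend. -/
lemma exists_extension (f : Fun ES S) : ∃ F : Fun EM M, comapFun j hj.contMDiff F = f := by
  have : SigmaCompactSpace M := sigmaCompactSpace_of_secondCountable EM M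
  -- The admissible values are prescribed on the image and free elsewhere. As they form convex sets,
  -- local extensions glue by a partition of unity; closedness of the image handles points off it.
  have hconv : ∀ x : M, Convex ℝ {z : ℝ | ∀ s, j s = x → z = f s} :=
    fun x y hy z hz a b _ _ hab s hs => by
      rw [hy s hs, hz s hs, ← add_smul, hab, one_smul]
  have hloc : ∀ x : M, ∃ U ∈ 𝓝 x, ∃ g : M → ℝ, ContMDiffOn 𝓘(ℝ, EM) 𝓘(ℝ, ℝ) ∞ g U ∧
      ∀ y ∈ U, g y ∈ {z : ℝ | ∀ s, j s = y → z = f s} := fun x => by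
    by_cases hx : x ∈ Set.range j
    · obtain ⟨s₀, rfl⟩ := hx
      obtain ⟨U, F, hU, hmem, hF, h⟩ := exists_local_extension hj f s₀
      exact ⟨U, hU.mem_nhds hmem, F, hF, fun y hy s hs => by subst hs; exact h s hy⟩
    · exact ⟨(Set.range j)ᶜ, hcl.isOpen_compl.mem_nhds hx, fun _ => 0, contMDiffOn_const,
        fun y hy s hs => absurd ⟨s, hs⟩ hy⟩
  obtain ⟨F, hF⟩ := exists_contMDiffMap_forall_mem_convex_of_local (n := ⊤) 𝓘(ℝ, EM) (M := M)
    hconv hloc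
  exact ⟨F, ContMDiffMap.ext fun s => hF (j s) s rfl⟩

include hj hcl in
/-- The differential of the embedding of a closed submanifold is injective. -/
lemma embedding_mfderiv_injective [T2Space S] {s : S} {v w : TangentSpace 𝓘(ℝ, ES) s}
    (h : mfderiv 𝓘(ℝ, ES) 𝓘(ℝ, EM) j s v = mfderiv 𝓘(ℝ, ES) 𝓘(ℝ, EM) j s w) : v = w := by
  refine tangent_ext fun f => ?_
  obtain ⟨F, rfl⟩ := exists_extension hj hcl f
  exact (mvfderiv_comp_map hj.contMDiff F s v).trans
    ((congrArg _ h).trans (mvfderiv_comp_map hj.contMDiff F s w).symm)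

include hj hcl in
/-- Vector fields on a closed submanifold extend. -/
lemma exists_extension_vf (Z : VF ES S) : ∃ Y : VF EM M, Restricts j Y Z := by
  have : SigmaCompactSpace M := sigmaCompactSpace_of_secondCountable EM M
  -- The condition is expressed through derivatives of functions so that it makes sense in the
  -- tangent space at `x`, not only at `j s`.
  have hconv : ∀ x : M, Convex ℝ {v : TangentSpace 𝓘(ℝ, EM) x | ∀ s, j s = x →
      ∀ f : Fun EM M, mvfderiv 𝓘(ℝ, EM) f x v = ⁅Z, comapFun j hj.contMDiff f⁆ s} :=
    fun x v hv w hw a b _ _ hab s hs f => by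
      rw [map_add, map_smul, map_smul, hv s hs f, hw s hs f, ← add_smul, hab, one_smul]
  have hloc : ∀ x : M, ∃ U ∈ 𝓝 x, ∃ V : ∀ y : M, TangentSpace 𝓘(ℝ, EM) y,
      ContMDiffOn 𝓘(ℝ, EM) (𝓘(ℝ, EM).prod 𝓘(ℝ, EM)) ∞
        (fun y => (⟨y, V y⟩ : TangentBundle 𝓘(ℝ, EM) M)) U ∧
      ∀ y ∈ U, V y ∈ {v : TangentSpace 𝓘(ℝ, EM) y | ∀ s, j s = y → ∀ f : Fun EM M,
        mvfderiv 𝓘(ℝ, EM) f y v = ⁅Z, comapFun j hj.contMDiff f⁆ s} := fun x => by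
    by_cases hx : x ∈ Set.range j
    · obtain ⟨s₀, rfl⟩ := hx
      obtain ⟨c⟩ := exists_coords (E := EM) (j s₀)
      -- The components of `dj(Z)` in the coordinate frame are functions on `S`; extending them
      -- gives a local extension of the field.
      choose C hC using fun l => exists_extension hj hcl ⁅Z, comapFun j hj.contMDiff (c.g l)⁆
      refine ⟨_, c.expand, (∑ l, C l • c.e l : VF EM M), (ContMDiffSection.contMDiff _).contMDiffOn,
        fun y hy s hs f => ?_⟩
      subst hs
      have h1 : (∑ l, C l • c.e l : VF EM M) (j s) =
          mfderiv 𝓘(ℝ, ES) 𝓘(ℝ, EM) j s (Z s) := by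
        rw [hy (mfderiv 𝓘(ℝ, ES) 𝓘(ℝ, EM) j s (Z s)), vf_sum_apply]
        refine Finset.sum_congr rfl fun l _ => ?_
        have h2 := congrArg (fun f : Fun ES S => f s) (hC l)
        rw [← mvfderiv_comp_map hj.contMDiff]
        exact congrArg (· • c.e l (j s)) h2
      rw [h1]
      exact (mvfderiv_comp_map hj.contMDiff f s (Z s)).symm
    · exact ⟨(Set.range j)ᶜ, hcl.isOpen_compl.mem_nhds hx, (0 : VF EM M),
        (ContMDiffSection.contMDiff _).contMDiffOn, fun y hy s hs => absurd ⟨s, hs⟩ hy⟩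
  obtain ⟨Y, hY⟩ := exists_contMDiffSection_forall_mem_convex_of_local (n := ⊤) 𝓘(ℝ, EM)
    (F_fiber := EM) (fun x : M => TangentSpace 𝓘(ℝ, EM) x) _
    hconv hloc
  exact ⟨Y, fun s => tangent_ext fun f =>
    (hY (j s) s rfl f).trans (mvfderiv_comp_map hj.contMDiff f s (Z s))⟩

end Embedding

/-! ### Descent of functions and lifting of vector fields along a submersion -/

section Submersion

variable {ES S EQ Q : Type*}
    [NormedAddCommGroup ES] [NormedSpace ℝ ES] [FiniteDimensional ℝ ES]
    [TopologicalSpace S] [ChartedSpace ES S] [IsManifold 𝓘(ℝ, ES) ∞ S]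
    [NormedAddCommGroup EQ] [NormedSpace ℝ EQ] [FiniteDimensional ℝ EQ]
    [TopologicalSpace Q] [ChartedSpace EQ Q] [IsManifold 𝓘(ℝ, EQ) ∞ Q]
    {π : S → Q} (hπ : Manifold.IsSubmersion 𝓘(ℝ, ES) 𝓘(ℝ, EQ) ∞ π)

include hπ in
/-- Local sections of a submersion. -/
lemma exists_local_section (s₀ : S) : ∃ (U : Set Q) (τ : Q → S), IsOpen U ∧ π s₀ ∈ U ∧
    ContMDiffOn 𝓘(ℝ, EQ) 𝓘(ℝ, ES) ∞ τ U ∧ τ (π s₀) = s₀ ∧ ∀ q ∈ U, π (τ q) = q := by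
  have c := hπ.isSubmersionAt s₀
  have hw : ∀ z ∈ c.domChart.target, c.codChart (π (c.domChart.symm z)) = (c.equiv z).1 :=
    fun z hz => by
    have h := c.writtenInCharts (show z ∈ (c.domChart.extend 𝓘(ℝ, ES)).target by simpa using hz)
    simpa only [Function.comp_apply, OpenPartialHomeomorph.extend_coe,
      OpenPartialHomeomorph.extend_coe_symm, modelWithCornersSelf_coe,
      modelWithCornersSelf_coe_symm, id_eq] using h
  set w := (c.equiv (c.domChart s₀)).2
  -- In the normal form `(y, z) ↦ y`, the slice with second component fixed at that of `s₀` is a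
  -- section through `s₀`.
  set T : EQ → ES := fun y => c.equiv.symm (y, w) with hT
  have hTc : ContDiff ℝ ∞ T := c.equiv.symm.contDiff.comp (contDiff_id.prodMk contDiff_const)
  have hs₀ := c.mem_domChart_source
  have hTs : T (c.codChart (π s₀)) = c.domChart s₀ := by
    have h := hw _ (c.domChart.map_source hs₀)
    rw [c.domChart.left_inv hs₀] at h
    simp only [hT]
    rw [h]
    exact c.equiv.symm_apply_apply _
  have hcod := contMDiffOn_of_mem_maximalAtlas c.codChart_mem_maximalAtlas
  have hdom := contMDiffOn_symm_of_mem_maximalAtlas c.domChart_mem_maximalAtlas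
  refine ⟨c.codChart.source ∩ (T ∘ c.codChart) ⁻¹' c.domChart.target,
    fun q => c.domChart.symm (T (c.codChart q)),
    (hTc.continuous.comp_continuousOn c.codChart.continuousOn).isOpen_inter_preimage
      c.codChart.open_source c.domChart.open_target, ⟨c.mem_codChart_source, ?_⟩, ?_, ?_,
      fun q hq => ?_⟩
  · rw [Set.mem_preimage, Function.comp_apply, hTs]
    exact c.domChart.map_source hs₀
  · refine hdom.comp ?_ fun x hx => hx.2
    exact hTc.contMDiff.comp_contMDiffOn (hcod.mono fun x hx => hx.1)
  · beta_reduce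
    rw [hTs, c.domChart.left_inv hs₀]
  · refine c.codChart.injOn (c.source_subset_preimage_source (c.domChart.map_target hq.2)) hq.1 ?_
    rw [hw _ hq.2]
    simp only [hT, Function.comp_apply, ContinuousLinearEquiv.apply_symm_apply]

include hπ in
lemma submersion_mfderiv_surjective (s : S) (v : TangentSpace 𝓘(ℝ, EQ) (π s)) :
    ∃ u : TangentSpace 𝓘(ℝ, ES) s, mfderiv 𝓘(ℝ, ES) 𝓘(ℝ, EQ) π s u = v := by
  obtain ⟨U, τ, hU, hmem, hτ, hs, hsec⟩ := exists_local_section hπ s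
  have hτd : MDifferentiableAt 𝓘(ℝ, EQ) 𝓘(ℝ, ES) τ (π s) :=
    (hτ.contMDiffAt (hU.mem_nhds hmem)).mdifferentiableAt (by simp)
  have hπd : MDifferentiableAt 𝓘(ℝ, ES) 𝓘(ℝ, EQ) π s :=
    (hπ.contMDiff s).mdifferentiableAt (by simp)
  have h1 : π ∘ τ =ᶠ[𝓝 (π s)] id := Filter.eventuallyEq_of_mem (hU.mem_nhds hmem) hsec
  have h2 := mfderiv_comp_apply_of_eq (I := 𝓘(ℝ, EQ)) (I' := 𝓘(ℝ, ES)) (I'' := 𝓘(ℝ, EQ))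
    (π s) hπd hτd hs v
  rw [h1.mfderiv_eq, mfderiv_id] at h2
  exact ⟨_, h2.symm⟩

include hπ in
/-- Smooth functions which are constant on the fibres of a submersion descend. -/
lemma exists_descend (hsurj : Function.Surjective π) (f : Fun ES S)
    (hf : ∀ s t, π s = π t → f s = f t) : ∃ g : Fun EQ Q, comapFun π hπ.contMDiff g = f := by
  choose r hr using hsurj
  refine ⟨⟨f ∘ r, fun q => ?_⟩, ContMDiffMap.ext fun s => hf _ _ (hr _)⟩
  obtain ⟨U, τ, hU, hmem, hτ, hs, hsec⟩ := exists_local_section hπ (r q)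
  rw [hr] at hmem
  -- The choice `r` need not even be continuous, but near `q` it differs from the smooth section `τ`
  -- only within fibres, where `f` is constant.
  refine ((f.contMDiff _).comp q (hτ.contMDiffAt (hU.mem_nhds hmem))).congr_of_eventuallyEq ?_
  filter_upwards [hU.mem_nhds hmem] with q' hq'
  exact hf _ _ (by rw [hr, hsec q' hq'])

variable [T2Space Q] [T2Space S] [SecondCountableTopology S]

include hπ in
/-- Vector fields lift along submersions. -/
lemma exists_lift (V : VF EQ Q) : ∃ Z : VF ES S, Restricts π V Z := by
  have : SigmaCompactSpace S := sigmaCompactSpace_of_secondCountable ES S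
  have hconv : ∀ s : S, Convex ℝ {v : TangentSpace 𝓘(ℝ, ES) s |
      V (π s) = mfderiv 𝓘(ℝ, ES) 𝓘(ℝ, EQ) π s v} := fun s v hv w hw a b _ _ hab => by
    change _ = mfderiv 𝓘(ℝ, ES) 𝓘(ℝ, EQ) π s (a • v + b • w)
    rw [map_add, map_smul, map_smul, ← show _ = _ from hv, ← show _ = _ from hw, ← add_smul, hab,
      one_smul]
  have hloc : ∀ s : S, ∃ U ∈ 𝓝 s, ∃ Z : ∀ s : S, TangentSpace 𝓘(ℝ, ES) s,
      ContMDiffOn 𝓘(ℝ, ES) (𝓘(ℝ, ES).prod 𝓘(ℝ, ES)) ∞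
        (fun s => (⟨s, Z s⟩ : TangentBundle 𝓘(ℝ, ES) S)) U ∧
      ∀ s ∈ U, Z s ∈ {v : TangentSpace 𝓘(ℝ, ES) s |
        V (π s) = mfderiv 𝓘(ℝ, ES) 𝓘(ℝ, EQ) π s v} := fun s₀ => by
    obtain ⟨c⟩ := exists_coords (E := EQ) (π s₀)
    choose u hu using fun l => submersion_mfderiv_surjective hπ s₀ (c.e l (π s₀))
    let L := fun l => extendVec s₀ (u l)
    -- Cramer's rule: `a` is the matrix of `dπ` on the fields `L l` in the coordinates `c.g i`, and
    -- is the identity at `s₀`. The adjugate gives a global smooth field whose projection has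
    -- components `a.det * b i`; dividing by the determinant near `s₀` gives a lift.
    let a : Matrix (Fin (Module.finrank ℝ EQ)) (Fin (Module.finrank ℝ EQ)) (Fun ES S) :=
      fun i l => ⁅L l, comapFun π hπ.contMDiff (c.g i)⁆
    let b := fun i => comapFun π hπ.contMDiff ⁅V, c.g i⁆
    let Z : VF ES S := ∑ l, (a.adjugate.mulVec b l) • L l
    have hdet : a.det s₀ ≠ 0 := by
      have h1 : a.det s₀ = ((evalAt ES s₀).toRingHom.mapMatrix a).det :=
        (RingHom.map_det (evalAt ES s₀).toRingHom a)
      have h2 : (evalAt ES s₀).toRingHom.mapMatrix a = 1 := by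
        ext i l
        refine Eq.trans ?_ (Matrix.one_apply).symm
        rw [← c.dual.self_of_nhds i l, ← hu l]
        refine (mvfderiv_comp_map hπ.contMDiff (c.g i) s₀ _).trans ?_
        rw [extendVec_apply]
      rw [h1, h2, Matrix.det_one]
      exact one_ne_zero
    have hZ : ∀ i, ⁅Z, comapFun π hπ.contMDiff (c.g i)⁆ = a.det * b i := fun i => by
      have h1 : ⁅Z, comapFun π hπ.contMDiff (c.g i)⁆ = a.mulVec (a.adjugate.mulVec b) i := by
        rw [← VF.toDer_apply]
        change VF.toDerLin ES S Z _ = _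
        rw [map_sum, ← Derivation.coeFnAddMonoidHom_apply, map_sum, Finset.sum_apply]
        refine Finset.sum_congr rfl fun l _ => ?_
        rw [map_smul]
        exact mul_comm _ _
      rw [h1, Matrix.mulVec_mulVec, Matrix.mul_adjugate, Matrix.smul_mulVec, Matrix.one_mulVec]
      rfl
    have hcont : ∀ᶠ s in 𝓝 s₀, a.det s ≠ 0 :=
      (a.det.contMDiff.continuous.continuousAt (x := s₀)).eventually_ne hdet
    refine ⟨_, (hcont.and ((hπ.contMDiff.continuous.tendsto s₀).eventually c.expand)),
      fun s => (a.det s)⁻¹ • Z s, fun s hs => ?_, fun s hs => ?_⟩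
    · refine ContMDiffAt.contMDiffWithinAt ?_
      exact ContMDiffAt.smul_section ((a.det.contMDiff s).inv₀ hs.1) (Z.contMDiff s)
    · obtain ⟨hs1, hs2⟩ := hs
      change _ = mfderiv 𝓘(ℝ, ES) 𝓘(ℝ, EQ) π s ((a.det s)⁻¹ • Z s)
      rw [hs2 (mfderiv 𝓘(ℝ, ES) 𝓘(ℝ, EQ) π s ((a.det s)⁻¹ • Z s)), hs2 (V (π s))]
      refine Finset.sum_congr rfl fun i _ => ?_
      congr 1
      rw [map_smul, map_smul, ← mvfderiv_comp_map hπ.contMDiff]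
      have h3 : mvfderiv 𝓘(ℝ, ES) (c.g i ∘ π) s (Z s) = a.det s * b i s :=
        congrArg (fun f : Fun ES S => f s) (hZ i)
      rw [h3, smul_eq_mul, inv_mul_cancel_left₀ hs1]
      rfl
  obtain ⟨Z, hZ⟩ := exists_contMDiffSection_forall_mem_convex_of_local (n := ⊤) 𝓘(ℝ, ES)
    (F_fiber := ES) (fun x : S => TangentSpace 𝓘(ℝ, ES) x) _ hconv hloc
  exact ⟨Z, hZ⟩

end Submersion

lemma exists_vf_of_derivation {E M : Type*} [NormedAddCommGroup E] [NormedSpace ℝ E]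
    [TopologicalSpace M] [ChartedSpace E M] [IsManifold 𝓘(ℝ, E) ∞ M] [FiniteDimensional ℝ E]
    [T2Space M] (d : Fun E M → Fun E M) (hadd : ∀ f g, d (f + g) = d f + d g)
    (hsmul : ∀ (c : ℝ) f, d (c • f) = c • d f) (hmul : ∀ f g, d (f * g) = f * d g + g * d f) :
    ∃ Z : VF E M, ∀ f, ⁅Z, f⁆ = d f := by
  obtain ⟨Z, hZ⟩ := (toDer_bijective (E := E) (M := M)).surjective
    (Derivation.mk' { toFun := d, map_add' := hadd, map_smul' := hsmul } hmul)
  exact ⟨Z, fun f => congrArg (fun D : Derivation ℝ (Fun E M) (Fun E M) => D f) hZ⟩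

/-! ### Invariant functions and projectable fields of a foliation with smooth leaf space -/

section Foliation

variable {ES S EQ Q : Type*}
    [NormedAddCommGroup ES] [NormedSpace ℝ ES] [FiniteDimensional ℝ ES]
    [TopologicalSpace S] [ChartedSpace ES S] [IsManifold 𝓘(ℝ, ES) ∞ S]
    [NormedAddCommGroup EQ] [NormedSpace ℝ EQ] [FiniteDimensional ℝ EQ]
    [TopologicalSpace Q] [ChartedSpace EQ Q] [IsManifold 𝓘(ℝ, EQ) ∞ Q]
    {𝓓 : RegularFoliation ES S} {π : S → Q} (hπ : 𝓓.IsLeafSpace (E' := EQ) π)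

lemma RegularFoliation.IsLeafSpace.smooth {𝓓 : RegularFoliation ES S} {π : S → Q}
    (hπ : 𝓓.IsLeafSpace (E' := EQ) π) : ContMDiff 𝓘(ℝ, ES) 𝓘(ℝ, EQ) ∞ π :=
  hπ.submersion.contMDiff

include hπ in
-- Since `D = ker dπ`, statements about brackets with `Γ(D)` become instances of naturality of
-- brackets under related fields.
lemma mem_secs_iff {W : VF ES S} : W ∈ secs 𝓓.D ↔ Restricts π (0 : VF EQ Q) W :=
  forall_congr' fun s => (hπ.tangent s (W s)).symm.trans eq_comm

lemma comapFun_injective (hsurj : Function.Surjective π)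
    (hs : ContMDiff 𝓘(ℝ, ES) 𝓘(ℝ, EQ) ∞ π) : Function.Injective (comapFun π hs) := fun f g h => by
  ext q
  obtain ⟨s, rfl⟩ := hsurj q
  exact congrArg (fun f : Fun ES S => f s) h

/-- Each velocity of a curve in the leaf is the value of some section of `D`, so `f` has zero
derivative along the curve. -/
lemma eq_of_sameLeaf {f : Fun ES S} (hf : ∀ W ∈ secs 𝓓.D, ⁅W, f⁆ = 0) {s t : S}
    (h : 𝓓.SameLeaf s t) : f s = f t := by
  obtain ⟨γ, hγ, hD, rfl, rfl⟩ := h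
  have hc : ContDiff ℝ ∞ (f ∘ γ) := (f.contMDiff.comp hγ).contDiff
  refine is_const_of_deriv_eq_zero (hc.differentiable (by simp)) (fun t => ?_) 0 1
  obtain ⟨W, hW, hWt⟩ := 𝓓.smooth (γ t) _ (hD t)
  have h1 := congrArg (fun f : Fun ES S => f (γ t)) (hf W hW)
  have h2 := mvfderiv_comp_map hγ f t (1 : ℝ)
  rw [← hWt] at h2
  have h3 := h2.trans h1
  rw [← fderiv_apply_one_eq_deriv]
  change (mfderiv 𝓘(ℝ, ℝ) 𝓘(ℝ, ℝ) (f ∘ γ) t) (1 : ℝ) = 0 at h3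
  rw [mfderiv_eq_fderiv] at h3
  exact h3

include hπ in
lemma lie_eq_zero_of_comapFun (g : Fun EQ Q) {W : VF ES S} (hW : W ∈ secs 𝓓.D) :
    ⁅W, comapFun π hπ.smooth g⁆ = 0 := by
  rw [((mem_secs_iff hπ).1 hW).lie_comapFun hπ.smooth]
  ext s
  exact map_zero (mvfderiv 𝓘(ℝ, EQ) g (π s))

include hπ in
lemma exists_descend_of_invariant {f : Fun ES S} (hf : ∀ W ∈ secs 𝓓.D, ⁅W, f⁆ = 0) :
    ∃ g : Fun EQ Q, comapFun π hπ.smooth g = f :=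
  exists_descend hπ.submersion hπ.surjective f fun s t h => eq_of_sameLeaf hf ((hπ.fibre s t).1 h)

variable [T2Space Q]

include hπ in
-- The bracket is related to `[V, 0] = 0`.
lemma lie_mem_secs_of_restricts {Z : VF ES S} {V : VF EQ Q} (H : Restricts π V Z) {W : VF ES S}
    (hW : W ∈ secs 𝓓.D) : ⁅Z, W⁆ ∈ secs 𝓓.D := by
  rw [mem_secs_iff hπ] at hW ⊢
  have h := H.lie hπ.smooth hW
  rwa [lie_zero] at h

include hπ in
/-- Vector fields normalizing the foliation are projectable. -/
lemma exists_project {Z : VF ES S} (hZ : ∀ W ∈ secs 𝓓.D, ⁅Z, W⁆ ∈ secs 𝓓.D) :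
    ∃ V : VF EQ Q, Restricts π V Z := by
  -- For `W` in `Γ(D)`, `W (Z (π^* g)) = Z (W (π^* g)) - [Z, W] (π^* g) = 0`, so `Z` preserves the
  -- functions pulled back from `Q`. Injectivity of `π^*` makes the induced operator a derivation,
  -- hence a field on `Q`.
  have hd : ∀ g : Fun EQ Q, ∃ g' : Fun EQ Q,
      comapFun π hπ.smooth g' = ⁅Z, comapFun π hπ.smooth g⁆ := fun g => by
    refine exists_descend_of_invariant hπ fun W hW => ?_
    have h := VF.lie_lie_fun Z W (comapFun π hπ.smooth g)
    rw [lie_eq_zero_of_comapFun hπ g hW, lie_eq_zero_of_comapFun hπ g (hZ W hW), lie_zero,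
      zero_sub, zero_eq_neg] at h
    exact h
  choose d hd using hd
  have hinj := comapFun_injective (ES := ES) (EQ := EQ) hπ.surjective hπ.smooth
  obtain ⟨V, hV⟩ := exists_vf_of_derivation d
    (fun f g => hinj (by rw [hd, map_add, map_add, hd, hd, lie_add]))
    (fun c f => hinj (by rw [hd, map_smul, map_smul, hd, lie_smul]))
    (fun f g => hinj (by
      rw [hd, map_mul, map_add, map_mul, map_mul, hd, hd, LieRinehartRing.leibniz_mul_right,
        smul_eq_mul, mul_comm ⁅Z, _⁆]))
  refine ⟨V, (restricts_iff hπ.smooth).2 fun g => ?_⟩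
  rw [hV, hd]

variable [T2Space S] [SecondCountableTopology S]

include hπ in
/-- Every tangent vector extends to a projectable vector field. -/
lemma exists_projectable (s : S) (v : TangentSpace 𝓘(ℝ, ES) s) :
    ∃ (V : VF EQ Q) (Z : VF ES S), Restricts π V Z ∧ Z s = v := by
  let V := extendVec (π s) (mfderiv 𝓘(ℝ, ES) 𝓘(ℝ, EQ) π s v)
  obtain ⟨Z, hZ⟩ := exists_lift hπ.submersion V
  have hD : v - Z s ∈ 𝓓.D s := by
    rw [← hπ.tangent, map_sub, ← hZ s, extendVec_apply, sub_self]
  obtain ⟨W, hW, hWs⟩ := 𝓓.smooth s _ hD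
  refine ⟨V, Z + W, ?_, ?_⟩
  · have h := hZ.add ((mem_secs_iff hπ).1 hW)
    rwa [add_zero] at h
  · change Z s + W s = v
    rw [hWs, add_sub_cancel]

end Foliation

/-! ### The constraint objects in geometric terms, and the reduced algebra -/

section Constraint

variable {EM M ES S EQ Q : Type*}
    [NormedAddCommGroup EM] [NormedSpace ℝ EM] [FiniteDimensional ℝ EM]
    [TopologicalSpace M] [ChartedSpace EM M] [IsManifold 𝓘(ℝ, EM) ∞ M]
    [T2Space M] [SecondCountableTopology M]
    [NormedAddCommGroup ES] [NormedSpace ℝ ES] [FiniteDimensional ℝ ES]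
    [TopologicalSpace S] [ChartedSpace ES S] [IsManifold 𝓘(ℝ, ES) ∞ S] [T2Space S]
    {j : S → M} (hj : Manifold.IsSmoothEmbedding 𝓘(ℝ, ES) 𝓘(ℝ, EM) ∞ j)
    (hcl : IsClosed (Set.range j)) {𝓓 : RegularFoliation ES S}

lemma mem_I_iff (hs : ContMDiff 𝓘(ℝ, ES) 𝓘(ℝ, EM) ∞ j) {f : Fun EM M} :
    f ∈ (symmetryData j 𝓓).I ↔ comapFun j hs f = 0 :=
  ⟨fun h => ContMDiffMap.ext h, fun h s => congrArg (fun f : Fun ES S => f s) h⟩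

include hj hcl in
-- A derivation preserving `I` acts on `A / I`, which is `C^∞(S)` because functions extend; the
-- resulting derivation is the restricted vector field.
lemma mem_derWobs_iff {Y : VF EM M} : Y.toDer ∈ derWobs (R := ℝ) (symmetryData j 𝓓).I ↔
    ∃ Z : VF ES S, Restricts j Y Z := by
  refine ⟨fun h => ?_, fun ⟨Z, hZ⟩ f hf => ?_⟩
  · have hJ := hj.contMDiff
    have key : ∀ f g : Fun EM M, comapFun j hJ f = comapFun j hJ g →
        comapFun j hJ ⁅Y, f⁆ = comapFun j hJ ⁅Y, g⁆ := fun f g hfg => by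
      have := (mem_I_iff hJ).1 (h (f - g) ((mem_I_iff hJ).2 (by rw [map_sub, hfg, sub_self])))
      rwa [map_sub, map_sub, sub_eq_zero] at this
    -- The extensions are chosen without any linearity; `key` makes the result independent of the
    -- choice.
    choose e he using exists_extension hj hcl
    obtain ⟨Z, hZ⟩ := exists_vf_of_derivation (fun f => comapFun j hJ ⁅Y, e f⁆)
      (fun f g => by
        rw [← map_add, ← lie_add]
        exact key _ _ (by rw [he, map_add, he, he]))
      (fun c f => by
        rw [← map_smul, ← lie_smul]
        exact key _ _ (by rw [he, map_smul, he]))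
      (fun f g => by
        rw [key (e (f * g)) (e f * e g) (by rw [he, map_mul, he, he]),
          LieRinehartRing.leibniz_mul_right, map_add, smul_eq_mul, map_mul, map_mul, he, he,
          mul_comm (comapFun j hJ ⁅Y, _⁆)])
    refine ⟨Z, (restricts_iff hJ).2 fun f => ?_⟩
    rw [hZ]
    exact key _ _ (he _)
  · rw [mem_I_iff hj.contMDiff] at hf ⊢
    rw [VF.toDer_apply, ← hZ.lie_comapFun hj.contMDiff, hf, lie_zero]

include hj hcl in
lemma Restricts.unique {Y : VF EM M} {Z Z' : VF ES S} (H : Restricts j Y Z)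
    (H' : Restricts j Y Z') : Z = Z' :=
  ContMDiffSection.ext fun s => embedding_mfderiv_injective hj hcl ((H s).symm.trans (H' s))

include hj hcl in
-- Membership in `F` only gives a vector of `D` at each point. Smoothness comes from tangency of
-- `Y`: the restricted field has these values, as `dj` is injective.
lemma mem_F_iff {Y : VF EM M} : Y.toDer ∈ (symmetryData j 𝓓).F ↔
    ∃ Z ∈ secs 𝓓.D, Restricts j Y Z := by
  refine ⟨fun h => ?_, fun ⟨Z, hZD, hZ⟩ s => ⟨Z s, hZD s, fun f => ?_⟩⟩
  · obtain ⟨Z, hZ⟩ := (mem_derWobs_iff hj hcl).1 ((symmetryData j 𝓓).le_wobs _ h)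
    refine ⟨Z, fun s => ?_, hZ⟩
    obtain ⟨v, hv, hvf⟩ := h s
    have : Z s = v := embedding_mfderiv_injective hj hcl
      ((hZ s).symm.trans (tangent_ext fun f => hvf f))
    rwa [this]
  · rw [← hZ s]; rfl

include hj hcl in
-- Every section of `D` extends to a field in `F`, so normalizing `F` tests all of `Γ(D)`;
-- uniqueness of the restriction identifies the restricted bracket.
lemma mem_lieWobs_iff {Y : VF EM M} : Y.toDer ∈ (symmetryData j 𝓓).lieWobs ↔
    ∃ Z : VF ES S, Restricts j Y Z ∧ ∀ W ∈ secs 𝓓.D, ⁅Z, W⁆ ∈ secs 𝓓.D := by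
  have hneg : ∀ Z W : VF ES S, ⁅Z, W⁆ ∈ secs 𝓓.D → ⁅W, Z⁆ ∈ secs 𝓓.D := fun Z W h s => by
    rw [← lie_skew]
    exact (𝓓.D s).neg_mem (h s)
  refine ⟨fun h => ?_, fun ⟨Z, hZ, hD⟩ => ⟨(mem_derWobs_iff hj hcl).2 ⟨Z, hZ⟩, fun X hX => ?_⟩⟩
  · obtain ⟨Z, hZ⟩ := (mem_derWobs_iff hj hcl).1 h.1
    refine ⟨Z, hZ, fun W hW => hneg _ _ ?_⟩
    obtain ⟨X, hX⟩ := exists_extension_vf hj hcl W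
    have h1 := h.2 X.toDer ((mem_F_iff hj hcl).2 ⟨W, hW, hX⟩)
    rw [← VF.toDer_lie, mem_F_iff hj hcl] at h1
    obtain ⟨W', hW', hXW⟩ := h1
    rwa [(hX.lie hj.contMDiff hZ).unique hj hcl hXW]
  · obtain ⟨X, rfl⟩ := toDer_bijective.surjective X
    obtain ⟨W, hW, hXW⟩ := (mem_F_iff hj hcl).1 hX
    rw [← VF.toDer_lie, mem_F_iff hj hcl]
    exact ⟨⁅W, Z⁆, hneg _ _ (hD W hW), hXW.lie hj.contMDiff hZ⟩

include hj hcl in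
-- This is involutivity of `D`.
lemma F_le_lieWobs {X : Derivation ℝ (Fun EM M) (Fun EM M)} (hX : X ∈ (symmetryData j 𝓓).F) :
    X ∈ (symmetryData j 𝓓).lieWobs := by
  obtain ⟨X, rfl⟩ := toDer_bijective.surjective X
  obtain ⟨W, hW, hXW⟩ := (mem_F_iff hj hcl).1 hX
  exact (mem_lieWobs_iff hj hcl).2 ⟨W, hXW, fun W' hW' => 𝓓.involutive W hW W' hW'⟩

include hj hcl in
lemma mem_algWobs_iff {f : Fun EM M} : f ∈ (symmetryData j 𝓓).algWobs ↔
    ∀ W ∈ secs 𝓓.D, ⁅W, comapFun j hj.contMDiff f⁆ = 0 := by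
  refine ⟨fun h W hW => ?_, fun h X hX => ?_⟩
  · obtain ⟨X, hX⟩ := exists_extension_vf hj hcl W
    rw [hX.lie_comapFun hj.contMDiff]
    exact (mem_I_iff hj.contMDiff).1 (h X.toDer ((mem_F_iff hj hcl).2 ⟨W, hW, hX⟩))
  · obtain ⟨X, rfl⟩ := toDer_bijective.surjective X
    obtain ⟨W, hW, hXW⟩ := (mem_F_iff hj hcl).1 hX
    rw [mem_I_iff hj.contMDiff, VF.toDer_apply, ← hXW.lie_comapFun hj.contMDiff, h W hW]

variable [NormedAddCommGroup EQ] [NormedSpace ℝ EQ] [FiniteDimensional ℝ EQ]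
    [TopologicalSpace Q] [ChartedSpace EQ Q] [IsManifold 𝓘(ℝ, EQ) ∞ Q]
    {π : S → Q} (hπ : 𝓓.IsLeafSpace (E' := EQ) π)

include hj hcl hπ in
lemma mem_algWobs_iff_exists {f : Fun EM M} : f ∈ (symmetryData j 𝓓).algWobs ↔
    ∃ g : Fun EQ Q, comapFun π hπ.smooth g = comapFun j hj.contMDiff f := by
  rw [mem_algWobs_iff hj hcl]
  refine ⟨fun h => exists_descend_of_invariant hπ h, fun ⟨g, hg⟩ W hW => ?_⟩
  rw [← hg, lie_eq_zero_of_comapFun hπ g hW]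

include hj hcl hπ in
lemma mem_algWobs_iff_sameLeaf {f : Fun EM M} : f ∈ (symmetryData j 𝓓).algWobs ↔
    ∀ s t, 𝓓.SameLeaf s t → f (j s) = f (j t) := by
  refine ⟨fun h s t hst => eq_of_sameLeaf ((mem_algWobs_iff hj hcl).1 h) hst, fun h => ?_⟩
  rw [mem_algWobs_iff_exists hj hcl hπ]
  exact exists_descend hπ.submersion hπ.surjective (comapFun j hj.contMDiff f) fun s t hst =>
    h s t ((hπ.fibre s t).1 hst)

include hj hcl hπ in
-- The class of `f` goes to the unique `g` with `π^* g = j^* f`. Algebraic identities are checked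
-- after the injective `π^*`; the kernel is `I`, and a preimage of `g` is an extension of `π^* g`.
lemma exists_algEquiv (P : SymmetryData ℝ (Fun EM M)) (hP : P = symmetryData j 𝓓) :
    ∃ φ : P.AlgRed ≃ₐ[ℝ] Fun EQ Q, ∀ (f : P.algWobs) (s : S),
      φ (Ideal.Quotient.mk P.algNull f) (π s) = f.1 (j s) := by
  have hW : ∀ f : Fun EM M, f ∈ P.algWobs ↔
      ∃ g : Fun EQ Q, comapFun π hπ.smooth g = comapFun j hj.contMDiff f := fun f => by
    rw [hP]
    exact mem_algWobs_iff_exists hj hcl hπ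
  have hI : ∀ f : Fun EM M, f ∈ P.I ↔ comapFun j hj.contMDiff f = 0 := fun f => by
    rw [hP]
    exact mem_I_iff hj.contMDiff
  have hinj := comapFun_injective (ES := ES) (EQ := EQ) hπ.surjective hπ.smooth
  choose d hd using fun f : P.algWobs => (hW f).1 f.2
  let φ₀ : P.algWobs →ₐ[ℝ] Fun EQ Q :=
    { toFun := d
      map_one' := hinj (by rw [hd, map_one]; rfl)
      map_mul' := fun f g => hinj (by rw [map_mul, hd, hd, hd, ← map_mul]; rfl)
      map_zero' := hinj (by rw [hd, map_zero]; rfl)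
      map_add' := fun f g => hinj (by rw [map_add, hd, hd, hd, ← map_add]; rfl)
      commutes' := fun c => hinj (by rw [hd, AlgHom.commutes]; rfl) }
  have hφ₀ : ∀ f : P.algWobs, f ∈ P.algNull ↔ φ₀ f = 0 := fun f => by
    rw [← hinj.eq_iff, map_zero]
    change f.1 ∈ P.I ↔ comapFun π hπ.smooth (d f) = 0
    rw [hd]
    exact hI f
  let φ₁ : P.AlgRed →ₐ[ℝ] Fun EQ Q := Ideal.Quotient.liftₐ P.algNull φ₀ fun f hf => (hφ₀ f).1 hf
  refine ⟨AlgEquiv.ofBijective φ₁ ⟨?_, fun g => ?_⟩, fun f s =>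
    congrArg (fun f : Fun ES S => f s) (hd f)⟩
  · refine (injective_iff_map_eq_zero φ₁).2 fun a ha => ?_
    obtain ⟨f, rfl⟩ := Ideal.Quotient.mk_surjective a
    exact Ideal.Quotient.eq_zero_iff_mem.2 ((hφ₀ f).2 ha)
  · obtain ⟨F, hF⟩ := exists_extension hj hcl (comapFun π hπ.smooth g)
    refine ⟨Ideal.Quotient.mk _ ⟨F, (hW F).2 ⟨g, hF.symm⟩⟩, ?_⟩
    exact hinj ((hd _).trans hF)

end Constraint

/-! ### The reduced Lie–Rinehart algebra -/

section LieReduction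

variable {EM M ES S EQ Q : Type*}
    [NormedAddCommGroup EM] [NormedSpace ℝ EM] [FiniteDimensional ℝ EM]
    [TopologicalSpace M] [ChartedSpace EM M] [IsManifold 𝓘(ℝ, EM) ∞ M]
    [T2Space M] [SecondCountableTopology M]
    [NormedAddCommGroup ES] [NormedSpace ℝ ES] [FiniteDimensional ℝ ES]
    [TopologicalSpace S] [ChartedSpace ES S] [IsManifold 𝓘(ℝ, ES) ∞ S]
    [T2Space S] [SecondCountableTopology S]
    [NormedAddCommGroup EQ] [NormedSpace ℝ EQ] [FiniteDimensional ℝ EQ]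
    [TopologicalSpace Q] [ChartedSpace EQ Q] [IsManifold 𝓘(ℝ, EQ) ∞ Q] [T2Space Q]
    {j : S → M} (hj : Manifold.IsSmoothEmbedding 𝓘(ℝ, ES) 𝓘(ℝ, EM) ∞ j)
    (hcl : IsClosed (Set.range j)) {𝓓 : RegularFoliation ES S}
    {π : S → Q} (hπ : 𝓓.IsLeafSpace (E' := EQ) π)

lemma restricts_unique_of_surjective {h : S → Q} (hs : Function.Surjective h) {V V' : VF EQ Q}
    {Z : VF ES S} (H : Restricts h V Z) (H' : Restricts h V' Z) : V = V' :=
  ContMDiffSection.ext fun q => by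
    obtain ⟨s, rfl⟩ := hs q
    rw [H s, H' s]

include hj hcl hπ in
-- A normalizing field restricts to `S` and then projects. The projection vanishes exactly when the
-- restriction lies in `Γ(D)`; a preimage of a field on `Q` is a lift extended to `M`.
lemma exists_bijective_project (P : SymmetryData ℝ (Fun EM M)) (hP : P = symmetryData j 𝓓) :
    ∃ Φ : P.LieRed →ₗ[ℝ] VF EQ Q, Function.Bijective Φ ∧
      ∀ X : P.lieWobs, ∃ (Y : VF EM M) (Z : VF ES S), Y.toDer = X.1 ∧ Restricts j Y Z ∧
        Restricts π (Φ (LieSubmodule.Quotient.mk X)) Z := by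
  have hW : ∀ Y : VF EM M, Y.toDer ∈ P.lieWobs ↔
      ∃ Z : VF ES S, Restricts j Y Z ∧ ∀ W ∈ secs 𝓓.D, ⁅Z, W⁆ ∈ secs 𝓓.D := fun Y => by
    rw [hP]
    exact mem_lieWobs_iff hj hcl
  have hF : ∀ Y : VF EM M, Y.toDer ∈ P.F ↔ ∃ Z ∈ secs 𝓓.D, Restricts j Y Z := fun Y => by
    rw [hP]
    exact mem_F_iff hj hcl
  clear hP
  have hex : ∀ X : P.lieWobs, ∃ (V : VF EQ Q) (Y : VF EM M) (Z : VF ES S), Y.toDer = X.1 ∧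
      Restricts j Y Z ∧ Restricts π V Z := fun X => by
    obtain ⟨Y, hY⟩ := toDer_bijective.surjective X.1
    obtain ⟨Z, hZ, hD⟩ := (hW Y).1 (hY ▸ X.2)
    obtain ⟨V, hV⟩ := exists_project hπ hD
    exact ⟨V, Y, Z, hY, hZ, hV⟩
  choose V Y Z hY hZ hV using hex
  -- Any chain of related fields starting at `X` computes `V X`; linearity, the kernel and
  -- surjectivity follow by exhibiting such chains.
  have key : ∀ (X : P.lieWobs) (Y' : VF EM M) (Z' : VF ES S) (W : VF EQ Q), Y'.toDer = X.1 →
      Restricts j Y' Z' → Restricts π W Z' → V X = W := fun X Y' Z' W h1 h2 h3 => by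
    obtain rfl : Y' = Y X := toDer_bijective.injective (h1.trans (hY X).symm)
    rw [h2.unique hj hcl (hZ X)] at h3
    exact restricts_unique_of_surjective hπ.surjective (hV X) h3
  have hker : ∀ X : P.lieWobs, X ∈ P.lieNull ↔ V X = 0 := fun X => by
    change X.1 ∈ P.F ↔ _
    rw [← hY, hF]
    refine ⟨fun ⟨Z', hD, hZ'⟩ => key X _ Z' 0 (hY X) hZ' ((mem_secs_iff hπ).1 hD), fun h =>
      ⟨Z X, (mem_secs_iff hπ).2 (h ▸ hV X), hZ X⟩⟩
  let Φ₀ : P.lieWobs →ₗ[ℝ] VF EQ Q :=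
    { toFun := V
      map_add' := fun X X' => key _ (Y X + Y X') (Z X + Z X') _
        (by rw [VF.toDer_add, hY, hY]; rfl) ((hZ X).add (hZ X')) ((hV X).add (hV X'))
      map_smul' := fun c X => key _ (c • Y X) (c • Z X) _
        ((LieRinehartAlgebra.anchor ℝ (Fun EM M) (VF EM M)).toLieHom.map_smul c (Y X) |>.trans
          (congrArg (c • ·) (hY X)))
        ((hZ X).const_smul c) ((hV X).const_smul c) }
  let Φ₁ : P.LieRed →ₗ[ℝ] VF EQ Q := Submodule.liftQ P.lieNull.toSubmodule Φ₀
    fun X hX => LinearMap.mem_ker.2 ((hker X).1 hX)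
  have hΦ₁ : ∀ X : P.lieWobs, Φ₁ (LieSubmodule.Quotient.mk X) = V X := fun X => rfl
  refine ⟨Φ₁, ⟨?_, fun W => ?_⟩, fun X => ⟨Y X, Z X, hY X, hZ X, hV X⟩⟩
  · refine (injective_iff_map_eq_zero Φ₁).2 fun x hx => ?_
    obtain ⟨X, rfl⟩ := Submodule.Quotient.mk_surjective _ x
    exact (Submodule.Quotient.mk_eq_zero P.lieNull.toSubmodule).2 ((hker X).2 hx)
  · obtain ⟨Z', hZ'⟩ := exists_lift hπ.submersion W
    obtain ⟨Y', hY'⟩ := exists_extension_vf hj hcl Z'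
    exact ⟨LieSubmodule.Quotient.mk ⟨Y'.toDer, (hW Y').2
      ⟨Z', hY', fun U hU => lie_mem_secs_of_restricts hπ hZ' hU⟩⟩, key _ Y' Z' W rfl hY' hZ'⟩

include hj hcl hπ in
-- Bracket and module compatibility hold because both sides are `π`-related to the same field on
-- `S`; for the action on functions, both sides have the same pullback to `S`.
lemma exists_algEquiv_lieHom (P : SymmetryData ℝ (Fun EM M)) (hP : P = symmetryData j 𝓓) :
    ∃ φ : P.AlgRed ≃ₐ[ℝ] Fun EQ Q,
    ∃ Φ : LieRinehartAlgebra.Hom φ.toAlgHom P.LieRed (VF EQ Q),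
      (∀ (f : P.algWobs) (s : S), φ (Ideal.Quotient.mk P.algNull f) (π s) = f.1 (j s)) ∧
      Function.Bijective (fun x => Φ x) ∧
      ∀ (X : P.lieWobs) (Y : VF EM M) (Z : VF ES S), Y.toDer = X.1 → Restricts j Y Z →
        Restricts π (Φ (LieSubmodule.Quotient.mk X)) Z := by
  obtain ⟨φ, hφ⟩ := exists_algEquiv hj hcl hπ P hP
  obtain ⟨Φ, hbij, hΦ⟩ := exists_bijective_project hj hcl hπ P hP
  clear hP
  have key : ∀ (X : P.lieWobs) (Y : VF EM M) (Z : VF ES S), Y.toDer = X.1 →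
      Restricts j Y Z → Restricts π (Φ (LieSubmodule.Quotient.mk X)) Z := fun X Y Z h1 h2 => by
    obtain ⟨Y', Z', h1', h2', h3⟩ := hΦ X
    obtain rfl : Y = Y' := toDer_bijective.injective (h1.trans h1'.symm)
    rwa [h2.unique hj hcl h2']
  have hmk : ∀ x : P.LieRed, ∃ X : P.lieWobs, LieSubmodule.Quotient.mk X = x :=
    Submodule.Quotient.mk_surjective _
  have h_lie : ∀ x y : P.LieRed, Φ ⁅x, y⁆ = ⁅Φ x, Φ y⁆ := by
    intro x y
    obtain ⟨X, rfl⟩ := hmk x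
    obtain ⟨X', rfl⟩ := hmk y
    obtain ⟨Y, Z, h1, h2, h3⟩ := hΦ X
    obtain ⟨Y', Z', h1', h2', h3'⟩ := hΦ X'
    exact restricts_unique_of_surjective hπ.surjective
      (key ⁅X, X'⁆ ⁅Y, Y'⁆ ⁅Z, Z'⁆ (by rw [VF.toDer_lie, h1, h1']; rfl) (h2.lie hj.contMDiff h2'))
      (h3.lie hπ.smooth h3')
  have h_smul : ∀ (a : P.AlgRed) (x : P.LieRed), Φ (a • x) = φ a • Φ x := by
    intro a x
    obtain ⟨X, rfl⟩ := hmk x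
    obtain ⟨f, rfl⟩ := Ideal.Quotient.mk_surjective a
    obtain ⟨Y, Z, h1, h2, h3⟩ := hΦ X
    exact restricts_unique_of_surjective hπ.surjective
      (key ⟨f.1 • X.1, P.smul_mem_lieWobs f.2 X.2⟩ (f.1 • Y)
        (comapFun j hj.contMDiff f.1 • Z) (by rw [VF.toDer_smul, h1])
        (h2.fun_smul _ fun s => rfl)) (h3.fun_smul _ fun s => (hφ f s).symm)
  have h_act : ∀ (a : P.AlgRed) (x : P.LieRed), φ ⁅x, a⁆ = ⁅Φ x, φ a⁆ := by
    intro a x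
    obtain ⟨X, rfl⟩ := hmk x
    obtain ⟨f, rfl⟩ := Ideal.Quotient.mk_surjective a
    obtain ⟨Y, Z, h1, h2, h3⟩ := hΦ X
    refine ContMDiffMap.ext fun q => ?_
    obtain ⟨s, rfl⟩ := hπ.surjective q
    refine (hφ ⟨X.1 f.1, P.apply_mem_algWobs X.2 f.2⟩ s).trans ?_
    have h4 : comapFun π hπ.smooth (φ (Ideal.Quotient.mk P.algNull f)) =
        comapFun j hj.contMDiff f.1 := ContMDiffMap.ext fun s => hφ f s
    have h5 := congrArg (fun g : Fun ES S => g s)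
      (h3.lie_comapFun hπ.smooth (φ (Ideal.Quotient.mk P.algNull f)))
    rw [h4, h2.lie_comapFun hj.contMDiff] at h5
    exact (congrArg (fun D : Derivation ℝ (Fun EM M) (Fun EM M) => D f.1 (j s)) h1.symm).trans h5
  exact ⟨φ, ⟨⟨Φ, fun {x y} => h_lie x y⟩, h_smul, h_act⟩, hφ, hbij, key⟩

end LieReduction

lemma alternating_congr_of_sub_mem {k : ℕ} {V : Type*} [AddCommGroup V] [Module ℝ V]
    (f : V [⋀^Fin k]→ₗ[ℝ] ℝ) (D : Submodule ℝ V)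
    (hf : ∀ v i, ∀ w ∈ D, f (Function.update v i w) = 0) {v w : Fin k → V}
    (h : ∀ i, v i - w i ∈ D) : f v = f w := by
  classical
  have key : ∀ s : Finset (Fin k), f v = f (s.piecewise w v) := by
    intro s
    induction s using Finset.induction_on with
    | empty => simp
    | insert i s hi ih =>
      rw [ih, Finset.piecewise_insert]
      have h1 : s.piecewise w v = Function.update (s.piecewise w v) i (v i) := by
        conv_lhs => rw [← Function.update_eq_self i (s.piecewise w v)]
        rw [Finset.piecewise_eq_of_notMem _ _ _ hi]
      rw [h1, Function.update_idem, ← sub_eq_zero, ← f.map_update_sub]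
      have h2 := hf (s.piecewise w v) i _ (h i)
      convert h2
  have := key Finset.univ
  rwa [Finset.piecewise_univ] at this

lemma update_apply_vf {E M : Type*} [NormedAddCommGroup E] [NormedSpace ℝ E]
    [TopologicalSpace M] [ChartedSpace E M] [IsManifold 𝓘(ℝ, E) ∞ M] {k : ℕ}
    (Z : Fin k → VF E M) (i : Fin k) (W : VF E M) (x : M) :
    (fun l => Function.update Z i W l x) = Function.update (fun l => Z l x) i (W x) := by
  funext l
  by_cases hl : l = i
  · subst hl; simp
  · simp [hl]

/-! ### Basic forms are the pullbacks from the leaf space -/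

section Basic

variable {ES S EQ Q : Type*}
    [NormedAddCommGroup ES] [NormedSpace ℝ ES] [FiniteDimensional ℝ ES]
    [TopologicalSpace S] [ChartedSpace ES S] [IsManifold 𝓘(ℝ, ES) ∞ S]
    [T2Space S] [SecondCountableTopology S]
    [NormedAddCommGroup EQ] [NormedSpace ℝ EQ] [FiniteDimensional ℝ EQ]
    [TopologicalSpace Q] [ChartedSpace EQ Q] [IsManifold 𝓘(ℝ, EQ) ∞ Q] [T2Space Q]
    {𝓓 : RegularFoliation ES S}
    {π : S → Q} (hπ : 𝓓.IsLeafSpace (E' := EQ) π) {k : ℕ}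

/-- Every vector of `D` lies on a section of `D`, so horizontality is a pointwise condition, while
invariance is an identity between smooth functions. -/
lemma isBasic_iff_eval (η : DiffForm ES S k) : 𝓓.IsBasic η.1 ↔
    (∀ s v i, ∀ w ∈ 𝓓.D s, η.1 s (Function.update v i w) = 0) ∧
    ∀ W ∈ secs 𝓓.D, ∀ Z : Fin k → VF ES S,
      ⁅W, DiffForm.eval η Z⁆ = ∑ i, DiffForm.eval η (Function.update Z i ⁅W, Z i⁆) := by
  have hsum : ∀ (W : VF ES S) (Z : Fin k → VF ES S) s,
      (∑ i, DiffForm.eval η (Function.update Z i ⁅W, Z i⁆)) s =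
      ∑ i, η.1 s (Function.update (fun l => Z l s) i (⁅W, Z i⁆ s)) := fun W Z s => by
    rw [fun_sum_apply]
    exact Finset.sum_congr rfl fun i _ => by rw [DiffForm.eval_apply, update_apply_vf]
  refine ⟨fun h => ⟨fun s v i w hw => ?_, fun W hW Z => ContMDiffMap.ext fun s => ?_⟩,
    fun h W hW Z s => ⟨fun i => h.1 _ _ _ _ (hW s), ?_⟩⟩
  · obtain ⟨W, hW, rfl⟩ := 𝓓.smooth s w hw
    have := (h W hW (fun l => extendVec s (v l)) s).1 i
    simpa only [extendVec_apply] using this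
  · rw [hsum]
    exact (h W hW Z s).2
  · rw [← hsum, ← h.2 W hW Z]
    rfl

include hπ in
-- The form at `q` is `η` on lifted vectors at a chosen point of the fibre. Horizontality removes
-- the dependence on the lifts of the vectors; invariance along leaves removes that on the point.
lemma exists_form_of_isBasic {η : DiffForm ES S k} (hη : 𝓓.IsBasic η.1) :
    ∃ τ : DiffForm EQ Q k, ∀ s, pullback π τ.1 s = η.1 s := by
  obtain ⟨hhor, hlie⟩ := (isBasic_iff_eval η).1 hη
  have hcongr : ∀ (s : S) (v w : Fin k → TangentSpace 𝓘(ℝ, ES) s),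
      (∀ i, mfderiv 𝓘(ℝ, ES) 𝓘(ℝ, EQ) π s (v i) = mfderiv 𝓘(ℝ, ES) 𝓘(ℝ, EQ) π s (w i)) →
      η.1 s v = η.1 s w := fun s v w h =>
    alternating_congr_of_sub_mem (η.1 s).toAlternatingMap (𝓓.D s) (hhor s) fun i => by
      rw [← hπ.tangent, map_sub, h, sub_self]
  -- A linear right inverse of `dπ` makes the form multilinear; neither it nor the base point needs
  -- to vary smoothly.
  have hex : ∀ q : Q, ∃ (s : S) (R : TangentSpace 𝓘(ℝ, EQ) q →ₗ[ℝ] TangentSpace 𝓘(ℝ, ES) s),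
      π s = q ∧ ∀ v : TangentSpace 𝓘(ℝ, EQ) q, mfderiv 𝓘(ℝ, ES) 𝓘(ℝ, EQ) π s (R v) = v :=
    fun q => by
      obtain ⟨s, rfl⟩ := hπ.surjective q
      obtain ⟨R, hR⟩ := LinearMap.exists_rightInverse_of_surjective
        (mfderiv 𝓘(ℝ, ES) 𝓘(ℝ, EQ) π s).toLinearMap
        (LinearMap.range_eq_top.2 (submersion_mfderiv_surjective hπ.submersion s))
      exact ⟨s, R, rfl, fun v => LinearMap.congr_fun hR v⟩
  choose r R hr hR using hex
  let τ : ∀ q : Q, TangentSpace 𝓘(ℝ, EQ) q [⋀^Fin k]→L[ℝ] ℝ := fun q =>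
    toContAlt ((η.1 (r q)).toAlternatingMap.compLinearMap (R q))
  -- On projectable fields the brackets `[W, Z i]` lie in `D`, so invariance of `η` says that `Γ(D)`
  -- kills the function `η(Z)`, which therefore descends. This gives smoothness and independence of
  -- the base point.
  have key : ∀ (V : Fin k → VF EQ Q) (Z : Fin k → VF ES S), (∀ i, Restricts π (V i) (Z i)) →
      ∃ g : Fun EQ Q, (∀ q, τ q (fun i => V i q) = g q) ∧
        ∀ s, g (π s) = η.1 s fun i => Z i s := fun V Z h => by
    obtain ⟨g, hg⟩ := exists_descend_of_invariant hπ (f := DiffForm.eval η Z) fun W hW => by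
      rw [hlie W hW Z]
      refine Finset.sum_eq_zero fun i _ => ContMDiffMap.ext fun s => ?_
      rw [DiffForm.eval_apply, update_apply_vf]
      refine hhor _ _ _ _ ?_
      rw [← lie_skew]
      exact (𝓓.D s).neg_mem (lie_mem_secs_of_restricts hπ (h i) hW s)
    have hg' : ∀ s, g (π s) = η.1 s fun i => Z i s := fun s =>
      congrArg (fun f : Fun ES S => f s) hg
    refine ⟨g, fun q => ?_, hg'⟩
    have h1 := hg' (r q)
    rw [hr] at h1
    rw [h1]
    refine hcongr (r q) _ _ fun i => (hR q _).trans ?_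
    have h2 := h i (r q)
    rw [← h2, hr]
  choose lift hlift using fun V : VF EQ Q => exists_lift hπ.submersion V
  have hτ : τ ∈ DiffForm EQ Q k := fun V => by
    obtain ⟨g, hg, -⟩ := key V _ fun i => hlift (V i)
    exact g.contMDiff.congr hg
  refine ⟨⟨τ, hτ⟩, fun s => ContinuousAlternatingMap.ext fun v => ?_⟩
  obtain ⟨g, hg, hg'⟩ := key _ _ fun i =>
    hlift (extendVec (π s) (mfderiv 𝓘(ℝ, ES) 𝓘(ℝ, EQ) π s (v i)))
  have h1 := (hg (π s)).trans (hg' s)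
  simp only [extendVec_apply] at h1
  refine h1.trans (hcongr s _ _ fun i => ?_)
  rw [← hlift, extendVec_apply]

include hπ in
-- The Lie derivative is tensorial in its arguments, so at a point it may be tested on projectable
-- fields. There `η(Z')` is a function pulled back from `Q` and the bracket terms lie in `D`, so
-- everything vanishes.
lemma isBasic_of_pullback {η : DiffForm ES S k} {τ : DiffForm EQ Q k}
    (h : ∀ s, pullback π τ.1 s = η.1 s) : 𝓓.IsBasic η.1 := by
  have hhor : ∀ s v i, ∀ w ∈ 𝓓.D s, η.1 s (Function.update v i w) = 0 := fun s v i w hw => by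
    rw [← h]
    refine (τ.1 (π s)).map_coord_zero i ?_
    change mfderiv 𝓘(ℝ, ES) 𝓘(ℝ, EQ) π s (Function.update v i w i) = 0
    rw [Function.update_self]
    exact (hπ.tangent s w).2 hw
  refine (isBasic_iff_eval η).2 ⟨hhor, fun W hW Z => ContMDiffMap.ext fun s => ?_⟩
  -- Passing to the algebraic form makes the tensoriality of `lieDer` available.
  obtain ⟨α, hα, -⟩ := exists_unique_represented η
  have hL : ∀ (Z : Fin k → VF ES S),
      ((lieDer W.toDer α).compLinearMap (VF.toDerLin ES S)) Z =
      ⁅W, DiffForm.eval η Z⁆ - ∑ i, DiffForm.eval η (Function.update Z i ⁅W, Z i⁆) := fun Z => by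
    change W.toDer (α fun i => (Z i).toDer) - ∑ i, α (Function.update (fun i => (Z i).toDer) i
      ⁅W.toDer, (Z i).toDer⁆) = _
    rw [hα Z, VF.toDer_apply]
    refine congrArg _ (Finset.sum_congr rfl fun i _ => ?_)
    rw [← hα, ← VF.toDer_lie]
    refine congrArg α (funext fun l => ?_)
    exact (Function.apply_update (fun _ => VF.toDer) Z i ⁅W, Z i⁆ l).symm
  choose V Z' hVZ hZ' using fun i => exists_projectable hπ s (Z i s)
  have h1 := alt_apply_congr ((lieDer W.toDer α).compLinearMap (VF.toDerLin ES S)) (Y := Z)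
    (Z := Z') (x := s) fun i => (hZ' i).symm
  rw [hL, hL] at h1
  have h2 : DiffForm.eval η Z' = comapFun π hπ.smooth (DiffForm.eval τ V) :=
    ContMDiffMap.ext fun s => by
      rw [DiffForm.eval_apply, ← h s, pullback_apply_restricts τ hVZ]
      rfl
  have h3 : ∑ i, DiffForm.eval η (Function.update Z' i ⁅W, Z' i⁆) = 0 :=
    Finset.sum_eq_zero fun i _ => ContMDiffMap.ext fun s => by
      rw [DiffForm.eval_apply, update_apply_vf]
      refine hhor _ _ _ _ ?_
      rw [← lie_skew]
      exact (𝓓.D s).neg_mem (lie_mem_secs_of_restricts hπ (hVZ i) hW s)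
  rw [h2, lie_eq_zero_of_comapFun hπ _ hW, h3, sub_zero] at h1
  exact sub_eq_zero.1 h1

include hπ in
lemma pullback_injective {τ τ' : DiffForm EQ Q k}
    (h : ∀ s, pullback (E' := ES) π τ.1 s = pullback π τ'.1 s) : τ = τ' := by
  refine DiffForm.ext_eval fun V => ContMDiffMap.ext fun q => ?_
  obtain ⟨s, rfl⟩ := hπ.surjective q
  choose Z hZ using fun i => exists_lift hπ.submersion (V i)
  rw [← pullback_apply_restricts τ hZ, h, pullback_apply_restricts τ' hZ]

end Basic

/-! ### The constraint forms in terms of their restriction to the submanifold -/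

section ConstraintForms

variable {EM M ES S : Type*}
    [NormedAddCommGroup EM] [NormedSpace ℝ EM] [FiniteDimensional ℝ EM]
    [TopologicalSpace M] [ChartedSpace EM M] [IsManifold 𝓘(ℝ, EM) ∞ M]
    [T2Space M] [SecondCountableTopology M]
    [NormedAddCommGroup ES] [NormedSpace ℝ ES] [FiniteDimensional ℝ ES]
    [TopologicalSpace S] [ChartedSpace ES S] [IsManifold 𝓘(ℝ, ES) ∞ S]
    [T2Space S] [SecondCountableTopology S]
    {j : S → M} (hj : Manifold.IsSmoothEmbedding 𝓘(ℝ, ES) 𝓘(ℝ, EM) ∞ j)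
    (hcl : IsClosed (Set.range j)) {𝓓 : RegularFoliation ES S} {k : ℕ}

include hj hcl in
lemma exists_pullback (σ : DiffForm EM M k) :
    ∃ η : DiffForm ES S k, ∀ s, η.1 s = pullback j σ.1 s := by
  refine ⟨⟨pullback j σ.1, fun Z => ?_⟩, fun s => rfl⟩
  choose Y hY using fun i => exists_extension_vf hj hcl (Z i)
  exact ((comapFun j hj.contMDiff (DiffForm.eval σ Y)).contMDiff).congr fun s =>
    pullback_apply_restricts σ hY s

variable {σ : DiffForm EM M k} {α : CE ℝ (Fun EM M) k} (h : Represents σ α)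
  {η : DiffForm ES S k} (hη : ∀ s, η.1 s = pullback j σ.1 s)

include h hη in
lemma comapFun_represented (hs : ContMDiff 𝓘(ℝ, ES) 𝓘(ℝ, EM) ∞ j) {Y : Fin k → VF EM M}
    {Z : Fin k → VF ES S} (H : ∀ i, Restricts j (Y i) (Z i)) :
    comapFun j hs (α fun i => (Y i).toDer) = DiffForm.eval η Z := by
  ext s
  rw [h Y, DiffForm.eval_apply, hη, pullback_apply_restricts σ H]
  rfl

include h hη hj in
lemma comapFun_lieDer {X : VF EM M} {W : VF ES S} (HX : Restricts j X W) {Y : Fin k → VF EM M}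
    {Z : Fin k → VF ES S} (H : ∀ i, Restricts j (Y i) (Z i)) :
    comapFun j hj.contMDiff (lieDer X.toDer α fun i => (Y i).toDer) =
      ⁅W, DiffForm.eval η Z⁆ - ∑ i, DiffForm.eval η (Function.update Z i ⁅W, Z i⁆) := by
  change comapFun j hj.contMDiff (X.toDer (α fun i => (Y i).toDer) -
    ∑ i, α (Function.update (fun i => (Y i).toDer) i ⁅X.toDer, (Y i).toDer⁆)) = _
  rw [map_sub, map_sum, VF.toDer_apply, ← HX.lie_comapFun hj.contMDiff,
    comapFun_represented h hη hj.contMDiff H]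
  refine congrArg _ (Finset.sum_congr rfl fun i _ => ?_)
  rw [← VF.toDer_lie, ← comapFun_represented h hη hj.contMDiff
    (Y := Function.update Y i ⁅X, Y i⁆)]
  · refine congrArg (fun V => comapFun j hj.contMDiff (α V)) (funext fun l => ?_)
    exact (Function.apply_update (fun _ => VF.toDer) Y i ⁅X, Y i⁆ l).symm
  · intro l
    by_cases hl : l = i
    · subst hl
      simpa using HX.lie hj.contMDiff (H l)
    · simpa [hl] using H l

variable (P : SymmetryData ℝ (Fun EM M)) (hP : P = symmetryData j 𝓓)

include hj hcl hP in
lemma exists_restricts_of_mem_derWobs {X : Derivation ℝ (Fun EM M) (Fun EM M)}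
    (hX : X ∈ derWobs (R := ℝ) P.I) :
    ∃ (Y : VF EM M) (Z : VF ES S), Y.toDer = X ∧ Restricts j Y Z := by
  obtain ⟨Y, rfl⟩ := toDer_bijective.surjective X
  rw [hP] at hX
  obtain ⟨Z, hZ⟩ := (mem_derWobs_iff hj hcl).1 hX
  exact ⟨Y, Z, rfl, hZ⟩

include hj hcl hP h hη in
-- Fields preserving `I` restrict to `S` and all fields on `S` arise so; the condition thus tests
-- `j^* σ` on all tuples of fields.
lemma forall_mem_I_iff : (∀ Y : Fin k → Derivation ℝ (Fun EM M) (Fun EM M),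
    (∀ i, Y i ∈ derWobs (R := ℝ) P.I) → α Y ∈ P.I) ↔ η = 0 := by
  have hI : ∀ f, f ∈ P.I ↔ comapFun j hj.contMDiff f = 0 := fun f => by
    rw [hP]
    exact mem_I_iff hj.contMDiff
  refine ⟨fun H => DiffForm.ext_eval fun Z => ?_, fun H X hX => ?_⟩
  · choose Y hY using fun i => exists_extension_vf hj hcl (Z i)
    rw [← comapFun_represented h hη hj.contMDiff hY]
    refine ((hI _).1 (H _ fun i => ?_)).trans ?_
    · rw [hP]
      exact (mem_derWobs_iff hj hcl).2 ⟨Z i, hY i⟩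
    · rfl
  · choose Y Z hY hZ using fun i => exists_restricts_of_mem_derWobs hj hcl P hP (hX i)
    obtain rfl : (fun i => (Y i).toDer) = X := funext hY
    rw [hI, comapFun_represented h hη hj.contMDiff hZ, H]
    rfl

include hj hcl hP h in
lemma mem_formNull_iff : α ∈ P.formNull k ↔ ∀ s, pullback (E' := ES) j σ.1 s = 0 := by
  obtain ⟨η, hη⟩ := exists_pullback hj hcl σ
  refine (forall_mem_I_iff hj hcl h hη P hP).trans ?_
  refine ⟨fun H s => by rw [← hη, H]; rfl, fun H => Subtype.ext (funext fun s => ?_)⟩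
  rw [hη, H]
  rfl

include hj hcl hP h in
-- The condition is automatic: a tangent field whose derivation has values in `I` vanishes along
-- `S`, so its restriction is zero.
lemma mem_formTan : α ∈ P.formTan k := by
  rintro X hX ⟨i, hi⟩
  obtain ⟨η, hη⟩ := exists_pullback hj hcl σ
  choose Y Z hY hZ using fun i => exists_restricts_of_mem_derWobs hj hcl P hP (hX i)
  obtain rfl : (fun i => (Y i).toDer) = X := funext hY
  rw [hP] at hi ⊢
  refine (mem_I_iff hj.contMDiff).2 ?_
  rw [comapFun_represented h hη hj.contMDiff hZ]
  ext s
  refine (η.1 s).map_coord_zero i (embedding_mfderiv_injective hj hcl ?_)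
  rw [← hZ, map_zero]
  refine tangent_ext fun f => ?_
  rw [map_zero]
  exact hi f s

include hj hcl hP in
lemma exists_restricts_of_mem_F {X : Derivation ℝ (Fun EM M) (Fun EM M)} (hX : X ∈ P.F) :
    ∃ (Y : VF EM M) (W : VF ES S), W ∈ secs 𝓓.D ∧ Y.toDer = X ∧ Restricts j Y W := by
  obtain ⟨Y, rfl⟩ := toDer_bijective.surjective X
  rw [hP] at hX
  obtain ⟨W, hW, hYW⟩ := (mem_F_iff hj hcl).1 hX
  exact ⟨Y, W, hW, rfl, hYW⟩

include hj hcl hP h hη in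
lemma mem_formWobs_of_isBasic (hb : 𝓓.IsBasic η.1) : α ∈ P.formWobs k := by
  obtain ⟨hhor, hlie⟩ := (isBasic_iff_eval η).1 hb
  have hI : ∀ f, f ∈ P.I ↔ comapFun j hj.contMDiff f = 0 := fun f => by
    rw [hP]
    exact mem_I_iff hj.contMDiff
  refine ⟨mem_formTan hj hcl h P hP, fun X hX => ?_⟩
  obtain ⟨X, W, hW, rfl, hXW⟩ := exists_restricts_of_mem_F hj hcl P hP hX
  refine ⟨?_, fun Y' hY' => ?_⟩
  · cases k with
    | zero => exact zero_mem _
    | succ k =>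
      intro (Y' : Fin k → _) (hY' : ∀ i : Fin k, _)
      choose Y Z hY hZ using fun i => exists_restricts_of_mem_derWobs hj hcl P hP (hY' i)
      have h1 := comapFun_represented h hη hj.contMDiff (Y := Matrix.vecCons X Y)
        (Z := Matrix.vecCons W Z) (Fin.cases hXW hZ)
      have h2 : (fun i => VF.toDer (Matrix.vecCons X Y i)) = Matrix.vecCons X.toDer Y' := by
        refine funext (Fin.cases rfl fun i => hY i)
      rw [h2] at h1
      refine (hI _).2 (h1.trans (ContMDiffMap.ext fun s => ?_))
      have h3 : Matrix.vecCons W Z = Function.update (Matrix.vecCons W Z) 0 W :=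
        (Function.update_eq_self 0 _).symm
      rw [DiffForm.eval_apply, h3, update_apply_vf]
      exact hhor _ _ _ _ (hW s)
  · choose Y Z hY hZ using fun i => exists_restricts_of_mem_derWobs hj hcl P hP (hY' i)
    obtain rfl : (fun i => (Y i).toDer) = Y' := funext hY
    rw [hI, comapFun_lieDer hj h hη hXW hZ, hlie W hW Z, sub_self]

include hj hcl hP h hη in
lemma isBasic_of_mem_formWobs (hα : α ∈ P.formWobs k) : 𝓓.IsBasic η.1 := by
  have hI : ∀ f, f ∈ P.I ↔ comapFun j hj.contMDiff f = 0 := fun f => by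
    rw [hP]
    exact mem_I_iff hj.contMDiff
  have hWobs : ∀ {Y : VF EM M} {Z : VF ES S}, Restricts j Y Z →
      Y.toDer ∈ derWobs (R := ℝ) P.I := fun hZ => by
    rw [hP]
    exact (mem_derWobs_iff hj hcl).2 ⟨_, hZ⟩
  have hF : ∀ {X : VF EM M} {W : VF ES S}, W ∈ secs 𝓓.D → Restricts j X W →
      X.toDer ∈ P.F := fun hW hX => by
    rw [hP]
    exact (mem_F_iff hj hcl).2 ⟨_, hW, hX⟩
  refine (isBasic_iff_eval η).2 ⟨fun s v i w hw => ?_, fun W hW Z => ?_⟩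
  · obtain ⟨W, hW, rfl⟩ := 𝓓.smooth s w hw
    obtain ⟨X, hX⟩ := exists_extension_vf hj hcl W
    cases k with
    | zero => exact i.elim0
    | succ k =>
      have key : ∀ u : Fin k → TangentSpace 𝓘(ℝ, ES) s, η.1 s (Matrix.vecCons (W s) u) = 0 := by
        intro u
        choose Y hY using fun i => exists_extension_vf hj hcl (extendVec s (u i))
        have h1 := comapFun_represented h hη hj.contMDiff (Y := Matrix.vecCons X Y)
          (Z := Matrix.vecCons W fun i => extendVec s (u i)) (Fin.cases hX hY)
        have h2 : (fun i => VF.toDer (Matrix.vecCons X Y i)) =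
            Matrix.vecCons X.toDer fun i => (Y i).toDer :=
          funext (Fin.cases rfl fun i => rfl)
        rw [h2] at h1
        have h3 := (hI _).1 ((hα.2 _ (hF hW hX)).1 (fun i => (Y i).toDer) fun i => hWobs (hY i))
        have h4 := congrArg (fun f : Fun ES S => f s) (h1.symm.trans h3)
        rw [DiffForm.eval_apply] at h4
        refine Eq.trans (congrArg _ (funext (Fin.cases rfl fun i => ?_))) h4
        exact (extendVec_apply s (u i)).symm
      -- The contraction controls only the first slot; a transposition carries the result to slot
      -- `i` up to sign.
      have h1 := (η.1 s).toAlternatingMap.map_perm (Function.update v i (W s)) (Equiv.swap 0 i)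
      have h2 : Function.update v i (W s) ∘ Equiv.swap 0 i =
          Matrix.vecCons (W s) (Matrix.vecTail (Function.update v i (W s) ∘ Equiv.swap 0 i)) := by
        conv_lhs => rw [← Matrix.cons_head_tail (Function.update v i (W s) ∘ Equiv.swap 0 i)]
        congr 1
        simp [Matrix.vecHead]
      rw [h2] at h1
      have h3 := (key _).symm.trans h1
      exact (smul_eq_zero_iff_eq _).1 h3.symm
  · obtain ⟨X, hX⟩ := exists_extension_vf hj hcl W
    choose Y hY using fun i => exists_extension_vf hj hcl (Z i)
    rw [← sub_eq_zero, ← comapFun_lieDer hj h hη hX hY, ← hI]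
    exact (hα.2 _ (hF hW hX)).2 _ fun i => hWobs (hY i)

include hj hcl hP h hη in
lemma mem_formWobs_iff : α ∈ P.formWobs k ↔ 𝓓.IsBasic η.1 :=
  ⟨isBasic_of_mem_formWobs hj hcl h hη P hP, mem_formWobs_of_isBasic hj hcl h hη P hP⟩

include hj hcl hP in
lemma formNull_le_formWobs : P.formNull k ≤ P.formWobs k := by
  intro α hα
  obtain ⟨σ, h, -⟩ := exists_unique_represents α
  obtain ⟨η, hη⟩ := exists_pullback hj hcl σ
  obtain rfl := (forall_mem_I_iff hj hcl h hη P hP).1 hα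
  refine mem_formWobs_of_isBasic hj hcl h hη P hP ((isBasic_iff_eval _).2
    ⟨fun s v i w hw => rfl, fun W hW Z => ?_⟩)
  have h0 : ∀ Z : Fin k → VF ES S, DiffForm.eval 0 Z = 0 := fun Z => rfl
  simp only [h0, lie_zero, Finset.sum_const_zero]

end ConstraintForms

/-! ### Forms in coordinates -/

section Local

variable {E M : Type*} [NormedAddCommGroup E] [NormedSpace ℝ E]
  [TopologicalSpace M] [ChartedSpace E M] [IsManifold 𝓘(ℝ, E) ∞ M]
  [FiniteDimensional ℝ E] [T2Space M] {k : ℕ}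

lemma Coords.expand_form {x₀ : M} (c : Coords (E := E) x₀) (σ : DiffForm E M k) :
    ∀ᶠ x in 𝓝 x₀, ∀ v : Fin k → TangentSpace 𝓘(ℝ, E) x,
      σ.1 x v = ∑ r : Fin k → Fin (Module.finrank ℝ E),
        DiffForm.eval σ (fun a => c.e (r a)) x *
          ∏ a, mvfderiv 𝓘(ℝ, E) (c.g (r a)) x (v a) := by
  filter_upwards [c.expand] with x hx v
  let f : MultilinearMap ℝ (fun _ : Fin k => TangentSpace 𝓘(ℝ, E) x) ℝ :=
    (σ.1 x).toAlternatingMap.toMultilinearMap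
  change f v = _
  conv_lhs => rw [show v = fun a => ∑ i, mvfderiv 𝓘(ℝ, E) (c.g i) x (v a) • c.e i x from
    funext fun a => hx (v a), f.map_sum]
  refine Finset.sum_congr rfl fun r _ => ?_
  rw [f.map_smul_univ, smul_eq_mul, mul_comm]
  rfl

/-- The alternating form with the given coefficients with respect to products of differentials. -/
lemma exists_form_of_coeff {ι : Type*} [Fintype ι] (G : ι → Fun E M)
    (C : (Fin k → ι) → Fun E M) : ∃ σ : DiffForm E M k, ∀ x v,
      σ.1 x v = (k.factorial : ℝ)⁻¹ * ∑ p : Equiv.Perm (Fin k), Equiv.Perm.sign p •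
        ∑ r : Fin k → ι, C r x * ∏ a, mvfderiv 𝓘(ℝ, E) (G (r a)) x (v (p a)) := by
  classical
  -- The sum of products need not be alternating and is antisymmetrized. The factor `1 / k!` makes
  -- this a projection, leaving a sum that is already alternating unchanged.
  let m : ∀ x : M, MultilinearMap ℝ (fun _ : Fin k => TangentSpace 𝓘(ℝ, E) x) ℝ := fun x =>
    ∑ r : Fin k → ι, C r x • (MultilinearMap.mkPiAlgebra ℝ (Fin k) ℝ).compLinearMap
      fun a => (mvfderiv 𝓘(ℝ, E) (G (r a)) x).toLinearMap
  have hm : ∀ x v, m x v = ∑ r : Fin k → ι, C r x * ∏ a, mvfderiv 𝓘(ℝ, E) (G (r a)) x (v a) :=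
    fun x v => by
      rw [sum_apply]
      rfl
  have hform : ∀ x v, toContAlt ((k.factorial : ℝ)⁻¹ • MultilinearMap.alternatization (m x)) v =
      (k.factorial : ℝ)⁻¹ * ∑ p : Equiv.Perm (Fin k), Equiv.Perm.sign p •
        ∑ r : Fin k → ι, C r x * ∏ a, mvfderiv 𝓘(ℝ, E) (G (r a)) x (v (p a)) := fun x v => by
    rw [toContAlt_apply, AlternatingMap.smul_apply, MultilinearMap.alternatization_apply,
      smul_eq_mul]
    refine congrArg _ (Finset.sum_congr rfl fun p _ => ?_)
    rw [MultilinearMap.domDomCongr_apply, hm]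
  refine ⟨⟨fun x => toContAlt ((k.factorial : ℝ)⁻¹ • MultilinearMap.alternatization (m x)),
    fun V => ?_⟩, hform⟩
  simp only [hform]
  let F : Fun E M := (k.factorial : ℝ)⁻¹ • ∑ p : Equiv.Perm (Fin k),
    ((Equiv.Perm.sign p : ℤ) : ℝ) • ∑ r : Fin k → ι, C r * ∏ a, ⁅V (p a), G (r a)⁆
  refine F.contMDiff.congr fun x => ?_
  change _ = evalAt E x F
  simp only [F, map_smul, map_sum, map_mul, map_prod, smul_eq_mul]
  refine congrArg _ (Finset.sum_congr rfl fun p _ => ?_)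
  rw [Units.smul_def, zsmul_eq_mul]
  rfl

end Local

/-! ### Extension to the ambient manifold of forms pulled back from the quotient -/

section Extension

variable {EM M ES S EQ Q : Type*}
    [NormedAddCommGroup EM] [NormedSpace ℝ EM] [FiniteDimensional ℝ EM]
    [TopologicalSpace M] [ChartedSpace EM M] [IsManifold 𝓘(ℝ, EM) ∞ M]
    [T2Space M] [SecondCountableTopology M]
    [NormedAddCommGroup ES] [NormedSpace ℝ ES] [FiniteDimensional ℝ ES]
    [TopologicalSpace S] [ChartedSpace ES S] [IsManifold 𝓘(ℝ, ES) ∞ S]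
    [NormedAddCommGroup EQ] [NormedSpace ℝ EQ] [FiniteDimensional ℝ EQ]
    [TopologicalSpace Q] [ChartedSpace EQ Q] [IsManifold 𝓘(ℝ, EQ) ∞ Q] [T2Space Q]
    {j : S → M} (hj : Manifold.IsSmoothEmbedding 𝓘(ℝ, ES) 𝓘(ℝ, EM) ∞ j)
    (hcl : IsClosed (Set.range j)) {h : S → Q} (hh : ContMDiff 𝓘(ℝ, ES) 𝓘(ℝ, EQ) ∞ h) {k : ℕ}

include hj hcl hh in
-- Near `s₀`, `h^* τ` is a sum of products of differentials of functions on `S` with function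
-- coefficients; all these functions extend to `M`.
lemma exists_local_extension_form (τ : DiffForm EQ Q k) (s₀ : S) :
    ∃ σ : DiffForm EM M k, ∀ᶠ s in 𝓝 s₀,
      pullback (E' := ES) j σ.1 s = pullback (E' := ES) h τ.1 s := by
  obtain ⟨c⟩ := exists_coords (E := EQ) (h s₀)
  choose G hG using fun i => exists_extension hj hcl (comapFun h hh (c.g i))
  choose C hC using fun r : Fin k → Fin (Module.finrank ℝ EQ) =>
    exists_extension hj hcl (comapFun h hh (DiffForm.eval τ fun a => c.e (r a)))
  obtain ⟨σ, hσ⟩ := exists_form_of_coeff G C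
  refine ⟨σ, ?_⟩
  filter_upwards [hh.continuous.continuousAt.eventually (c.expand_form τ)] with s hs
  refine ContinuousAlternatingMap.ext fun v => ?_
  have key : ∀ w : Fin k → TangentSpace 𝓘(ℝ, ES) s,
      ∑ r : Fin k → Fin (Module.finrank ℝ EQ), C r (j s) *
        ∏ a, mvfderiv 𝓘(ℝ, EM) (G (r a)) (j s) (mfderiv 𝓘(ℝ, ES) 𝓘(ℝ, EM) j s (w a)) =
      pullback (E' := ES) h τ.1 s w := fun w => by
    rw [pullback_apply, hs]
    refine Finset.sum_congr rfl fun r _ => ?_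
    have h1 : C r (j s) = DiffForm.eval τ (fun a => c.e (r a)) (h s) :=
      congrArg (fun f : Fun ES S => f s) (hC r)
    rw [h1]
    refine congrArg _ (Finset.prod_congr rfl fun a _ => ?_)
    rw [← mvfderiv_comp_map hj.contMDiff, ← mvfderiv_comp_map hh]
    have h2 : (G (r a) : M → ℝ) ∘ j = c.g (r a) ∘ h :=
      congrArg (fun f : Fun ES S => (f : S → ℝ)) (hG (r a))
    rw [h2]
  rw [pullback_apply, hσ]
  simp only [key]
  -- Along `S` the sum is `h^* τ`, which is alternating, so the `k!` signed terms are equal and the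
  -- normalization cancels.
  have h3 : ∀ p : Equiv.Perm (Fin k), Equiv.Perm.sign p •
      pullback (E' := ES) h τ.1 s (fun a => v (p a)) = pullback (E' := ES) h τ.1 s v := fun p => by
    have h4 := (pullback (E' := ES) h τ.1 s).toAlternatingMap.map_perm v p
    refine (congrArg _ h4).trans ?_
    rw [smul_smul, Int.units_mul_self, one_smul]
    rfl
  have h5 : (k.factorial : ℝ) ≠ 0 := Nat.cast_ne_zero.2 k.factorial_ne_zero
  refine (congrArg _ (Finset.sum_congr rfl fun p _ => h3 p)).trans ?_
  rw [Finset.sum_const, Finset.card_univ, Fintype.card_perm, Fintype.card_fin, nsmul_eq_mul,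
    inv_mul_cancel_left₀ h5]

include hj hcl hh in
lemma exists_extension_form (τ : DiffForm EQ Q k) :
    ∃ σ : DiffForm EM M k, ∀ s,
      pullback (E' := ES) j σ.1 s = pullback (E' := ES) h τ.1 s := by
  have := sigmaCompactSpace_of_secondCountable EM M
  have hloc : ∀ x : M, ∃ (U : Set M) (σ : DiffForm EM M k), IsOpen U ∧ x ∈ U ∧ ∀ s, j s ∈ U →
      pullback (E' := ES) j σ.1 s = pullback (E' := ES) h τ.1 s := fun x => by
    by_cases hx : x ∈ Set.range j
    · obtain ⟨s₀, rfl⟩ := hx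
      obtain ⟨σ, hσ⟩ := exists_local_extension_form hj hcl hh τ s₀
      -- A neighbourhood in `S` is the trace of one in `M`, over which a partition of unity can
      -- work.
      rw [hj.isEmbedding.nhds_eq_comap] at hσ
      obtain ⟨t, ht, hts⟩ := hσ
      obtain ⟨U, hUt, hU, hs⟩ := mem_nhds_iff.1 ht
      exact ⟨U, σ, hU, hs, fun s h => hts (hUt h)⟩
    · exact ⟨(Set.range j)ᶜ, 0, hcl.isOpen_compl, hx, fun s h => absurd ⟨s, rfl⟩ h⟩
  choose U σ hU hxU hσ using hloc
  obtain ⟨ρ, hρ⟩ := SmoothPartitionOfUnity.exists_isSubordinate 𝓘(ℝ, EM) isClosed_univ U hU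
    fun x _ => Set.mem_iUnion.2 ⟨x, hxU x⟩
  have hsum : ∀ (x : M) (v : Fin k → TangentSpace 𝓘(ℝ, EM) x),
      (∑ i ∈ ρ.finsupport x, ρ i x • (σ i).1 x) v = ∑ i ∈ ρ.finsupport x, ρ i x • (σ i).1 x v :=
    fun x v => by
      rw [ContinuousAlternatingMap.sum_apply]
      rfl
  refine ⟨⟨fun x => ∑ i ∈ ρ.finsupport x, ρ i x • (σ i).1 x, fun V => ?_⟩, fun s => ?_⟩
  · have h1 := ρ.contMDiff_finsum_smul (g := fun i => DiffForm.eval (σ i) V)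
      (fun i x _ => (DiffForm.eval (σ i) V).contMDiff x)
    refine h1.congr fun x => ?_
    rw [hsum]
    exact ρ.sum_finsupport_smul_eq_finsum x fun i => DiffForm.eval (σ i) V
  · refine ContinuousAlternatingMap.ext fun v => ?_
    rw [pullback_apply]
    refine (hsum _ _).trans ?_
    have h1 : ∀ i ∈ ρ.finsupport (j s), ρ i (j s) •
        (σ i).1 (j s) (fun a => mfderiv 𝓘(ℝ, ES) 𝓘(ℝ, EM) j s (v a)) =
        ρ i (j s) • pullback (E' := ES) h τ.1 s v := fun i hi => by
      rw [← hσ i s (hρ i (subset_closure ((ρ.mem_finsupport _).1 hi)))]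
      rfl
    rw [Finset.sum_congr rfl h1, ← Finset.sum_smul, ρ.sum_finsupport _ (Set.mem_univ _), one_smul]

end Extension

/-! ### The Chevalley–Eilenberg differential and Cartan's formula -/

section Differential

section Cochains

variable {L V : Type*} [LieRing L] [AddCommGroup V] [LieRingModule L V] {k : ℕ}

lemma removeNth_succ_cons (x : L) (Y : Fin (k + 1) → L) (i : Fin (k + 1)) :
    i.succ.removeNth (Fin.cons x Y : Fin (k + 2) → L) = Fin.cons x (i.removeNth Y) :=
  funext (Fin.cases rfl fun l => by simp [Fin.removeNth])

/-- Cartan's formula `ι_x d = L_x - d ι_x`: the summand of index zero is the Lie derivative, and in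
the others the index shifts by one, which changes the sign. -/
lemma ceDiff_cons (α : (Fin (k + 1) → L) → V) (x : L) (Y : Fin (k + 1) → L) :
    ceDiff α (Fin.cons x Y) = (⁅x, α Y⁆ - ∑ i, α (Function.update Y i ⁅x, Y i⁆)) -
      ceDiff (fun Z => α (Fin.cons x Z)) Y := by
  have h0 : ∀ z : Fin (k + 2) → L, Fin.removeNth 0 z = Fin.tail z := fun z => Fin.removeNth_zero z
  rw [ceDiff, Fin.sum_univ_succ, sub_eq_add_neg (_ - _), ceDiff, ← Finset.sum_neg_distrib]
  congr 1
  · simp only [Fin.val_zero, pow_zero, one_smul, h0, Fin.cons_zero, Fin.tail_cons,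
      Finset.sum_filter, Fin.sum_univ_succ, lt_irrefl, if_false, zero_add, Fin.succ_pos, if_true,
      Fin.cons_succ, ← Fin.cons_update]
  · refine Finset.sum_congr rfl fun i _ => ?_
    simp only [Finset.sum_filter, Fin.sum_univ_succ, Fin.not_lt_zero, if_false, zero_add,
      Fin.succ_lt_succ_iff, Fin.cons_succ, ← Fin.cons_update, removeNth_succ_cons, Fin.val_succ,
      pow_succ, mul_neg, mul_one, neg_smul]

lemma ceDiff_zero_degree (α : (Fin 0 → L) → V) (X : Fin 1 → L) :
    ceDiff α X = ⁅X 0, α Fin.elim0⁆ := by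
  have h : ∀ z : Fin 0 → L, z = Fin.elim0 := fun z => Subsingleton.elim _ _
  simp [ceDiff, Finset.filter_singleton, h]

lemma ceDiff_add (α β : (Fin k → L) → V) (X : Fin (k + 1) → L) :
    ceDiff (fun Y => α Y + β Y) X = ceDiff α X + ceDiff β X := by
  simp only [ceDiff, lie_add, ← Finset.sum_add_distrib, ← smul_add]
  refine Finset.sum_congr rfl fun i _ => congrArg _ ?_
  rw [Finset.sum_add_distrib]
  abel

/-- The Chevalley–Eilenberg differential is natural. -/
lemma map_ceDiff {L' V' : Type*} [LieRing L'] [AddCommGroup V'] [LieRingModule L' V']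
    (r : L → L' → Prop) (hr : ∀ {x y x' y'}, r x y → r x' y' → r ⁅x, x'⁆ ⁅y, y'⁆) (f : V →+ V')
    (hf : ∀ {x y} (v : V), r x y → f ⁅x, v⁆ = ⁅y, f v⁆)
    {α : (Fin k → L) → V} {β : (Fin k → L') → V'}
    (h : ∀ X Y, (∀ i, r (X i) (Y i)) → f (α X) = β Y) {X : Fin (k + 1) → L}
    {Y : Fin (k + 1) → L'} (hXY : ∀ i, r (X i) (Y i)) : f (ceDiff α X) = ceDiff β Y := by
  rw [ceDiff, map_sum, ceDiff]
  refine Finset.sum_congr rfl fun i _ => ?_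
  rw [map_zsmul, map_sub, map_sum, hf _ (hXY i),
    h (i.removeNth X) (i.removeNth Y) fun l => hXY (i.succAbove l)]
  refine congrArg _ (congrArg _ (Finset.sum_congr rfl fun l _ => h _ _ fun m => ?_))
  by_cases hm : i.succAbove m = l
  · simp only [Fin.removeNth_apply, hm, Function.update_self]
    exact hr (hXY i) (hXY l)
  · simp only [Fin.removeNth_apply, Function.update_of_ne hm]
    exact hXY _

end Cochains

variable {R A : Type*} [CommRing R] [CommRing A] [Algebra R A] {k : ℕ}

lemma lieDer_apply (X : Derivation R A A) (α : CE R A k) (Y : Fin k → Derivation R A A) :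
    lieDer X α Y = X (α Y) - ∑ i, α (Function.update Y i ⁅X, Y i⁆) := rfl

lemma lieDer_add_left (X X' : Derivation R A A) (α : CE R A k) (Y : Fin k → Derivation R A A) :
    lieDer (X + X') α Y = lieDer X α Y + lieDer X' α Y := by
  simp only [lieDer_apply, Derivation.add_apply, add_lie, AlternatingMap.map_update_add,
    Finset.sum_add_distrib]
  abel

/-- The correction is `df ∧ ι_X α`; it cancels against the one in `ceDiff_smul`, making `L_X - d
ι_X` linear over `A` in `X`. -/
lemma lieDer_smul_left (f : A) (X : Derivation R A A) (α : CE R A k)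
    (Y : Fin k → Derivation R A A) :
    lieDer (f • X) α Y = f * lieDer X α Y + ∑ i, Y i f * α (Function.update Y i X) := by
  have h : ∀ i, ⁅f • X, Y i⁆ = f • ⁅X, Y i⁆ - Y i f • X := fun i => by
    rw [← lie_skew, LieRinehartRing.leibniz_smul_right, ← lie_skew X, smul_neg,
      Derivation.bracket_eq_fun]
    abel
  simp only [lieDer_apply, Derivation.smul_apply, smul_eq_mul, h, AlternatingMap.map_update_sub,
    AlternatingMap.map_update_smul, Finset.sum_sub_distrib, mul_sub, Finset.mul_sum]
  abel

lemma ceDiff_smul (f : A) (α : CE R A k) (Y : Fin (k + 1) → Derivation R A A) :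
    ceDiff (fun Z => f * α Z) Y = f * ceDiff α Y +
      ∑ i : Fin (k + 1), (-1 : ℤ) ^ (i : ℕ) • (Y i f * α (i.removeNth Y)) := by
  simp only [ceDiff, Derivation.bracket_eq_fun, Derivation.leibniz, smul_eq_mul, ← Finset.mul_sum]
  rw [Finset.mul_sum, ← Finset.sum_add_distrib]
  refine Finset.sum_congr rfl fun i _ => ?_
  rw [mul_smul_comm, ← smul_add]
  congr 1
  ring

lemma lieDer_cons_self (X : Derivation R A A) (α : CE R A (k + 1))
    (Y : Fin k → Derivation R A A) :
    lieDer X α (Matrix.vecCons X Y) = lieDer X (α.curryLeft X) Y := by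
  rw [lieDer_apply, lieDer_apply, Fin.sum_univ_succ]
  have h0 : α (Function.update (Matrix.vecCons X Y) 0 ⁅X, Matrix.vecCons X Y 0⁆) = 0 :=
    α.map_coord_zero 0 (by simp)
  rw [h0, zero_add]
  refine congrArg _ (Finset.sum_congr rfl fun i _ => congrArg α ?_)
  exact (Fin.cons_update (α := fun _ => Derivation R A A) X Y i _).symm

/-- Moving `X` from the first slot to slot `i` passes `i` arguments; this matches the two correction
terms. -/
lemma map_cons_removeNth (X : Derivation R A A) (α : CE R A (k + 1))
    (Y : Fin (k + 1) → Derivation R A A) (i : Fin (k + 1)) :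
    (-1 : ℤ) ^ (i : ℕ) • α (Matrix.vecCons X (i.removeNth Y)) = α (Function.update Y i X) := by
  rw [← Fin.insertNth_removeNth, ← α.neg_one_pow_smul_map_insertNth i, smul_smul, ← pow_add,
    Even.neg_one_pow ⟨_, rfl⟩, one_smul]

/-- An `A`-linear map into alternating maps which vanishes on repeated arguments is an alternating
map in one more variable. -/
lemma exists_alternating_of_curried (T : Derivation R A A →ₗ[A] CE R A k)
    (hT : ∀ X Y i, Y i = X → T X Y = 0) :
    ∃ β : CE R A (k + 1), ∀ X Y, β (Matrix.vecCons X Y) = T X Y := by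
  let T' : Derivation R A A →ₗ[A] MultilinearMap A (fun _ : Fin k => Derivation R A A) A :=
    { toFun := fun X => (T X).toMultilinearMap
      map_add' := fun X X' => by rw [map_add]; rfl
      map_smul' := fun f X => by rw [map_smul]; rfl }
  refine ⟨{ T'.uncurryLeft with map_eq_zero_of_eq' := fun v i l hil hne => ?_ }, fun X Y => rfl⟩
  change T (v 0) (Fin.tail v) = 0
  rcases Fin.eq_zero_or_eq_succ i with rfl | ⟨i, rfl⟩ <;>
    rcases Fin.eq_zero_or_eq_succ l with rfl | ⟨l, rfl⟩
  · exact absurd rfl hne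
  · exact hT _ _ l hil.symm
  · exact hT _ _ i hil
  · exact (T (v 0)).map_eq_zero_of_eq (Fin.tail v) hil fun h => hne (congrArg Fin.succ h)

/-- A transposition brings the repeated argument to the first slot. -/
lemma apply_eq_zero_of_cons {T : CE R A k} {X : Derivation R A A}
    (h : ∀ Y : Fin k → Derivation R A A, ∀ i : Fin k, (i : ℕ) = 0 → Y i = X → T Y = 0)
    (Y : Fin k → Derivation R A A) (i : Fin k) (hi : Y i = X) : T Y = 0 := by
  cases k with
  | zero => exact i.elim0
  | succ k =>
    have h1 := T.map_perm Y (Equiv.swap 0 i)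
    rw [h _ 0 rfl (by simp [hi])] at h1
    exact (smul_eq_zero_iff_eq _).1 h1.symm

/-- The Chevalley–Eilenberg differential preserves alternating `A`-multilinear forms. -/
lemma exists_ceDiff (α : CE R A k) : ∃ β : CE R A (k + 1), ∀ X, β X = ceDiff α X := by
  -- Cartan's formula expresses the curried `d α` as `X ↦ L_X α - d (ι_X α)`, with `d` on the right
  -- applied in one degree less.
  induction k with
  | zero =>
    obtain ⟨β, hβ⟩ := exists_alternating_of_curried (k := 0) (R := R) (A := A)
      { toFun := fun X => lieDer X α
        map_add' := fun X X' => AlternatingMap.ext fun Y => lieDer_add_left X X' α Y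
        map_smul' := fun f X => AlternatingMap.ext fun Y => by
          rw [lieDer_smul_left, Finset.univ_eq_empty, Finset.sum_empty, add_zero]
          rfl } fun _ _ i => i.elim0
    refine ⟨β, fun X => ?_⟩
    rw [← Matrix.cons_head_tail X, hβ, ceDiff_zero_degree]
    change Matrix.vecHead X (α _) - ∑ i : Fin 0, _ = Matrix.vecHead X (α _)
    rw [Finset.univ_eq_empty, Finset.sum_empty, sub_zero]
    exact congrArg (fun Y => Matrix.vecHead X (α Y)) (Subsingleton.elim _ _)
  | succ k ih =>
    choose d hd using fun γ : CE R A k => ih γ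
    have hcurry : ∀ (X : Derivation R A A) Y, α.curryLeft X Y = α (Fin.cons X Y) := fun X Y => rfl
    let T : Derivation R A A →ₗ[A] CE R A (k + 1) :=
      { toFun := fun X => lieDer X α - d (α.curryLeft X)
        map_add' := fun X X' => AlternatingMap.ext fun Y => by
          simp only [AlternatingMap.sub_apply, AlternatingMap.add_apply, hd, map_add,
            lieDer_add_left]
          have h := ceDiff_add (α.curryLeft X) (α.curryLeft X') Y
          rw [show ceDiff (⇑(α.curryLeft X + α.curryLeft X')) Y = _ from h]
          abel
        map_smul' := fun f X => AlternatingMap.ext fun Y => by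
          simp only [AlternatingMap.sub_apply, AlternatingMap.smul_apply, hd, map_smul,
            lieDer_smul_left, RingHom.id_apply, smul_eq_mul]
          have h := ceDiff_smul f (α.curryLeft X) Y
          rw [show ceDiff (⇑(f • α.curryLeft X)) Y = _ from h]
          have h2 : ∑ i : Fin (k + 1), (-1 : ℤ) ^ (i : ℕ) •
              (Y i f * α.curryLeft X (i.removeNth Y)) =
              ∑ i, Y i f * α (Function.update Y i X) :=
            Finset.sum_congr rfl fun i _ => by
              rw [← mul_smul_comm, ← map_cons_removeNth]
              rfl
          rw [h2]
          ring }
    have hTapp : ∀ X Y, T X Y = lieDer X α Y - ceDiff (α.curryLeft X) Y := fun X Y => by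
      rw [← hd]
      rfl
    -- If `X` is repeated, the first term is `L_X (ι_X α)` because `[X, X] = 0`. Cartan's formula
    -- for `ι_X α`, with `ι_X ι_X α = 0`, gives the same value for the second, so they cancel.
    -- Degree zero of `ι_X α` is treated by hand, as that formula needs a positive degree.
    obtain ⟨β, hβ⟩ := exists_alternating_of_curried T fun X => apply_eq_zero_of_cons
      fun Y i hi hYi => by
        obtain rfl : i = 0 := Fin.ext hi
        have hY : Y = Matrix.vecCons X (Matrix.vecTail Y) := by
          rw [← hYi]
          exact (Matrix.cons_head_tail Y).symm
        rw [hTapp, hY, lieDer_cons_self]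
        cases k with
        | zero =>
          rw [ceDiff_zero_degree]
          change X _ - ∑ i : Fin 0, _ - X _ = 0
          rw [Finset.univ_eq_empty, Finset.sum_empty, sub_zero, sub_eq_zero]
          exact congrArg (fun Y => X (α.curryLeft X Y)) (Subsingleton.elim _ _)
        | succ k =>
          have h1 := ceDiff_cons (α.curryLeft X) X (Matrix.vecTail Y)
          refine (congrArg _ h1).trans ?_
          have h2 : (fun Z => α.curryLeft X (Fin.cons X Z)) = fun _ => 0 := funext fun Z =>
            (α.curryLeft_same X ▸ rfl : (α.curryLeft X).curryLeft X Z = 0)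
          have h3 : ceDiff (fun _ : Fin k → Derivation R A A => (0 : A))
              (Matrix.vecTail Y) = 0 := by
            have := ceDiff_add (fun _ : Fin k → Derivation R A A => (0 : A)) (fun _ => 0)
              (Matrix.vecTail Y)
            simpa using this
          rw [h2, h3, sub_zero]
          exact sub_self _
    refine ⟨β, fun X => ?_⟩
    rw [← Matrix.cons_head_tail X, hβ, hTapp]
    exact (ceDiff_cons α (Matrix.vecHead X) (Matrix.vecTail X)).symm

end Differential

/-! ### Function multiples and contractions of differential forms -/

section FormOperations

variable {E M : Type*} [NormedAddCommGroup E] [NormedSpace ℝ E] [FiniteDimensional ℝ E]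
  [TopologicalSpace M] [ChartedSpace E M] [IsManifold 𝓘(ℝ, E) ∞ M] {k : ℕ}

/-- The product of a form with a function. -/
def DiffForm.funSMul (f : Fun E M) (σ : DiffForm E M k) : DiffForm E M k :=
  ⟨fun x => f x • σ.1 x, fun V => (f * DiffForm.eval σ V).contMDiff⟩

lemma vecCons_apply_vf (X : VF E M) (V : Fin k → VF E M) (x : M) :
    (fun i => Matrix.vecCons X V i x) = Matrix.vecCons (X x) fun i => V i x :=
  funext (Fin.cases rfl fun _ => rfl)

/-- The contraction of a form with a vector field. -/
def DiffForm.contract (X : VF E M) (σ : DiffForm E M (k + 1)) : DiffForm E M k :=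
  ⟨fun x => toContAlt ((σ.1 x).toAlternatingMap.curryLeft (X x)), fun V => by
    refine (DiffForm.eval σ (Matrix.vecCons X V)).contMDiff.congr fun x => ?_
    rw [DiffForm.eval_apply, vecCons_apply_vf]
    rfl⟩

lemma DiffForm.contract_apply (X : VF E M) (σ : DiffForm E M (k + 1)) (x : M)
    (v : Fin k → TangentSpace 𝓘(ℝ, E) x) :
    (DiffForm.contract X σ).1 x v = σ.1 x (Matrix.vecCons (X x) v) := rfl

lemma Represents.contract {X : VF E M} {σ : DiffForm E M (k + 1)}
    {α : CE ℝ (Fun E M) (k + 1)} (h : Represents σ α) :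
    Represents (DiffForm.contract X σ) (α.curryLeft X.toDer) := fun Y => by
  have h1 := h (Matrix.vecCons X Y)
  have h2 : (fun i => (Matrix.vecCons X Y i).toDer) =
      Matrix.vecCons X.toDer fun i => (Y i).toDer := funext (Fin.cases rfl fun _ => rfl)
  rw [h2] at h1
  refine Eq.trans h1 (ContMDiffMap.ext fun x => ?_)
  rw [DiffForm.eval_apply, vecCons_apply_vf]
  rfl

variable {E' M' : Type*} [NormedAddCommGroup E'] [NormedSpace ℝ E'] [FiniteDimensional ℝ E']
  [TopologicalSpace M'] [ChartedSpace E' M'] [IsManifold 𝓘(ℝ, E') ∞ M']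

lemma pullback_contract {h : M' → M} {X : VF E M} {Z : VF E' M'} (H : Restricts h X Z)
    (σ : DiffForm E M (k + 1)) (s : M') (v : Fin k → TangentSpace 𝓘(ℝ, E') s) :
    pullback (E' := E') h (DiffForm.contract X σ).1 s v =
      pullback h σ.1 s (Matrix.vecCons (Z s) v) := by
  rw [pullback_apply, pullback_apply, DiffForm.contract_apply, H s]
  exact congrArg _ (funext (Fin.cases rfl fun _ => rfl))

end FormOperations

/-! ### The reduced forms and their operations -/

section Main

variable {EM M ES S EQ Q : Type*}
    [NormedAddCommGroup EM] [NormedSpace ℝ EM] [FiniteDimensional ℝ EM]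
    [TopologicalSpace M] [ChartedSpace EM M] [IsManifold 𝓘(ℝ, EM) ∞ M]
    [T2Space M] [SecondCountableTopology M]
    [NormedAddCommGroup ES] [NormedSpace ℝ ES] [FiniteDimensional ℝ ES]
    [TopologicalSpace S] [ChartedSpace ES S] [IsManifold 𝓘(ℝ, ES) ∞ S]
    [T2Space S] [SecondCountableTopology S]
    [NormedAddCommGroup EQ] [NormedSpace ℝ EQ] [FiniteDimensional ℝ EQ]
    [TopologicalSpace Q] [ChartedSpace EQ Q] [IsManifold 𝓘(ℝ, EQ) ∞ Q]
    [T2Space Q] [SecondCountableTopology Q]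
    {j : S → M} (hj : Manifold.IsSmoothEmbedding 𝓘(ℝ, ES) 𝓘(ℝ, EM) ∞ j)
    (hcl : IsClosed (Set.range j)) {𝓓 : RegularFoliation ES S}
    {π : S → Q} (hπ : 𝓓.IsLeafSpace (E' := EQ) π) {k : ℕ}

/-- Pullback commutes with `d`. Along a smooth map, fields correspond only by relatedness, which is
why naturality is applied to a relation. -/
lemma comapFun_ceDiff (hs : ContMDiff 𝓘(ℝ, ES) 𝓘(ℝ, EM) ∞ j) {σ : DiffForm EM M k}
    {α : CE ℝ (Fun EM M) k} (h : Represents σ α) {η : DiffForm ES S k}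
    (hη : ∀ s, η.1 s = pullback j σ.1 s) {Y : Fin (k + 1) → VF EM M}
    {Z : Fin (k + 1) → VF ES S} (H : ∀ i, Restricts j (Y i) (Z i)) :
    comapFun j hs (ceDiff α fun i => (Y i).toDer) = ceDiff (DiffForm.eval η) Z := by
  refine map_ceDiff (fun D Z => ∃ Y : VF EM M, Y.toDer = D ∧ Restricts j Y Z) ?_
    (comapFun j hs : Fun EM M →+ Fun ES S) ?_ ?_ fun i => ⟨Y i, rfl, H i⟩
  · rintro _ Z _ Z' ⟨Y, rfl, hY⟩ ⟨Y', rfl, hY'⟩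
    exact ⟨⁅Y, Y'⁆, VF.toDer_lie Y Y', hY.lie hs hY'⟩
  · rintro _ Z f ⟨Y, rfl, hY⟩
    exact (hY.lie_comapFun hs f).symm
  · intro X Z hXZ
    choose Y hY hYZ using hXZ
    obtain rfl : (fun i => (Y i).toDer) = X := funext hY
    exact comapFun_represented h hη hs hYZ

lemma ceDiff_eval {σ : DiffForm EM M k} {α : CE ℝ (Fun EM M) k} (h : Represents σ α)
    (V : Fin (k + 1) → VF EM M) :
    ceDiff α (fun i => (V i).toDer) = ceDiff (DiffForm.eval σ) V := by
  refine map_ceDiff (fun (D : Derivation ℝ (Fun EM M) (Fun EM M)) Y => Y.toDer = D) ?_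
    (AddMonoidHom.id (Fun EM M)) ?_ ?_ fun i => rfl
  · rintro _ Y _ Y' rfl rfl
    exact VF.toDer_lie Y Y'
  · rintro _ Y f rfl
    rfl
  · intro X Y hXY
    obtain rfl : (fun i => (Y i).toDer) = X := funext hXY
    exact h Y

variable (P : SymmetryData ℝ (Fun EM M)) (hP : P = symmetryData j 𝓓)

include hj hcl hπ hP in
lemma mem_formWobs_iff_exists {σ : DiffForm EM M k} {α : CE ℝ (Fun EM M) k}
    (h : Represents σ α) : α ∈ P.formWobs k ↔
      ∃ τ : DiffForm EQ Q k, ∀ s, pullback (E' := ES) π τ.1 s = pullback j σ.1 s := by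
  obtain ⟨η, hη⟩ := exists_pullback hj hcl σ
  rw [mem_formWobs_iff hj hcl h hη P hP]
  refine ⟨fun hb => ?_, fun ⟨τ, hτ⟩ => isBasic_of_pullback hπ fun s => (hτ s).trans (hη s).symm⟩
  obtain ⟨τ, hτ⟩ := exists_form_of_isBasic hπ hb
  exact ⟨τ, fun s => (hτ s).trans (hη s)⟩

include hj hcl hπ hP in
-- The class of `σ` goes to the unique `τ` with `π^* τ = j^* σ`; injectivity of `π^*` gives
-- uniqueness and linearity, and surjectivity is extension of `π^* τ` to `M`.
lemma exists_formEquiv (k : ℕ) : ∃ Ψ : P.FormRed k ≃ₗ[ℝ] DiffForm EQ Q k,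
    ∀ (α : CE ℝ (Fun EM M) k) (hα : α ∈ P.formWobs k) (σ : DiffForm EM M k), Represents σ α →
      ∀ s : S, pullback (E' := ES) π (Ψ (P.formMk α hα)).1 s = pullback j σ.1 s := by
  have hmem : ∀ {α : CE ℝ (Fun EM M) k} {σ : DiffForm EM M k}, Represents σ α →
      (α ∈ P.formWobs k ↔ ∃ τ : DiffForm EQ Q k, ∀ s,
        pullback (E' := ES) π τ.1 s = pullback j σ.1 s) :=
    fun h => mem_formWobs_iff_exists hj hcl hπ P hP h
  have hnull : ∀ {α : CE ℝ (Fun EM M) k} {σ : DiffForm EM M k}, Represents σ α →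
      (α ∈ P.formNull k ↔ ∀ s, pullback (E' := ES) j σ.1 s = 0) :=
    fun h => mem_formNull_iff hj hcl h P hP
  clear hP
  have hex : ∀ x : P.FormRed k, ∃ (α : CE ℝ (Fun EM M) k) (hα : α ∈ P.formWobs k)
      (σ : DiffForm EM M k) (τ : DiffForm EQ Q k), P.formMk α hα = x ∧ Represents σ α ∧
        ∀ s, pullback (E' := ES) π τ.1 s = pullback j σ.1 s := fun x => by
    obtain ⟨α, hα, rfl⟩ := Red.exists_mk x
    obtain ⟨σ, hσ, -⟩ := exists_unique_represents α
    obtain ⟨τ, hτ⟩ := (hmem hσ).1 hα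
    exact ⟨α, hα, σ, τ, rfl, hσ, hτ⟩
  choose α hα σ τ hx hσ hτ using hex
  have hsub : ∀ {α α' : CE ℝ (Fun EM M) k} {σ σ' : DiffForm EM M k}, Represents σ α →
      Represents σ' α' → Represents (σ - σ') (α - α') := fun h h' Y =>
    (congrArg₂ (· - ·) (h Y) (h' Y) :)
  have key : ∀ (x : P.FormRed k) (α' : CE ℝ (Fun EM M) k) (hα' : α' ∈ P.formWobs k)
      (σ' : DiffForm EM M k) (τ' : DiffForm EQ Q k), P.formMk α' hα' = x → Represents σ' α' →
      (∀ s, pullback (E' := ES) π τ'.1 s = pullback j σ'.1 s) → τ x = τ' := by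
    rintro x α' hα' σ' τ' h1 h2 h3
    refine pullback_injective hπ fun s => ?_
    rw [hτ, h3]
    have h4 : α x - α' ∈ P.formNull k := by
      refine (Red.mk_eq_zero (W := P.formWobs k) (sub_mem (hα x) hα')).1 ?_
      exact sub_eq_zero.2 ((hx x).trans h1.symm)
    exact sub_eq_zero.1 ((hnull (hsub (hσ x) h2)).1 h4 s)
  let Ψ : P.FormRed k →ₗ[ℝ] DiffForm EQ Q k :=
    { toFun := τ
      map_add' := fun x y => key _ (α x + α y) (add_mem (hα x) (hα y)) (σ x + σ y) _
        ((congrArg₂ (· + ·) (hx x) (hx y) :))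
        (fun Y => (congrArg₂ (· + ·) (hσ x Y) (hσ y Y) :))
        (fun s => (congrArg₂ (· + ·) (hτ x s) (hτ y s) :))
      map_smul' := fun c x => key _ (algebraMap ℝ P.algWobs c • α x)
        ((P.formWobs k).smul_mem _ (hα x)) (c • σ x) _
        (congrArg (fun y : P.FormRed k => c • y) (hx x))
        (fun Y => (congrArg (fun f : Fun EM M => c • f) (hσ x Y) :))
        (fun s => (congrArg (fun u => c • u) (hτ x s) :)) }
  refine ⟨LinearEquiv.ofBijective Ψ ⟨?_, fun τ' => ?_⟩, fun α' hα' σ' h s => ?_⟩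
  · refine (injective_iff_map_eq_zero Ψ).2 fun x h0 => ?_
    rw [← hx x]
    refine (Red.mk_eq_zero (hα x)).2 ((hnull (hσ x)).2 fun s => ?_)
    rw [← hτ, show τ x = 0 from h0]
    rfl
  · obtain ⟨σ', hσ'⟩ := exists_extension_form hj hcl hπ.smooth τ'
    obtain ⟨α', hα', -⟩ := exists_unique_represented σ'
    exact ⟨P.formMk α' ((hmem hα').2 ⟨τ', fun s => (hσ' s).symm⟩),
      key _ _ _ σ' τ' rfl hα' fun s => (hσ' s).symm⟩
  · obtain ⟨τ', hτ'⟩ := (hmem h).1 hα'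
    rw [← hτ']
    exact congrArg (fun u : DiffForm EQ Q k => pullback (E' := ES) π u.1 s)
      (key _ α' hα' σ' τ' rfl h hτ')

include hπ in
lemma formEquiv_smul (P : SymmetryData ℝ (Fun EM M)) {φ : P.AlgRed → Fun EQ Q}
    (hφ : ∀ (f : P.algWobs) (s : S), φ (Ideal.Quotient.mk P.algNull f) (π s) = f.1 (j s))
    {Ψ : P.FormRed k → DiffForm EQ Q k}
    (hΨ : ∀ (α : CE ℝ (Fun EM M) k) (hα : α ∈ P.formWobs k) (σ : DiffForm EM M k),
      Represents σ α → ∀ s : S,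
        pullback (E' := ES) π (Ψ (P.formMk α hα)).1 s = pullback j σ.1 s)
    (a : P.AlgRed) (x : P.FormRed k) (q : Q) : (Ψ (a • x)).1 q = φ a q • (Ψ x).1 q := by
  obtain ⟨f, rfl⟩ := Ideal.Quotient.mk_surjective a
  obtain ⟨α, hα, rfl⟩ := Red.exists_mk x
  obtain ⟨σ, hσ, -⟩ := exists_unique_represents α
  have h1 : Represents (DiffForm.funSMul f.1 σ) (f • α) := fun Y =>
    (congrArg (fun g : Fun EM M => f.1 * g) (hσ Y) :)
  have h2 : Ψ (P.formMk (f • α) ((P.formWobs k).smul_mem f hα)) =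
      DiffForm.funSMul (φ (Ideal.Quotient.mk P.algNull f)) (Ψ (P.formMk α hα)) :=
    pullback_injective hπ fun s => by
      rw [hΨ _ _ _ h1]
      have h3 := congrArg (fun u => f.1 (j s) • u) (hΨ α hα σ hσ s).symm
      rw [← hφ f s] at h3
      exact (congrArg (fun c : ℝ => c • pullback (E' := ES) j σ.1 s) (hφ f s).symm).trans h3
  exact congrArg (fun u : DiffForm EQ Q k => u.1 q) h2

include hj hcl hπ hP in
-- From `π^* τ = j^* σ` naturality gives `π^* dτ = j^* dσ`. This shows at once that `dσ` is
-- admissible and that its class goes to `dτ`.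
lemma exists_ceDiff_mem_formWobs {Ψ : ∀ k, P.FormRed k → DiffForm EQ Q k}
    (hΨ : ∀ k (α : CE ℝ (Fun EM M) k) (hα : α ∈ P.formWobs k) (σ : DiffForm EM M k),
      Represents σ α → ∀ s : S,
        pullback (E' := ES) π (Ψ k (P.formMk α hα)).1 s = pullback j σ.1 s)
    (α : CE ℝ (Fun EM M) k) (hα : α ∈ P.formWobs k) :
    ∃ β : CE ℝ (Fun EM M) (k + 1), ∃ hβ : β ∈ P.formWobs (k + 1),
      (∀ X, β X = ceDiff α X) ∧ ∀ V : Fin (k + 1) → VF EQ Q,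
        DiffForm.eval (Ψ (k + 1) (P.formMk β hβ)) V =
          ceDiff (DiffForm.eval (Ψ k (P.formMk α hα))) V := by
  obtain ⟨σ, hσ, -⟩ := exists_unique_represents α
  have hτ := hΨ k α hα σ hσ
  set τ := Ψ k (P.formMk α hα)
  obtain ⟨η, hη⟩ := exists_pullback hj hcl σ
  obtain ⟨β, hβ⟩ := exists_ceDiff α
  obtain ⟨σ', hσ', -⟩ := exists_unique_represents β
  obtain ⟨α', hα', -⟩ := exists_unique_represented τ
  obtain ⟨γ, hγ⟩ := exists_ceDiff α'
  obtain ⟨τ', hτ', -⟩ := exists_unique_represents γ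
  have key : ∀ s, pullback (E' := ES) π τ'.1 s = pullback j σ'.1 s := fun s => by
    refine ContinuousAlternatingMap.ext fun v => ?_
    -- The vectors at `s` extend to fields on `S` that both project to `Q` and extend to `M`, so
    -- naturality applies on both sides.
    choose V Z hVZ hZ using fun i => exists_projectable hπ s (v i)
    choose Y hY using fun i => exists_extension_vf hj hcl (Z i)
    obtain rfl : (fun i => Z i s) = v := funext hZ
    rw [pullback_apply_restricts τ' hVZ, pullback_apply_restricts σ' hY, ← hσ', ← hτ', hβ, hγ]
    have h1 := comapFun_ceDiff hj.contMDiff hσ hη hY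
    have h2 := comapFun_ceDiff hπ.smooth hα' (fun s => (hη s).trans (hτ s).symm) hVZ
    exact congrArg (fun f : Fun ES S => f s) (h2.trans h1.symm)
  have hmem : β ∈ P.formWobs (k + 1) :=
    (mem_formWobs_iff_exists hj hcl hπ P hP hσ').2 ⟨τ', key⟩
  refine ⟨β, hmem, hβ, fun V => ?_⟩
  obtain rfl : Ψ (k + 1) (P.formMk β hmem) = τ' :=
    pullback_injective hπ fun s => (hΨ _ β hmem σ' hσ' s).trans (key s).symm
  rw [← hτ', hγ, ceDiff_eval hα']

include hj hcl hπ hP in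
lemma exists_contract_mem_formWobs {Ψ : ∀ k, P.FormRed k → DiffForm EQ Q k}
    (hΨ : ∀ k (α : CE ℝ (Fun EM M) k) (hα : α ∈ P.formWobs k) (σ : DiffForm EM M k),
      Represents σ α → ∀ s : S,
        pullback (E' := ES) π (Ψ k (P.formMk α hα)).1 s = pullback j σ.1 s)
    (α : CE ℝ (Fun EM M) (k + 1)) (hα : α ∈ P.formWobs (k + 1)) {Y : VF EM M} {Z : VF ES S}
    {V : VF EQ Q} (hYZ : Restricts j Y Z) (hVZ : Restricts π V Z) :
    ∃ h : contract Y.toDer α ∈ P.formWobs k, ∀ (q : Q) (v : Fin k → TangentSpace 𝓘(ℝ, EQ) q),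
      (Ψ k (P.formMk (contract Y.toDer α) h)).1 q v =
        (Ψ (k + 1) (P.formMk α hα)).1 q (Matrix.vecCons (V q) v) := by
  obtain ⟨σ, hσ, -⟩ := exists_unique_represents α
  have hc : Represents (DiffForm.contract Y σ) (contract Y.toDer α) := hσ.contract
  have key : ∀ s, pullback (E' := ES) π
      (DiffForm.contract V (Ψ (k + 1) (P.formMk α hα))).1 s =
      pullback j (DiffForm.contract Y σ).1 s := fun s =>
    ContinuousAlternatingMap.ext fun v => by
      rw [pullback_contract hYZ, pullback_contract hVZ, hΨ _ α hα σ hσ s]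
  have hmem : contract Y.toDer α ∈ P.formWobs k :=
    (mem_formWobs_iff_exists hj hcl hπ P hP hc).2 ⟨_, key⟩
  refine ⟨hmem, fun q v => ?_⟩
  have h1 : Ψ k (P.formMk (contract Y.toDer α) hmem) =
      DiffForm.contract V (Ψ (k + 1) (P.formMk α hα)) :=
    pullback_injective hπ fun s => (hΨ _ _ hmem _ hc s).trans (key s).symm
  exact congrArg (fun u : DiffForm EQ Q k => u.1 q v) h1

end Main

end

end ConstraintReduction

/-! ### The reduction theorem -/

theorem mainTheorem8
    {EM M ES S EQ Q : Type*}
    [NormedAddCommGroup EM] [NormedSpace ℝ EM] [FiniteDimensional ℝ EM]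
    [TopologicalSpace M] [ChartedSpace EM M] [IsManifold 𝓘(ℝ, EM) ∞ M]
    [T2Space M] [SecondCountableTopology M]
    [NormedAddCommGroup ES] [NormedSpace ℝ ES] [FiniteDimensional ℝ ES]
    [TopologicalSpace S] [ChartedSpace ES S] [IsManifold 𝓘(ℝ, ES) ∞ S]
    [NormedAddCommGroup EQ] [NormedSpace ℝ EQ] [FiniteDimensional ℝ EQ]
    [TopologicalSpace Q] [ChartedSpace EQ Q] [IsManifold 𝓘(ℝ, EQ) ∞ Q]
    [T2Space Q] [SecondCountableTopology Q]
    -- the closed embedded submanifold `S`, the foliation and its leaf space `π : S → Q`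
    (j : S → M) (hj : Manifold.IsSmoothEmbedding 𝓘(ℝ, ES) 𝓘(ℝ, EM) ∞ j)
    (hcl : IsClosed (Set.range j))
    (𝓓 : ConstraintReduction.RegularFoliation ES S)
    (π : S → Q) (hπ : 𝓓.IsLeafSpace (E' := EQ) π)
    (P : ConstraintReduction.SymmetryData ℝ (ConstraintReduction.Fun EM M))
    (hP : P = ConstraintReduction.symmetryData j 𝓓) :
    -- derivations of `C^∞(M)` are vector fields, forms on derivations are differential forms
    Function.Bijective (ConstraintReduction.VF.toDer (E := EM) (M := M)) ∧
    (∀ k, (∀ α : ConstraintReduction.CE ℝ (ConstraintReduction.Fun EM M) k,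
        ∃! σ : ConstraintReduction.DiffForm EM M k, ConstraintReduction.Represents σ α) ∧
      ∀ σ : ConstraintReduction.DiffForm EM M k,
        ∃! α : ConstraintReduction.CE ℝ (ConstraintReduction.Fun EM M) k,
          ConstraintReduction.Represents σ α) ∧
    -- the constraint objects before reduction, in geometric terms
    (∀ f : ConstraintReduction.Fun EM M,
      f ∈ P.algWobs ↔ ∀ s t, 𝓓.SameLeaf s t → f (j s) = f (j t)) ∧
    (∀ X ∈ P.F, X ∈ P.lieWobs) ∧
    (∀ k, P.formNull k ≤ P.formWobs k) ∧
    (∀ Y : ConstraintReduction.VF EM M, Y.toDer ∈ P.lieWobs ↔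
      ∃ Z : ConstraintReduction.VF ES S, ConstraintReduction.Restricts j Y Z ∧
        ∀ W ∈ ConstraintReduction.secs 𝓓.D, ⁅Z, W⁆ ∈ ConstraintReduction.secs 𝓓.D) ∧
    (∀ Y : ConstraintReduction.VF EM M, Y.toDer ∈ P.F ↔
      ∃ Z ∈ ConstraintReduction.secs 𝓓.D, ConstraintReduction.Restricts j Y Z) ∧
    (∀ k (α : ConstraintReduction.CE ℝ (ConstraintReduction.Fun EM M) k)
      (σ : ConstraintReduction.DiffForm EM M k), ConstraintReduction.Represents σ α →
      (α ∈ P.formWobs k ↔ 𝓓.IsBasic (ConstraintReduction.pullback j σ.1)) ∧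
      (α ∈ P.formNull k ↔
        ∀ s : S, ConstraintReduction.pullback (E' := ES) j σ.1 s = 0)) ∧
    -- the reduced objects
    ∃ φ : P.AlgRed ≃ₐ[ℝ] ConstraintReduction.Fun EQ Q,
    ∃ Φ : LieRinehartAlgebra.Hom φ.toAlgHom
      P.LieRed (ConstraintReduction.VF EQ Q),
    ∃ Ψ : ∀ k, P.FormRed k ≃ₗ[ℝ] ConstraintReduction.DiffForm EQ Q k,
      -- the canonical identification of the reduced algebra with `C^∞(Q)`
      (∀ (f : P.algWobs) (s : S), φ (Ideal.Quotient.mk P.algNull f) (π s) = f.1 (j s)) ∧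
      -- the reduced Lie-Rinehart algebra is `𝔛(Q)`
      Function.Bijective (fun x => Φ x) ∧
      (∀ (X : P.lieWobs) (Y : ConstraintReduction.VF EM M) (Z : ConstraintReduction.VF ES S),
        Y.toDer = X.1 → ConstraintReduction.Restricts j Y Z → ∀ s : S,
          Φ (LieSubmodule.Quotient.mk X) (π s) = mfderiv 𝓘(ℝ, ES) 𝓘(ℝ, EQ) π s (Z s)) ∧
      -- the reduced forms are `Ω(Q)`
      (∀ k (α : ConstraintReduction.CE ℝ (ConstraintReduction.Fun EM M) k)
        (hα : α ∈ P.formWobs k) (σ : ConstraintReduction.DiffForm EM M k),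
        ConstraintReduction.Represents σ α → ∀ s : S,
          ConstraintReduction.pullback (E' := ES) π (Ψ k (P.formMk α hα)).1 s =
            ConstraintReduction.pullback (E' := ES) j σ.1 s) ∧
      -- compatibility with multiplication by functions
      (∀ k (a : P.AlgRed) (x : P.FormRed k) (q : Q),
        (Ψ k (a • x)).1 q = φ a q • (Ψ k x).1 q) ∧
      -- compatibility with the differentials
      (∀ k (α : ConstraintReduction.CE ℝ (ConstraintReduction.Fun EM M) k)
        (hα : α ∈ P.formWobs k),
        ∃ β : ConstraintReduction.CE ℝ (ConstraintReduction.Fun EM M) (k + 1),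
        ∃ hβ : β ∈ P.formWobs (k + 1),
          (∀ X, β X = ConstraintReduction.ceDiff α X) ∧
          ∀ V : Fin (k + 1) → ConstraintReduction.VF EQ Q,
            ConstraintReduction.DiffForm.eval (Ψ (k + 1) (P.formMk β hβ)) V =
              ConstraintReduction.ceDiff
                (ConstraintReduction.DiffForm.eval (Ψ k (P.formMk α hα))) V) ∧
      -- compatibility with contractions
      (∀ k (α : ConstraintReduction.CE ℝ (ConstraintReduction.Fun EM M) (k + 1))
        (hα : α ∈ P.formWobs (k + 1)) (X : P.lieWobs),
        ∃ h : ConstraintReduction.contract X.1 α ∈ P.formWobs k,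
          ∀ (q : Q) (v : Fin k → TangentSpace 𝓘(ℝ, EQ) q),
            (Ψ k (P.formMk (ConstraintReduction.contract X.1 α) h)).1 q v =
              (Ψ (k + 1) (P.formMk α hα)).1 q
                (Matrix.vecCons (Φ (LieSubmodule.Quotient.mk X) q) v)) := by
  -- The separation and countability properties of `S` are inherited from `M`.
  have : T2Space S := hj.isEmbedding.t2Space
  have : SecondCountableTopology S := hj.isEmbedding.secondCountableTopology
  obtain ⟨φ, Φ, hφ, hbij, hΦ⟩ :=
    ConstraintReduction.exists_algEquiv_lieHom hj hcl hπ P hP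
  choose Ψ hΨ using ConstraintReduction.exists_formEquiv hj hcl hπ P hP
  refine ⟨ConstraintReduction.toDer_bijective, fun k =>
    ⟨ConstraintReduction.exists_unique_represents, ConstraintReduction.exists_unique_represented⟩,
    fun f => ?_, fun X hX => ?_, fun k => ConstraintReduction.formNull_le_formWobs hj hcl P hP,
    fun Y => ?_, fun Y => ?_, fun k α σ h =>
      ⟨?_, ConstraintReduction.mem_formNull_iff hj hcl h P hP⟩,
    φ, Φ, Ψ, hφ, hbij, fun X Y Z h1 h2 => hΦ X Y Z h1 h2, hΨ, fun k a x q =>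
      ConstraintReduction.formEquiv_smul hπ P hφ (hΨ k) a x q, fun k α hα =>
      ConstraintReduction.exists_ceDiff_mem_formWobs hj hcl hπ P hP hΨ α hα, fun k α hα X => ?_⟩
  · rw [hP]
    exact ConstraintReduction.mem_algWobs_iff_sameLeaf hj hcl hπ
  · rw [hP] at hX ⊢
    exact ConstraintReduction.F_le_lieWobs hj hcl hX
  · rw [hP]
    exact ConstraintReduction.mem_lieWobs_iff hj hcl
  · rw [hP]
    exact ConstraintReduction.mem_F_iff hj hcl
  · obtain ⟨η, hη⟩ := ConstraintReduction.exists_pullback hj hcl σ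
    rw [← show η.1 = ConstraintReduction.pullback j σ.1 from funext hη]
    exact ConstraintReduction.mem_formWobs_iff hj hcl h hη P hP
  · obtain ⟨X, hX⟩ := X
    obtain ⟨Y, rfl⟩ := ConstraintReduction.toDer_bijective.surjective X
    obtain ⟨Z, hYZ⟩ : ∃ Z : ConstraintReduction.VF ES S, ConstraintReduction.Restricts j Y Z := by
      rw [hP] at hX
      exact (ConstraintReduction.mem_derWobs_iff hj hcl).1 hX.1
    exact ConstraintReduction.exists_contract_mem_formWobs hj hcl hπ P hP hΨ α hα hYZ
      (hΦ ⟨Y.toDer, hX⟩ Y Z rfl hYZ)
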